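/- **Theorem 3.1.** Let $p$ be a prime, $\mathcal K$ a field of characteristic $p$, $n\ge 1$ and $1\le k\le n$. Let $\mathcal O(n;\underline 1)$ be the restricted divided power algebra over $\mathcal K$, with basis $x^{(\alpha)}$, $\alpha\in\mathbb Z_{\ge0}^n$, $0\le\alpha\le\tau=(p-1,\dots,p-1)$, and product $x^{(\alpha)}x^{(\beta)}=\prod_i\binom{\alpha_i+\beta_i}{\alpha_i}\,x^{(\alpha+\beta)}$, where $x^{(\alpha)}:=0$ if some $\alpha_j\ge p$. Let $D_i$ be its derivation with $D_ix^{(\alpha)}=x^{(\alpha-\epsilon_i)}$ (zero if $\alpha_i=0$), where $\epsilon_i$ is the $i$-th unit vector, and let $\mathbf W(n;\underline 1)=\mathrm{Der}_{\mathcal K}\,\mathcal O(n;\underline 1)$ be the Jacobson–Witt algebra, with basis $x^{(\alpha)}D_i$. Let $\mathbf W^+_{\mathbb Z}=\mathrm{Der}_{\mathbb Z}\,\mathbb Z[x_1,\dots,x_n]$, with $\mathbb Z$-basis $x^\alpha D_i$, $\alpha\in\mathbb Z_{\ge0}^n$, $D_i=\partial/\partial x_i$. For a Lie algebra $L$ over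 a commutative ring $R$, a *quantization* of $U(L)$ over $U(L)[[t]]$ with the algebra structure undeformed means a topological Hopf algebra structure over $R[[t]]$ on $U(L)[[t]]$, with the usual product and unit and with coproduct valued in the completed tensor square $(U(L)\otimes_R U(L))[[t]]$, which induces the standard Hopf algebra structure on $U(L)[[t]]/tU(L)[[t]]\cong U(L)$. For $a\in\mathbb Z$ write $y_a^{\langle\ell\rangle}=(y+a)(y+a+1)\cdots(y+a+\ell-1)$ and $y^{\langle \ell\rangle}=y_0^{\langle \ell\rangle}$. For given $\alpha$ and $i$ put $$A_\ell=\tfrac1{\ell!}\prod_{j=0}^{\ell-1}(\alpha_k-\delta_{ik}+j)\in\mathbb Z,\qquad B_\ell=\delta_{ik}A_{\ell-1}\ (\ell\ge1),\quad B_0=0,\qquad C_\ell=A_\ell-B_\ell,$$ and let $\bar C_\ell=\bar A_\ell-\bar B_\ell\in\mathcal K$, where $\bar A_\ell=\ell!\binom{\alpha_k+\ell}{\ell}A_\ell \bmod p$ and $\bar B_\ell=\ell!\binom{\alpha_k+\ell}{\ell}B_\ell\bmod p$. (i) The elements $h=x^{(\epsilon_k)}D_k$ and $e=2x^{(2\epsilon_k)}D_k$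 of $\mathbf W(n;\underline 1)$ satisfy $[h,e]=e$, and there is a quantization of $U(\mathbf W(n;\underline 1))$ over $U(\mathbf W(n;\underline 1))[[t]]$, with the algebra structure undeformed, such that for all $0\le\alpha\le\tau$ and $1\le i\le n$ $$\Delta(x^{(\alpha)}D_i)=x^{(\alpha)}D_i\otimes(1-et)^{\alpha_k-\delta_{ik}}+\sum_{\ell=0}^{p-1}(-1)^\ell\,\bar C_\ell\,h^{\langle\ell\rangle}\otimes(1-et)^{-\ell}\,x^{(\alpha+\ell\epsilon_k)}D_i\,t^\ell,\tag{33}$$ $$S(x^{(\alpha)}D_i)=-(1-et)^{-\alpha_k+\delta_{ik}}\Bigl(\sum_{\ell=0}^{p-1}\bar C_\ell\,x^{(\alpha+\ell\epsilon_k)}D_i\,h_1^{\langle\ell\rangle}\,t^\ell\Bigr),\tag{34}$$ $$\varepsilon(x^{(\alpha)}D_i)=0.\tag{35}$$ (ii) This quantization is the reduction, modulo $p$ and modulo the ideal $J_{\underline 1}$ spanned by the $x^\alpha D_i$ with some $\alpha_j\ge p$, of the following quantization integral form. In $\mathbf W^+_{\mathbb Z}$ put $h=x^{\epsilon_k}D_k$,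 $e=x^{2\epsilon_k}D_k$; then $[h,e]=e$, and there is a quantization of $U(\mathbf W^+_{\mathbb Z})$ over $U(\mathbf W^+_{\mathbb Z})[[t]]$, with the algebra structure undeformed, such that for all $\alpha\in\mathbb Z_{\ge0}^n$ and $1\le i\le n$ $$\Delta(x^{\alpha}D_i)=x^{\alpha}D_i\otimes(1-et)^{\alpha_k-\delta_{ik}}+\sum_{\ell\ge0}(-1)^\ell C_\ell\,h^{\langle\ell\rangle}\otimes(1-et)^{-\ell}\,x^{\alpha+\ell\epsilon_k}D_i\,t^\ell,$$ $$S(x^{\alpha}D_i)=-(1-et)^{-\alpha_k+\delta_{ik}}\Bigl(\sum_{\ell\ge0}C_\ell\,x^{\alpha+\ell\epsilon_k}D_i\,h_1^{\langle\ell\rangle}\,t^\ell\Bigr),\qquad \varepsilon(x^\alpha D_i)=0.$$ There is a ring homomorphism $\pi:U(\mathbf W^+_{\mathbb Z})\to U(\mathbf W(n;\underline 1))$ with $\pi(x^\alpha D_i)=\alpha!\,x^{(\alpha)}D_i$ for all $\alpha$ and $i$ (so that $\pi$ vanishes on $J_{\underline 1}$), where $\alpha!=\prod_j\alpha_j!$;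 applied coefficientwise to power series in $t$, it carries $\Delta$, $S$ and $\varepsilon$ of the integral form to those in (i). -/

import Mathlib

open scoped TensorProduct PowerSeries

noncomputable section

/-! ## Formal power series with coefficients in an associative algebra

For an `R`-algebra `A`, the topologically free `R⟦t⟧`-algebra on `A` is `A⟦X⟧` (the variable `X = t`
is central), and the completed tensor product of `A⟦X⟧` and `B⟦X⟧` over `R⟦X⟧` is `(A ⊗[R] B)⟦X⟧`. -/

namespace FormalAlg

section

variable {R A B C D : Type*} [CommRing R]
  [Ring A] [Algebra R A] [Ring B] [Algebra R B] [Ring C] [Algebra R C] [Ring D] [Algebra R D]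

/-- The structure map `R⟦X⟧ → A⟦X⟧`. -/
def scal (R A : Type*) [CommRing R] [Ring A] [Algebra R A] : R⟦X⟧ →+* A⟦X⟧ :=
  PowerSeries.map (algebraMap R A)

/-- The constant power series `a`. -/
def cst (a : A) : A⟦X⟧ := PowerSeries.C a

/-- The tensor `f ⊗ g` of power series, in the completed tensor product. -/
def ptensor (R : Type*) {A B : Type*} [CommRing R] [Ring A] [Algebra R A] [Ring B] [Algebra R B]
    (f : A⟦X⟧) (g : B⟦X⟧) : (A ⊗[R] B)⟦X⟧ :=
  PowerSeries.mk fun m => ∑ ij ∈ Finset.HasAntidiagonal.antidiagonal m,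
    PowerSeries.coeff ij.1 f ⊗ₜ[R] PowerSeries.coeff ij.2 g

/-- The `t`-adically convergent sum `∑ ℓ, f ℓ * t ^ ℓ`. -/
def formalSum (f : ℕ → A⟦X⟧) : A⟦X⟧ :=
  PowerSeries.mk fun m => ∑ lj ∈ Finset.HasAntidiagonal.antidiagonal m, PowerSeries.coeff lj.2 (f lj.1)

/-- The `t`-linear, `t`-adically continuous extension to `A⟦X⟧` of a linear map `A → B⟦X⟧`. -/
def extend (φ : A →ₗ[R] B⟦X⟧) (f : A⟦X⟧) : B⟦X⟧ :=
  formalSum fun i => φ (PowerSeries.coeff i f)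

/-- Coefficientwise application of a linear map. -/
def mapCoeff (φ : A →ₗ[R] B) (f : A⟦X⟧) : B⟦X⟧ :=
  PowerSeries.mk fun m => φ (PowerSeries.coeff m f)

/-- The restriction to `A ⊗ B` of the completed tensor product of two linear maps. -/
def tensorMapAux (φ : A⟦X⟧ →ₗ[R] C⟦X⟧) (ψ : B⟦X⟧ →ₗ[R] D⟦X⟧) :
    A ⊗[R] B →ₗ[R] (C ⊗[R] D)⟦X⟧ :=
  TensorProduct.lift <| LinearMap.mk₂ R (fun a b => ptensor R (φ (cst a)) (ψ (cst b)))
    (fun a a' b => by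
      ext m; simp [ptensor, cst, TensorProduct.add_tmul, Finset.sum_add_distrib])
    (fun r a b => by
      have h : (PowerSeries.C (r • a) : A⟦X⟧) = r • PowerSeries.C a := by
        ext m; simp [PowerSeries.coeff_C]
      ext m; simp [ptensor, cst, h, Finset.smul_sum, TensorProduct.smul_tmul'])
    (fun a b b' => by
      ext m; simp [ptensor, cst, TensorProduct.tmul_add, Finset.sum_add_distrib])
    (fun r a b => by
      have h : (PowerSeries.C (r • b) : B⟦X⟧) = r • PowerSeries.C b := by
        ext m; simp [PowerSeries.coeff_C]
      ext m; simp [ptensor, cst, h, Finset.smul_sum])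

/-- The completed tensor product `φ ⊗ ψ : (A ⊗ B)⟦X⟧ → (C ⊗ D)⟦X⟧`
of `R⟦X⟧`-linear maps `φ` and `ψ`. -/
def tensorMap (φ : A⟦X⟧ →ₗ[R] C⟦X⟧) (ψ : B⟦X⟧ →ₗ[R] D⟦X⟧) :
    (A ⊗[R] B)⟦X⟧ → (C ⊗[R] D)⟦X⟧ :=
  extend (tensorMapAux φ ψ)

end

/-- A (topological) Hopf algebra structure over `R⟦X⟧` on the topologically free algebra `A⟦X⟧`,
with the undeformed product and unit of `A⟦X⟧`. -/
structure FormalHopf (R A : Type*) [CommRing R] [Ring A] [Algebra R A] where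
  /-- the coproduct, an algebra morphism to the completed tensor square -/
  comul : A⟦X⟧ →ₐ[R] (A ⊗[R] A)⟦X⟧
  /-- the counit, an algebra morphism -/
  counit : A⟦X⟧ →ₐ[R] R⟦X⟧
  /-- the antipode -/
  antipode : A⟦X⟧ →ₗ[R] A⟦X⟧
  /-- `R⟦X⟧`-linearity of the algebra morphism `comul` -/
  comul_scal : ∀ c : R⟦X⟧, comul (scal R A c) = scal R (A ⊗[R] A) c
  /-- `R⟦X⟧`-linearity of the algebra morphism `counit` -/
  counit_scal : ∀ c : R⟦X⟧, counit (scal R A c) = c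
  /-- `R⟦X⟧`-linearity of `antipode` -/
  antipode_scal : ∀ (c : R⟦X⟧) (f : A⟦X⟧), antipode (scal R A c * f) = scal R A c * antipode f
  coassoc : ∀ f : A⟦X⟧,
    mapCoeff (TensorProduct.assoc R A A A).toLinearMap
      (tensorMap comul.toLinearMap LinearMap.id (comul f)) =
    tensorMap LinearMap.id comul.toLinearMap (comul f)
  counit_left : ∀ f : A⟦X⟧,
    mapCoeff (TensorProduct.lid R A).toLinearMap
      (tensorMap counit.toLinearMap LinearMap.id (comul f)) = f
  counit_right : ∀ f : A⟦X⟧,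
    mapCoeff (TensorProduct.rid R A).toLinearMap
      (tensorMap LinearMap.id counit.toLinearMap (comul f)) = f
  antipode_left : ∀ f : A⟦X⟧,
    mapCoeff (LinearMap.mul' R A) (tensorMap antipode LinearMap.id (comul f)) =
      scal R A (counit f)
  antipode_right : ∀ f : A⟦X⟧,
    mapCoeff (LinearMap.mul' R A) (tensorMap LinearMap.id antipode (comul f)) =
      scal R A (counit f)

/-- The invertible power series `1 - e t`, with inverse `∑ e ^ m t ^ m`. Its integral powers are
those of the group of units. -/
def oneSub {A : Type*} [Ring A] (e : A) : A⟦X⟧ˣ where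
  val := 1 - PowerSeries.C e * PowerSeries.X
  inv := PowerSeries.mk fun m => e ^ m
  val_inv := by
    ext m
    rw [sub_mul, one_mul, mul_assoc, map_sub, PowerSeries.coeff_C_mul]
    cases m with
    | zero => simp
    | succ m => simp [PowerSeries.coeff_succ_X_mul, pow_succ', PowerSeries.coeff_one]
  inv_val := by
    ext m
    rw [mul_sub, mul_one, ← mul_assoc, map_sub]
    cases m with
    | zero => simp
    | succ m => simp [PowerSeries.coeff_succ_mul_X, pow_succ, PowerSeries.coeff_one]

/-- The power `(1 - e t) ^ z`, for an integer `z`. -/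
def oneSubPow {A : Type*} [Ring A] (e : A) (z : ℤ) : A⟦X⟧ := ↑(oneSub e ^ z)

/-- The rising product `(x + a) (x + a + 1) ⋯ (x + a + ℓ - 1)`. -/
def rising {A : Type*} [Ring A] (x : A) (a : ℤ) : ℕ → A
  | 0 => 1
  | ℓ + 1 => rising x a ℓ * (x + (a : A) + (ℓ : A))

/-- For a map of rings `φ : A → B` over `σ : R → S`, the map `a ⊗ b ↦ φ a ⊗ φ b` on tensor
squares. -/
def tensorSq {R S A B : Type*} [CommRing R] [CommRing S] [Ring A] [Algebra R A] [Ring B]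
    [Algebra S B] (σ : R →+* S) (φ : A →+* B)
    (h : ∀ r, φ (algebraMap R A r) = algebraMap S B (σ r)) : A ⊗[R] A →ₛₗ[σ] B ⊗[S] B :=
  let φ' : A →ₛₗ[σ] B :=
    { toFun := φ
      map_add' := map_add φ
      map_smul' := fun r a => by rw [Algebra.smul_def, map_mul, h, Algebra.smul_def] }
  TensorProduct.map φ' φ'

/-- The Hopf structure `H'` on `B⟦X⟧` over `S⟦X⟧` is induced by the Hopf structure `H` on `A⟦X⟧`
over `R⟦X⟧` along the maps of rings `σ : R → S` and `φ : A → B` applied coefficientwise. -/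
structure IsInducedBy {R S A B : Type*} [CommRing R] [CommRing S] [Ring A] [Algebra R A] [Ring B]
    [Algebra S B] (σ : R →+* S) (φ : A →+* B) (H : FormalHopf R A) (H' : FormalHopf S B) :
    Prop where
  compat : ∀ r, φ (algebraMap R A r) = algebraMap S B (σ r)
  comul : ∀ f m, PowerSeries.coeff m (H'.comul (PowerSeries.map φ f)) =
    tensorSq σ φ compat (PowerSeries.coeff m (H.comul f))
  counit : ∀ f, H'.counit (PowerSeries.map φ f) = PowerSeries.map σ (H.counit f)
  antipode : ∀ f, H'.antipode (PowerSeries.map φ f) = PowerSeries.map φ (H.antipode f)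

end FormalAlg

/-! ## The standard Hopf structure of an enveloping algebra, and its quantizations -/

namespace Env

open UniversalEnvelopingAlgebra

variable (R L : Type*) [CommRing R] [LieRing L] [LieAlgebra R L]

/-- The universal enveloping algebra. -/
abbrev U : Type _ := UniversalEnvelopingAlgebra R L

section

attribute [local instance] LieRing.ofAssociativeRing

/-- The standard coproduct, `x ↦ x ⊗ 1 + 1 ⊗ x` for `x` in the Lie algebra. -/
def comul₀ : U R L →ₐ[R] U R L ⊗[R] U R L :=
  lift R
    { toFun := fun x => ι R x ⊗ₜ[R] 1 + 1 ⊗ₜ[R] ι R x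
      map_add' := fun x y => by
        rw [map_add, TensorProduct.add_tmul, TensorProduct.tmul_add]; abel
      map_smul' := fun r x => by
        rw [map_smul, smul_add, TensorProduct.smul_tmul', TensorProduct.tmul_smul]; rfl
      map_lie' := fun {x y} => by
        simp only [LieHom.map_lie, LieRing.of_associative_ring_bracket, mul_add, add_mul,
          Algebra.TensorProduct.tmul_mul_tmul, one_mul, mul_one, TensorProduct.sub_tmul,
          TensorProduct.tmul_sub]
        abel }

/-- The standard counit, `x ↦ 0` for `x` in the Lie algebra. -/
def counit₀ : U R L →ₐ[R] R := lift R 0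

/-- The standard antipode as a morphism to the opposite algebra. -/
def antipodeOp : U R L →ₐ[R] (U R L)ᵐᵒᵖ :=
  lift R
    { toFun := fun x => MulOpposite.op (-ι R x)
      map_add' := fun x y => by rw [map_add, neg_add, MulOpposite.op_add]
      map_smul' := fun r x => by rw [map_smul, ← smul_neg, MulOpposite.op_smul]; rfl
      map_lie' := fun {x y} => by
        simp only [LieHom.map_lie, LieRing.of_associative_ring_bracket, ← MulOpposite.op_mul,
          ← MulOpposite.op_sub, neg_mul_neg, neg_sub] }

/-- The standard antipode, the anti-automorphism with `x ↦ -x` for `x` in the Lie algebra. -/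
def antipode₀ : U R L →ₗ[R] U R L :=
  (MulOpposite.opLinearEquiv R).symm.toLinearMap ∘ₗ (antipodeOp R L).toLinearMap

end

/-- A Hopf structure over `R⟦X⟧` on `U(L)⟦X⟧`, with the undeformed product. -/
abbrev HopfU : Type _ := FormalAlg.FormalHopf R (U R L)

variable {L} in
/-- The image in `U(L)` of an element of the Lie algebra `L`. -/
abbrev inU (x : L) : U R L := ι R x

variable {L} in
/-- The element of `U(L)⟦X⟧` given by an element of the Lie algebra `L`. -/
def el (x : L) : (U R L)⟦X⟧ := FormalAlg.cst (ι R x)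

variable {R L}

/-- A Hopf structure on `U(L)⟦X⟧` is a quantization of `U(L)` when the identification
`U(L)⟦X⟧ / t U(L)⟦X⟧ ≅ U(L)` by the constant coefficient takes it to the standard Hopf structure
(the products agree by construction). -/
structure IsQuantization (H : HopfU R L) : Prop where
  comul : ∀ f, PowerSeries.constantCoeff (H.comul f) =
    comul₀ R L (PowerSeries.constantCoeff f)
  counit : ∀ f, PowerSeries.constantCoeff (H.counit f) =
    counit₀ R L (PowerSeries.constantCoeff f)
  antipode : ∀ f, PowerSeries.constantCoeff (H.antipode f) =
    antipode₀ R L (PowerSeries.constantCoeff f)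

end Env

/-! ## The restricted divided power algebra and the Jacobson-Witt algebra -/

/-- The restricted divided power algebra `O(n; 1)`: linear combinations of the `x^(α)` with
`0 ≤ α ≤ (p - 1, …, p - 1)`, as functions of the multi-index `α`. -/
def DivPow (p n : ℕ) (K : Type*) : Type _ := (Fin n → Fin p) → K

namespace DivPow

section

variable {p n : ℕ} {K : Type*}

instance [CommRing K] : AddCommGroup (DivPow p n K) :=
  inferInstanceAs (AddCommGroup ((Fin n → Fin p) → K))

instance [CommRing K] : Module K (DivPow p n K) :=
  inferInstanceAs (Module K ((Fin n → Fin p) → K))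

@[ext] theorem ext {f g : DivPow p n K} (h : ∀ γ, f γ = g γ) : f = g := funext h

/-- The divided power `x^(α)`; it is zero when some `α i` is at least `p`. -/
def dpow (p : ℕ) {n : ℕ} (K : Type*) [CommRing K] (α : Fin n → ℕ) : DivPow p n K :=
  fun γ => if ∀ i, (γ i : ℕ) = α i then 1 else 0

/-- The coefficient of `x^(c)` in `x^(a) x^(b)`, one variable. -/
def mc (a b c : ℕ) : ℕ := if a + b = c then (a + b).choose a else 0

/-- The coefficient of `x^(γ)` in `x^(α) x^(β)`, namely `∏ (α i + β i).choose (α i)` if `γ = α + β`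
and zero otherwise. -/
def mulCoeff (α β γ : Fin n → Fin p) : ℕ := ∏ i, mc (α i) (β i) (γ i)

variable [CommRing K]

/-- The bilinear product with `x^(α) x^(β) = ∏ (α i + β i).choose (α i) x^(α + β)`. -/
instance : Mul (DivPow p n K) :=
  ⟨fun f g γ => ∑ α, ∑ β, (mulCoeff α β γ : K) * (f α * g β)⟩

instance : One (DivPow p n K) := ⟨dpow p K 0⟩

theorem mul_apply (f g : DivPow p n K) (γ) :
    (f * g) γ = ∑ α, ∑ β, (mulCoeff α β γ : K) * (f α * g β) := rfl

theorem one_apply (γ) : (1 : DivPow p n K) γ = if ∀ i, (γ i : ℕ) = 0 then 1 else 0 := rfl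

@[simp] theorem add_apply (f g : DivPow p n K) (γ) : (f + g) γ = f γ + g γ := rfl
@[simp] theorem zero_apply (γ) : (0 : DivPow p n K) γ = 0 := rfl
@[simp] theorem smul_apply (r : K) (f : DivPow p n K) (γ) : (r • f) γ = r * f γ := rfl

theorem mulCoeff_comm (α β γ : Fin n → Fin p) : mulCoeff α β γ = mulCoeff β α γ := by
  refine Finset.prod_congr rfl fun i _ => ?_
  unfold mc
  rw [add_comm (α i : ℕ)]
  split_ifs
  · rw [Nat.choose_symm_add]
  · rfl

theorem mc_assoc (a b c d : Fin p) :
    ∑ e : Fin p, mc e c d * mc a b e = ∑ e : Fin p, mc a e d * mc b c e := by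
  have key : ∀ (f : ℕ → ℕ) (s : ℕ), (s < p ∨ f s = 0) → (∀ e, e ≠ s → f e = 0) →
      ∑ e : Fin p, f e = f s := by
    intro f s h1 h2
    by_cases hs : s < p
    · rw [Finset.sum_eq_single (⟨s, hs⟩ : Fin p)]
      · intro e _ he
        exact h2 _ fun h => he (Fin.ext h)
      · simp
    · rw [h1.resolve_left hs]
      exact Finset.sum_eq_zero fun e _ => h2 _ (by have := e.2; omega)
  have hd := d.2
  rw [key (fun e => mc e c d * mc a b e) (a + b), key (fun e => mc a e d * mc b c e) (b + c)]
  · by_cases h : (a : ℕ) + b + c = d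
    · have h' : (a : ℕ) + (b + c) = d := by omega
      simp only [mc, h, h', if_true]
      have h1 := Nat.choose_mul (n := (d : ℕ)) (k := (a : ℕ) + b) (s := (a : ℕ)) (by omega)
      rw [h1, show (d : ℕ) - a = b + c by omega, show (a : ℕ) + b - a = b by omega]
    · have h' : ¬ (a : ℕ) + (b + c) = d := by omega
      simp [mc, h, h']
  · by_cases h : (a : ℕ) + (b + c) = d
    · left; omega
    · right; simp [mc, h]
  · intro e he; simp [mc, Ne.symm he]
  · by_cases h : (a : ℕ) + b + c = d
    · left; omega
    · right; simp [mc, h]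
  · intro e he; simp [mc, Ne.symm he]

theorem mulCoeff_assoc (α β γ δ : Fin n → Fin p) :
    ∑ ε, mulCoeff ε γ δ * mulCoeff α β ε = ∑ ε, mulCoeff α ε δ * mulCoeff β γ ε := by
  simp only [mulCoeff, ← Finset.prod_mul_distrib]
  have h1 := Finset.prod_univ_sum (fun _ : Fin n => (Finset.univ : Finset (Fin p)))
    (fun i e => mc e (γ i) (δ i) * mc (α i) (β i) e)
  have h2 := Finset.prod_univ_sum (fun _ : Fin n => (Finset.univ : Finset (Fin p)))
    (fun i e => mc (α i) e (δ i) * mc (β i) (γ i) e)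
  rw [Fintype.piFinset_univ] at h1 h2
  rw [← h1, ← h2]
  exact Finset.prod_congr rfl fun i _ => mc_assoc _ _ _ _

theorem one_mul' [hp : Fact p.Prime] (f : DivPow p n K) : 1 * f = f := by
  ext γ
  have h0 : 0 < p := hp.out.pos
  rw [mul_apply, Finset.sum_eq_single (fun _ => (⟨0, h0⟩ : Fin p)),
    Finset.sum_eq_single γ]
  · simp [one_apply, mulCoeff, mc]
  · intro β _ hβ
    obtain ⟨i, hi⟩ := Function.ne_iff.mp hβ
    have : mulCoeff (fun _ => (⟨0, h0⟩ : Fin p)) β γ = 0 :=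
      Finset.prod_eq_zero (Finset.mem_univ i) (by simp [mc, Fin.val_inj, hi])
    rw [this, Nat.cast_zero, zero_mul]
  · simp
  · intro α _ hα
    have : ¬ ∀ i, (α i : ℕ) = 0 := fun h => hα (funext fun i => Fin.ext (h i))
    refine Finset.sum_eq_zero fun β _ => ?_
    rw [one_apply, if_neg this, zero_mul, mul_zero]
  · simp

theorem mul_comm' (f g : DivPow p n K) : f * g = g * f := by
  ext γ
  rw [mul_apply, mul_apply, Finset.sum_comm]
  refine Finset.sum_congr rfl fun α _ => Finset.sum_congr rfl fun β _ => ?_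
  rw [mulCoeff_comm, mul_comm (f β)]

theorem mul_assoc' (f g h : DivPow p n K) : f * g * h = f * (g * h) := by
  ext δ
  have hL : (f * g * h) δ = ∑ α, ∑ β, ∑ γ,
      ((∑ ε, mulCoeff ε γ δ * mulCoeff α β ε : ℕ) : K) * (f α * g β * h γ) := by
    simp only [mul_apply, Finset.sum_mul, Finset.mul_sum, Nat.cast_sum, Nat.cast_mul]
    rw [Finset.sum_comm]
    rw [Finset.sum_congr rfl fun γ _ => Finset.sum_comm]
    rw [Finset.sum_comm]
    refine Finset.sum_congr rfl fun α _ => ?_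
    rw [Finset.sum_congr rfl fun γ _ => Finset.sum_comm]
    rw [Finset.sum_comm]
    exact Finset.sum_congr rfl fun β _ => Finset.sum_congr rfl fun γ _ =>
      Finset.sum_congr rfl fun ε _ => by ring
  have hR : (f * (g * h)) δ = ∑ α, ∑ β, ∑ γ,
      ((∑ ε, mulCoeff α ε δ * mulCoeff β γ ε : ℕ) : K) * (f α * g β * h γ) := by
    simp only [mul_apply, Finset.sum_mul, Finset.mul_sum, Nat.cast_sum, Nat.cast_mul]
    refine Finset.sum_congr rfl fun α _ => ?_
    rw [Finset.sum_comm]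
    refine Finset.sum_congr rfl fun β _ => ?_
    rw [Finset.sum_comm]
    exact Finset.sum_congr rfl fun γ _ =>
      Finset.sum_congr rfl fun ε _ => by ring
  rw [hL, hR]
  simp only [mulCoeff_assoc]

theorem left_distrib' (f g h : DivPow p n K) : f * (g + h) = f * g + f * h := by
  ext γ
  simp only [mul_apply, add_apply, mul_add, Finset.sum_add_distrib]

theorem zero_mul' (f : DivPow p n K) : 0 * f = 0 := by
  ext γ; simp [mul_apply]

variable [hp : Fact p.Prime]

instance : CommRing (DivPow p n K) :=
  { (inferInstance : AddCommGroup (DivPow p n K)) with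
    mul_assoc := mul_assoc'
    one_mul := one_mul'
    mul_one := fun f => by rw [mul_comm', one_mul']
    mul_comm := mul_comm'
    left_distrib := left_distrib'
    right_distrib := fun f g h => by
      rw [mul_comm', left_distrib', mul_comm' h f, mul_comm' h g]
    zero_mul := zero_mul'
    mul_zero := fun f => by rw [mul_comm', zero_mul'] }

theorem smul_mul' (r : K) (f g : DivPow p n K) : r • f * g = r • (f * g) := by
  ext γ
  simp only [mul_apply, smul_apply, Finset.mul_sum]
  exact Finset.sum_congr rfl fun α _ => Finset.sum_congr rfl fun β _ => by ring

instance : Algebra K (DivPow p n K) :=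
  Algebra.ofModule smul_mul' fun r f g => by rw [mul_comm, smul_mul', mul_comm]

@[simp] theorem sub_apply (f g : DivPow p n K) (γ) : (f - g) γ = f γ - g γ := rfl

end

section

variable {p n : ℕ} {K : Type*} [CommRing K]

/-- The coefficient of `x^(c)` in `D x^(a)`, one variable. -/
def dc (a c : ℕ) : ℕ := if a = c + 1 then 1 else 0

/-- The coefficient of `x^(γ)` in `D_i x^(α)`: one if `α = γ + ε_i`, zero otherwise. -/
def derCoeff (i : Fin n) (α γ : Fin n → Fin p) : ℕ :=
  ∏ j, if j = i then dc (α j) (γ j) else if α j = γ j then 1 else 0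

/-- The linear map with `D_i x^(α) = x^(α - ε_i)`. -/
def derivLin (i : Fin n) : DivPow p n K →ₗ[K] DivPow p n K where
  toFun f := fun γ => ∑ α, (derCoeff i α γ : K) * f α
  map_add' f g := by
    funext γ
    refine Eq.trans ?_ (Finset.sum_add_distrib (s := Finset.univ)
      (f := fun α => (derCoeff i α γ : K) * f α) (g := fun α => (derCoeff i α γ : K) * g α))
    exact Finset.sum_congr rfl fun α _ => mul_add _ _ _
  map_smul' r f := by
    funext γ
    refine Eq.trans ?_ (Finset.mul_sum Finset.univ
      (fun α => (derCoeff i α γ : K) * f α) r).symm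
    exact Finset.sum_congr rfl fun α _ => mul_left_comm _ _ _

theorem derivLin_apply (i : Fin n) (f : DivPow p n K) (γ) :
    derivLin i f γ = ∑ α, (derCoeff i α γ : K) * f α := rfl

theorem sum_fin (f : ℕ → K) (s : ℕ) (h1 : s < p ∨ f s = 0) (h2 : ∀ e, e ≠ s → f e = 0) :
    ∑ e : Fin p, f e = f s := by
  by_cases hs : s < p
  · rw [Finset.sum_eq_single (⟨s, hs⟩ : Fin p)]
    · intro e _ he
      exact h2 _ fun h => he (Fin.ext h)
    · simp
  · rw [h1.resolve_left hs]
    exact Finset.sum_eq_zero fun e _ => h2 _ (by have := e.2; omega)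

theorem leibniz_one [hp : Fact p.Prime] [CharP K p] (a b c : Fin p) :
    ∑ d : Fin p, (dc d c * mc a b d : K) =
      ∑ d : Fin p, (mc d b c * dc a d : K) + ∑ d : Fin p, (mc a d c * dc b d : K) := by
  have ha := a.2
  have hb := b.2
  have hc := c.2
  have e1 : ∑ d : Fin p, (mc d b c * dc a d : K) =
      if (a : ℕ) + b = c + 1 ∧ (a : ℕ) ≠ 0 then ((c : ℕ).choose (a - 1) : K) else 0 := by
    rcases Nat.eq_zero_or_pos (a : ℕ) with h | h
    · simp [h, dc]
    · rw [sum_fin (fun d => (mc d b c * dc a d : K)) ((a : ℕ) - 1) (Or.inl (by omega))]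
      · by_cases h' : (a : ℕ) + b = c + 1
        · have h2 : (a : ℕ) - 1 + b = c := by omega
          have h3 : (a : ℕ) = a - 1 + 1 := by omega
          rw [mc, dc, if_pos h2, if_pos h3, h2, if_pos ⟨h', by omega⟩, Nat.cast_one, mul_one]
        · have h2 : ¬ (a : ℕ) - 1 + b = c := by omega
          simp [mc, h2, h']
      · intro e he
        have : ¬ (a : ℕ) = e + 1 := by omega
        simp [dc, this]
  have e2 : ∑ d : Fin p, (mc a d c * dc b d : K) =
      if (a : ℕ) + b = c + 1 ∧ (b : ℕ) ≠ 0 then ((c : ℕ).choose a : K) else 0 := by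
    rcases Nat.eq_zero_or_pos (b : ℕ) with h | h
    · simp [h, dc]
    · rw [sum_fin (fun d => (mc a d c * dc b d : K)) ((b : ℕ) - 1) (Or.inl (by omega))]
      · by_cases h' : (a : ℕ) + b = c + 1
        · have h2 : (a : ℕ) + (b - 1) = c := by omega
          have h3 : (b : ℕ) = b - 1 + 1 := by omega
          rw [mc, dc, if_pos h2, if_pos h3, h2, if_pos ⟨h', by omega⟩, Nat.cast_one, mul_one]
        · have h2 : ¬ (a : ℕ) + (b - 1) = c := by omega
          simp [mc, h2, h']
      · intro e he
        have : ¬ (b : ℕ) = e + 1 := by omega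
        simp [dc, this]
  have e3 : ∑ d : Fin p, (dc d c * mc a b d : K) =
      if (a : ℕ) + b = c + 1 then (((c : ℕ) + 1).choose a : K) else 0 := by
    by_cases hcp : (c : ℕ) + 1 < p
    · rw [sum_fin (fun d => (dc d c * mc a b d : K)) ((c : ℕ) + 1) (Or.inl hcp)]
      · by_cases h' : (a : ℕ) + b = c + 1 <;> simp [mc, dc, h']
      · intro e he; simp [dc, he]
    · have hcp' : (c : ℕ) + 1 = p := by omega
      rw [Finset.sum_eq_zero]
      · split_ifs with h
        · symm
          rw [CharP.cast_eq_zero_iff K p, hcp']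
          exact hp.out.dvd_choose_self (by omega) ha
        · rfl
      · intro d _
        have : ¬ (d : ℕ) = c + 1 := by have := d.2; omega
        simp [dc, this]
  rw [e1, e2, e3]
  by_cases h : (a : ℕ) + b = c + 1
  · rcases Nat.eq_zero_or_pos (a : ℕ) with ha0 | ha0
    · have : (b : ℕ) ≠ 0 := by omega
      simp [ha0, this]
    · rcases Nat.eq_zero_or_pos (b : ℕ) with hb0 | hb0
      · have h1 : (a : ℕ) = c + 1 := by omega
        simp [hb0, h1]
      · obtain ⟨a', ha'⟩ : ∃ a', (a : ℕ) = a' + 1 := ⟨a - 1, by omega⟩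
        rw [if_pos h, if_pos ⟨h, by omega⟩, if_pos ⟨h, by omega⟩, ha', Nat.choose_succ_succ]
        simp
  · simp [h]

theorem sum_prod (F : Fin n → Fin p → K) :
    ∑ δ : Fin n → Fin p, ∏ j, F j (δ j) = ∏ j, ∑ d, F j d := by
  rw [Finset.prod_univ_sum, Fintype.piFinset_univ]

theorem leibniz_coeff [hp : Fact p.Prime] [CharP K p] (i : Fin n) (α β γ : Fin n → Fin p) :
    ∑ δ, (derCoeff i δ γ * mulCoeff α β δ : K) =
      ∑ δ, (mulCoeff δ β γ * derCoeff i α δ : K) +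
        ∑ δ, (mulCoeff α δ γ * derCoeff i β δ : K) := by
  simp only [derCoeff, mulCoeff, Nat.cast_prod, ← Finset.prod_mul_distrib]
  rw [sum_prod (fun j d => (((if j = i then dc d (γ j) else if d = γ j then 1 else 0 : ℕ) : K) *
      (mc (α j) (β j) d : K))),
    sum_prod (fun j d => ((mc d (β j) (γ j) : K) *
      ((if j = i then dc (α j) d else if α j = d then 1 else 0 : ℕ) : K))),
    sum_prod (fun j d => ((mc (α j) d (γ j) : K) *
      ((if j = i then dc (β j) d else if β j = d then 1 else 0 : ℕ) : K)))]
  rw [← Finset.mul_prod_erase _ _ (Finset.mem_univ i),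
    ← Finset.mul_prod_erase _ _ (Finset.mem_univ i),
    ← Finset.mul_prod_erase _ _ (Finset.mem_univ i)]
  simp only [if_true]
  rw [leibniz_one, add_mul]
  congr 2
  · refine Finset.prod_congr rfl fun j hj => ?_
    have hj' := Finset.ne_of_mem_erase hj
    simp [hj']
  · refine Finset.prod_congr rfl fun j hj => ?_
    have hj' := Finset.ne_of_mem_erase hj
    simp [hj']

theorem derivLin_mul [hp : Fact p.Prime] [CharP K p] (i : Fin n) (f g : DivPow p n K) :
    derivLin i (f * g) = f * derivLin i g + g * derivLin i f := by
  ext γ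
  have hL : derivLin i (f * g) γ = ∑ α, ∑ β,
      (∑ δ, (derCoeff i δ γ * mulCoeff α β δ : K)) * (f α * g β) := by
    simp only [derivLin_apply, mul_apply, Finset.sum_mul, Finset.mul_sum]
    rw [Finset.sum_comm]
    refine Finset.sum_congr rfl fun α _ => ?_
    rw [Finset.sum_comm]
    exact Finset.sum_congr rfl fun β _ => Finset.sum_congr rfl fun δ _ => by ring
  have h1 : (f * derivLin i g) γ = ∑ α, ∑ β,
      (∑ δ, (mulCoeff α δ γ * derCoeff i β δ : K)) * (f α * g β) := by
    simp only [derivLin_apply, mul_apply, Finset.sum_mul, Finset.mul_sum]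
    refine Finset.sum_congr rfl fun α _ => ?_
    rw [Finset.sum_comm]
    exact Finset.sum_congr rfl fun β _ => Finset.sum_congr rfl fun δ _ => by ring
  have h2 : (g * derivLin i f) γ = ∑ α, ∑ β,
      (∑ δ, (mulCoeff δ β γ * derCoeff i α δ : K)) * (f α * g β) := by
    rw [mul_comm']
    simp only [derivLin_apply, mul_apply, Finset.sum_mul, Finset.mul_sum]
    rw [Finset.sum_comm]
    rw [Finset.sum_congr rfl fun β _ => Finset.sum_comm]
    rw [Finset.sum_comm]
    exact Finset.sum_congr rfl fun α _ => Finset.sum_congr rfl fun β _ =>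
      Finset.sum_congr rfl fun δ _ => by ring
  rw [add_apply, hL, h1, h2, ← Finset.sum_add_distrib]
  refine Finset.sum_congr rfl fun α _ => ?_
  rw [← Finset.sum_add_distrib]
  refine Finset.sum_congr rfl fun β _ => ?_
  rw [leibniz_coeff]; ring

/-- The derivation `D_i` of the restricted divided power algebra, `D_i x^(α) = x^(α - ε_i)`. -/
def deriv [hp : Fact p.Prime] [CharP K p] (i : Fin n) :
    Derivation K (DivPow p n K) (DivPow p n K) :=
  Derivation.mk' (derivLin i) (derivLin_mul i)

end

end DivPow

namespace Witt

/-- The Jacobson-Witt algebra `W(n; 1) = Der_K O(n; 1)`. -/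
abbrev JW (p n : ℕ) (K : Type*) [Field K] [Fact p.Prime] : Type _ :=
  Derivation K (DivPow p n K) (DivPow p n K)

/-- The element `x^(α) D_i` of `W(n; 1)`; it is zero when some `α j` is at least `p`. -/
def xD (p : ℕ) {n : ℕ} (K : Type*) [Field K] [Fact p.Prime] [CharP K p] (α : Fin n → ℕ)
    (i : Fin n) : JW p n K :=
  DivPow.dpow p K α • DivPow.deriv i

/-- The Lie algebra `W⁺` of derivations of a polynomial ring, with `R`-basis the `x^α D_i`. -/
abbrev WPlus (R : Type*) [CommRing R] (n : ℕ) : Type _ :=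
  Derivation R (MvPolynomial (Fin n) R) (MvPolynomial (Fin n) R)

/-- The element `x^α D_i` of `W⁺`. -/
def xDPlus (R : Type*) [CommRing R] {n : ℕ} (α : Fin n →₀ ℕ) (i : Fin n) : WPlus R n :=
  MvPolynomial.monomial α (1 : R) • MvPolynomial.pderiv i

/-- The Kronecker symbol. -/
def kron {n : ℕ} (i k : Fin n) : ℤ := if i = k then 1 else 0

/-- `A_ℓ = (∏_{j < ℓ} (a - δ_{ik} + j)) / ℓ!`; the quotient is exact (`coeffA_spec`). Here `a`
stands for `α_k`. -/
def coeffA {n : ℕ} (a : ℕ) (i k : Fin n) (ℓ : ℕ) : ℤ :=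
  (∏ j ∈ Finset.range ℓ, ((a : ℤ) - kron i k + (j : ℤ))) / (ℓ.factorial : ℤ)

theorem coeffA_spec {n : ℕ} (a : ℕ) (i k : Fin n) (ℓ : ℕ) :
    (ℓ.factorial : ℤ) * coeffA a i k ℓ = ∏ j ∈ Finset.range ℓ, ((a : ℤ) - kron i k + (j : ℤ)) := by
  refine Int.mul_ediv_cancel' ⟨Ring.multichoose ((a : ℤ) - kron i k) ℓ, ?_⟩
  have h := Ring.factorial_nsmul_multichoose_eq_ascPochhammer ((a : ℤ) - kron i k) ℓ
  rw [nsmul_eq_mul, Polynomial.ascPochhammer_smeval_eq_eval] at h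
  rw [h]
  clear h
  induction ℓ with
  | zero => simp
  | succ ℓ ih => rw [Finset.prod_range_succ, ih, ascPochhammer_succ_eval]

/-- `B_ℓ = δ_{ik} A_{ℓ-1}`, with `B_0 = 0`. -/
def coeffB {n : ℕ} (a : ℕ) (i k : Fin n) : ℕ → ℤ
  | 0 => 0
  | ℓ + 1 => kron i k * coeffA a i k ℓ

/-- `C_ℓ = A_ℓ - B_ℓ`. -/
def coeffC {n : ℕ} (a : ℕ) (i k : Fin n) (ℓ : ℕ) : ℤ := coeffA a i k ℓ - coeffB a i k ℓ

/-- `C̄_ℓ = Ā_ℓ - B̄_ℓ` in the field `K` of characteristic `p`, where `Ā_ℓ` and `B̄_ℓ` are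
`ℓ! (α_k + ℓ).choose ℓ` times `A_ℓ` and `B_ℓ` modulo `p`. -/
def coeffCbar {n : ℕ} (K : Type*) [Field K] (a : ℕ) (i k : Fin n) (ℓ : ℕ) : K :=
  ((ℓ.factorial * (a + ℓ).choose ℓ * coeffA a i k ℓ : ℤ) : K) -
    ((ℓ.factorial * (a + ℓ).choose ℓ * coeffB a i k ℓ : ℤ) : K)

end Witt

end

open FormalAlg Env Witt

open scoped TensorProduct PowerSeries

/-! Only a few features of the two Witt algebras matter: a ℤ-grading, an element `h` acting on
weight `w` as the scalar `w`, an element `e` of weight one, and operators `d ℓ` that behave like (ad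
e)^ℓ / ℓ!. These are collected in `JordanianDatum`, and every such datum yields a quantization in
which Δ(x) = x ⊗ (1 - et)^w + ∑ (-1)^ℓ h^⟨ℓ⟩ ⊗ (1 - et)^(-ℓ) d_ℓ(x) t^ℓ for x of weight w. No
twisting element is used, so no ℓ! is ever inverted and the construction works over any commutative
ring.

Everything reduces to commutation rules. Multiplication by 1 - et shifts the parameter `c` of the
series `T` by +1 and that of `Psi` by -1, while an element of weight w shifts `h` by w. These shifts
fit together so that Δ respects brackets on the Lie algebra (`Phi_lie`, `Psi_lie`, `Phi_mul_Psi`),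
and so does the morphism `twist` from which S is built. Maps that are additive and commute with t
are determined by constants, so the Hopf axioms only have to be checked on homogeneous x. There,
coassociativity is a Vandermonde identity (`rising_add_mul`) for G = h and v = (1 - et)^(-1), which
satisfy Gv = vG + v² - v. The left antipode axiom holds term by term, and the right one is a second
identity of Vandermonde type (`sum_rising_mul_rising_neg`).

For the integral form, `d ℓ` multiplies x^α D_i by C_ℓ and raises α_k by ℓ. The datum identities
follow from those of ad e because the Lie ring is torsion free. The morphism x^α D_i ↦ α! x^(α) D_i
has image spanning W(n; 1) over K, since α! is invertible when all α_j < p. Being linear, all the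
identities pass to W(n; 1), and C_ℓ becomes C̄_ℓ because (α + ℓ ε_k)! = α! ℓ! (α_k + ℓ choose ℓ).
Since the Hopf structure is built from the datum, compatible data give compatible quantizations
(`isInducedBy`). -/

noncomputable section

/-! ### Maps of power series commuting with the variable, formal sums, completed tensor products. -/

namespace FormalAlg

open PowerSeries
open Finset hiding antidiagonal mem_antidiagonal
open Finset.HasAntidiagonal (antidiagonal mem_antidiagonal)

/-- Additive maps of power series commuting with multiplication by the variable; these are
automatically continuous. -/
structure IsXLinear {A B : Type*} [Ring A] [Ring B] (φ : A⟦X⟧ → B⟦X⟧) : Prop where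
  map_add : ∀ f g, φ (f + g) = φ f + φ g
  map_X_mul : ∀ f, φ (X * f) = X * φ f

section

variable {A B B' : Type*} [Ring A] [Ring B] [Ring B']

namespace IsXLinear

variable {φ ψ : A⟦X⟧ → B⟦X⟧}

theorem map_zero (hφ : IsXLinear φ) : φ 0 = 0 := by
  have := hφ.map_add 0 0
  simpa using this

/-- Writing f = X·g + const, the coefficient m + 1 of φ f involves g only through the coefficient m
of φ g, so induction on m needs no continuity hypothesis. -/
theorem ext (hφ : IsXLinear φ) (hψ : IsXLinear ψ) (h : ∀ a, φ (C a) = ψ (C a)) (f : A⟦X⟧) :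
    φ f = ψ f := by
  ext m
  induction m generalizing f with
  | zero =>
    rw [f.eq_X_mul_shift_add_const, hφ.map_add, hψ.map_add, hφ.map_X_mul, hψ.map_X_mul, h]
    simp
  | succ m ih =>
    rw [f.eq_X_mul_shift_add_const, hφ.map_add, hψ.map_add, hφ.map_X_mul, hψ.map_X_mul, h,
      _root_.map_add, _root_.map_add, coeff_succ_X_mul, coeff_succ_X_mul, ih]

theorem comp {χ : B⟦X⟧ → B'⟦X⟧} (hχ : IsXLinear χ) (hφ : IsXLinear φ) :
    IsXLinear fun f => χ (φ f) :=
  ⟨fun f g => by rw [hφ.map_add, hχ.map_add], fun f => by rw [hφ.map_X_mul, hχ.map_X_mul]⟩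

theorem id : IsXLinear fun f : A⟦X⟧ => f := ⟨fun _ _ => rfl, fun _ => rfl⟩

theorem mul_left (hφ : IsXLinear φ) (g : B⟦X⟧) : IsXLinear fun f => g * φ f :=
  ⟨fun f f' => by rw [hφ.map_add, mul_add], fun f => by
    rw [hφ.map_X_mul, ← mul_assoc, ← mul_assoc, X_mul]⟩

theorem mul_right (hφ : IsXLinear φ) (g : B⟦X⟧) : IsXLinear fun f => φ f * g :=
  ⟨fun f f' => by rw [hφ.map_add, add_mul], fun f => by rw [hφ.map_X_mul, mul_assoc]⟩

theorem of_ringHom (φ : A⟦X⟧ →+* B⟦X⟧) (h : φ X = X) : IsXLinear φ :=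
  ⟨_root_.map_add φ, fun f => by rw [map_mul, h]⟩

theorem map (σ : A →+* B) : IsXLinear (PowerSeries.map σ) := of_ringHom _ (by simp)

end IsXLinear

theorem formalSum_eq (f : ℕ → A⟦X⟧) :
    formalSum f = f 0 + X * formalSum fun ℓ => f (ℓ + 1) := by
  ext m
  cases m with
  | zero => simp [formalSum]
  | succ m =>
    rw [map_add, coeff_succ_X_mul, formalSum, formalSum, coeff_mk, coeff_mk,
      Nat.sum_antidiagonal_succ]

/-- Peeling off the first term, ∑ f_ℓ t^ℓ = f_0 + t ∑ f_{ℓ+1} t^ℓ, gives the same coefficient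
recursion on both sides. This is the automatic continuity used throughout. -/
theorem IsXLinear.map_formalSum {φ : A⟦X⟧ → B⟦X⟧} (hφ : IsXLinear φ) (f : ℕ → A⟦X⟧) :
    φ (formalSum f) = formalSum fun ℓ => φ (f ℓ) := by
  ext m
  induction m generalizing f with
  | zero => rw [formalSum_eq f, hφ.map_add, hφ.map_X_mul, formalSum_eq fun ℓ => φ (f ℓ)]; simp
  | succ m ih =>
    rw [formalSum_eq f, hφ.map_add, hφ.map_X_mul, formalSum_eq fun ℓ => φ (f ℓ), _root_.map_add,
      _root_.map_add,
      coeff_succ_X_mul, coeff_succ_X_mul, ih]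

theorem mul_formalSum (g : A⟦X⟧) (f : ℕ → A⟦X⟧) :
    g * formalSum f = formalSum fun ℓ => g * f ℓ :=
  (IsXLinear.id.mul_left g).map_formalSum f

theorem formalSum_mul (f : ℕ → A⟦X⟧) (g : A⟦X⟧) :
    formalSum f * g = formalSum fun ℓ => f ℓ * g :=
  (IsXLinear.id.mul_right g).map_formalSum f

theorem formalSum_add (f g : ℕ → A⟦X⟧) :
    formalSum (fun ℓ => f ℓ + g ℓ) = formalSum f + formalSum g := by
  ext m; simp [formalSum, sum_add_distrib]

theorem formalSum_neg (f : ℕ → A⟦X⟧) : formalSum (fun ℓ => -f ℓ) = -formalSum f := by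
  ext m; simp [formalSum]

theorem formalSum_sub (f g : ℕ → A⟦X⟧) :
    formalSum (fun ℓ => f ℓ - g ℓ) = formalSum f - formalSum g := by
  ext m; simp [formalSum]

theorem formalSum_smul {R : Type*} [CommRing R] [Algebra R A] (r : R) (f : ℕ → A⟦X⟧) :
    formalSum (fun ℓ => r • f ℓ) = r • formalSum f := by
  ext m; simp [formalSum, smul_sum]

theorem formalSum_zero : formalSum (fun _ => (0 : A⟦X⟧)) = 0 := by
  ext m; simp [formalSum]

theorem formalSum_eq_single (f : ℕ → A⟦X⟧) (h : ∀ ℓ, f (ℓ + 1) = 0) : formalSum f = f 0 := by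
  rw [formalSum_eq]; simp [h, formalSum_zero]

theorem formalSum_eq_sum_range (f : ℕ → A⟦X⟧) (p : ℕ) (h : ∀ ℓ, p ≤ ℓ → f ℓ = 0) :
    formalSum f = ∑ ℓ ∈ range p, f ℓ * X ^ ℓ := by
  induction p generalizing f with
  | zero =>
    rw [show f = fun _ => 0 from funext fun ℓ => h ℓ (Nat.zero_le _), formalSum_zero]; simp
  | succ p ih =>
    rw [formalSum_eq, sum_range_succ', ih _ fun ℓ hℓ => h _ (by omega), mul_sum, add_comm]
    simp only [pow_zero, mul_one, add_left_inj]
    exact sum_congr rfl fun ℓ _ => by rw [pow_succ, X_mul, mul_assoc]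

/-- A double formal sum, arranged by total degree. -/
theorem formalSum_formalSum (f : ℕ → ℕ → A⟦X⟧) :
    formalSum (fun ℓ => formalSum (f ℓ)) = formalSum fun N => ∑ ij ∈ antidiagonal N, f ij.1 ij.2 := by
  ext m
  simp only [formalSum, coeff_mk, map_sum]
  rw [sum_sigma', sum_sigma']
  refine sum_bij' (fun x _ => ⟨(x.1.1 + x.2.1, x.2.2), (x.1.1, x.2.1)⟩)
    (fun x _ => ⟨(x.2.1, x.2.2 + x.1.2), (x.2.2, x.1.2)⟩) ?_ ?_ ?_ ?_ ?_
  · rintro ⟨⟨a, b⟩, ⟨c, d⟩⟩ h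
    simp only [mem_sigma, mem_antidiagonal] at h ⊢; grind
  · rintro ⟨⟨a, b⟩, ⟨c, d⟩⟩ h
    simp only [mem_sigma, mem_antidiagonal] at h ⊢; grind
  · rintro ⟨⟨a, b⟩, ⟨c, d⟩⟩ h
    simp only [mem_sigma, mem_antidiagonal] at h
    obtain ⟨h1, rfl⟩ := h; rfl
  · rintro ⟨⟨a, b⟩, ⟨c, d⟩⟩ h
    simp only [mem_sigma, mem_antidiagonal] at h
    obtain ⟨h1, rfl⟩ := h; rfl
  · rintro ⟨⟨a, b⟩, ⟨c, d⟩⟩ h; rfl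

end

section

variable {R A B C D : Type*} [CommRing R]
  [Ring A] [Algebra R A] [Ring B] [Algebra R B] [Ring C] [Algebra R C] [Ring D] [Algebra R D]

theorem C_smul (r : R) (a : A) : (PowerSeries.C (r • a) : A⟦X⟧) = r • PowerSeries.C a := by
  rw [Algebra.smul_def, Algebra.smul_def, map_mul, PowerSeries.algebraMap_apply]

/-- Both sides commute with X as functions of the scalar series, so `IsXLinear.ext` in that variable
leaves only R-linearity. -/
theorem IsXLinear.map_scal_mul {φ : A⟦X⟧ →ₗ[R] B⟦X⟧} (hφ : IsXLinear φ) (c : R⟦X⟧) (f : A⟦X⟧) :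
    φ (scal R A c * f) = scal R B c * φ f := by
  refine IsXLinear.ext (φ := fun c => φ (scal R A c * f)) (ψ := fun c => scal R B c * φ f)
    (hφ.comp ((IsXLinear.map _).mul_right f)) ((IsXLinear.map _).mul_right (φ f)) (fun r => ?_) c
  simp only [scal, map_C]
  rw [← PowerSeries.algebraMap_apply, ← PowerSeries.algebraMap_apply, ← Algebra.smul_def,
    ← Algebra.smul_def, map_smul]

theorem scal_mul_comm (c : R⟦X⟧) (f : A⟦X⟧) : scal R A c * f = f * scal R A c := by
  refine IsXLinear.ext (φ := fun c => scal R A c * f) (ψ := fun c => f * scal R A c)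
    ((IsXLinear.map _).mul_right f) ((IsXLinear.map _).mul_left f) (fun r => ?_) c
  simp only [scal, map_C]
  rw [← PowerSeries.algebraMap_apply, Algebra.commutes]

/-! ### The continuous extension of a linear map -/

theorem coeff_extend (φ : A →ₗ[R] B⟦X⟧) (f : A⟦X⟧) (m : ℕ) :
    PowerSeries.coeff m (extend φ f) =
      ∑ ij ∈ antidiagonal m, PowerSeries.coeff ij.2 (φ (PowerSeries.coeff ij.1 f)) := by
  simp [extend, formalSum]

theorem isXLinear_extend (φ : A →ₗ[R] B⟦X⟧) : IsXLinear (extend φ) where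
  map_add f g := by
    ext m; simp [coeff_extend, sum_add_distrib]
  map_X_mul f := by
    rw [extend, formalSum_eq]
    simp only [coeff_zero_X_mul, map_zero, zero_add, coeff_succ_X_mul]
    rfl

@[simp] theorem extend_C (φ : A →ₗ[R] B⟦X⟧) (a : A) : extend φ (PowerSeries.C a) = φ a := by
  rw [extend, formalSum_eq_single _ fun ℓ => by rw [coeff_succ_C, map_zero], coeff_zero_C]

theorem extend_smul (φ : A →ₗ[R] B⟦X⟧) (r : R) (f : A⟦X⟧) : extend φ (r • f) = r • extend φ f := by
  ext m; simp [coeff_extend, smul_sum]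

/-- The extension as a linear map. -/
def extendLin (φ : A →ₗ[R] B⟦X⟧) : A⟦X⟧ →ₗ[R] B⟦X⟧ where
  toFun := extend φ
  map_add' := (isXLinear_extend φ).map_add
  map_smul' := extend_smul φ

/-- Applying `IsXLinear.ext` to one factor and then to the other reduces multiplicativity to
constants. The same double reduction recurs for every bilinear identity below. -/
theorem extend_mul (φ : A →ₐ[R] B⟦X⟧) (f g : A⟦X⟧) :
    extend φ.toLinearMap (f * g) = extend φ.toLinearMap f * extend φ.toLinearMap g := by
  have hX := isXLinear_extend φ.toLinearMap
  refine IsXLinear.ext (φ := fun f => extend φ.toLinearMap (f * g))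
    (ψ := fun f => extend φ.toLinearMap f * extend φ.toLinearMap g)
    (hX.comp (IsXLinear.id.mul_right g)) (hX.mul_right _) (fun a => ?_) f
  refine IsXLinear.ext (φ := fun g => extend φ.toLinearMap (PowerSeries.C a * g))
    (ψ := fun g => extend φ.toLinearMap (PowerSeries.C a) * extend φ.toLinearMap g)
    (hX.comp (IsXLinear.id.mul_left _)) (hX.mul_left _) (fun b => ?_) g
  simp only [← map_mul (PowerSeries.C (R := A)), extend_C]
  simp

/-- The continuous extension of an algebra morphism is an algebra morphism. -/
def extendAlgHom (φ : A →ₐ[R] B⟦X⟧) : A⟦X⟧ →ₐ[R] B⟦X⟧ :=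
  AlgHom.ofLinearMap (extendLin φ.toLinearMap)
    (by
      change extend φ.toLinearMap 1 = 1
      rw [← map_one (PowerSeries.C (R := A)), extend_C]; simp)
    (extend_mul φ)

@[simp] theorem extendAlgHom_C (φ : A →ₐ[R] B⟦X⟧) (a : A) :
    extendAlgHom φ (PowerSeries.C a) = φ a := extend_C φ.toLinearMap a

theorem isXLinear_extendAlgHom (φ : A →ₐ[R] B⟦X⟧) : IsXLinear (extendAlgHom φ) :=
  isXLinear_extend φ.toLinearMap

theorem isXLinear_mapCoeff (φ : A →ₗ[R] B) : IsXLinear (mapCoeff φ) where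
  map_add f g := by ext m; simp [mapCoeff]
  map_X_mul f := by
    ext m
    cases m with
    | zero => simp [mapCoeff]
    | succ m => rw [coeff_succ_X_mul, mapCoeff, coeff_mk, coeff_succ_X_mul, mapCoeff, coeff_mk]

theorem IsXLinear.map_X {φ : A⟦X⟧ →ₐ[R] B⟦X⟧} (hφ : IsXLinear φ) : φ X = X := by
  have := hφ.map_X_mul 1
  simpa using this

theorem IsXLinear.map_scal {φ : A⟦X⟧ →ₐ[R] B⟦X⟧} (hφ : IsXLinear φ) (c : R⟦X⟧) :
    φ (scal R A c) = scal R B c := by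
  have := IsXLinear.map_scal_mul (φ := φ.toLinearMap) hφ c 1
  simpa using this

/-! ### Completed tensor products -/

/-- The morphism `f ↦ f ⊗ 1`. -/
def inl (R A B : Type*) [CommRing R] [Ring A] [Algebra R A] [Ring B] [Algebra R B] :
    A⟦X⟧ →ₐ[R] (A ⊗[R] B)⟦X⟧ :=
  PowerSeries.mapAlgHom Algebra.TensorProduct.includeLeft

/-- The morphism `g ↦ 1 ⊗ g`. -/
def inr (R A B : Type*) [CommRing R] [Ring A] [Algebra R A] [Ring B] [Algebra R B] :
    B⟦X⟧ →ₐ[R] (A ⊗[R] B)⟦X⟧ :=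
  PowerSeries.mapAlgHom Algebra.TensorProduct.includeRight

theorem isXLinear_inl : IsXLinear (inl R A B) := IsXLinear.map _
theorem isXLinear_inr : IsXLinear (inr R A B) := IsXLinear.map _

@[simp] theorem inl_C (a : A) : inl R A B (PowerSeries.C a) = PowerSeries.C (a ⊗ₜ 1) :=
  PowerSeries.map_C _ _

@[simp] theorem inr_C (b : B) : inr R A B (PowerSeries.C b) = PowerSeries.C (1 ⊗ₜ b) :=
  PowerSeries.map_C _ _

theorem coeff_inl (f : A⟦X⟧) (m : ℕ) :
    PowerSeries.coeff m (inl R A B f) = PowerSeries.coeff m f ⊗ₜ 1 := PowerSeries.coeff_map _ _ _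

theorem coeff_inr (g : B⟦X⟧) (m : ℕ) :
    PowerSeries.coeff m (inr R A B g) = 1 ⊗ₜ PowerSeries.coeff m g := PowerSeries.coeff_map _ _ _

/-- Tensors become products of two commuting images inside one ring, so that tensor computations
turn into ring computations. -/
theorem ptensor_eq (f : A⟦X⟧) (g : B⟦X⟧) : ptensor R f g = inl R A B f * inr R A B g := by
  ext m
  simp [ptensor, coeff_inl, coeff_inr, PowerSeries.coeff_mul]

theorem inl_mul_inr (f : A⟦X⟧) (g : B⟦X⟧) :
    inr R A B g * inl R A B f = inl R A B f * inr R A B g := by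
  refine IsXLinear.ext (φ := fun f => inr R A B g * inl R A B f)
    (ψ := fun f => inl R A B f * inr R A B g)
    (isXLinear_inl.mul_left _) (isXLinear_inl.mul_right _) (fun a => ?_) f
  refine IsXLinear.ext (φ := fun g => inr R A B g * inl R A B (PowerSeries.C a))
    (ψ := fun g => inl R A B (PowerSeries.C a) * inr R A B g)
    (isXLinear_inr.mul_right _) (isXLinear_inr.mul_left _) (fun b => ?_) g
  simp only [inl_C, inr_C, ← map_mul]
  simp

theorem ptensor_C (a : A) (b : B) :
    ptensor R (PowerSeries.C a) (PowerSeries.C b) = PowerSeries.C (a ⊗ₜ[R] b) := by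
  rw [ptensor_eq, inl_C, inr_C, ← map_mul]; simp

theorem ptensor_mul (f f' : A⟦X⟧) (g g' : B⟦X⟧) :
    ptensor R f g * ptensor R f' g' = ptensor R (f * f') (g * g') := by
  simp only [ptensor_eq, map_mul]
  rw [mul_assoc, ← mul_assoc (inr R A B g), inl_mul_inr]
  simp only [mul_assoc]

theorem isXLinear_ptensor_left (g : B⟦X⟧) : IsXLinear fun f : A⟦X⟧ => ptensor R f g := by
  simp only [ptensor_eq]; exact isXLinear_inl.mul_right _

theorem isXLinear_ptensor_right (f : A⟦X⟧) : IsXLinear fun g : B⟦X⟧ => ptensor R f g := by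
  simp only [ptensor_eq]; exact isXLinear_inr.mul_left _

theorem isXLinear_tensorMap (φ : A⟦X⟧ →ₗ[R] C⟦X⟧) (ψ : B⟦X⟧ →ₗ[R] D⟦X⟧) :
    IsXLinear (tensorMap φ ψ) := isXLinear_extend _

/-- `tensorMap` is built from the values of φ and ψ on constants only; their X-linearity is what
makes it correct on tensors of arbitrary series. -/
theorem tensorMap_ptensor {φ : A⟦X⟧ →ₗ[R] C⟦X⟧} {ψ : B⟦X⟧ →ₗ[R] D⟦X⟧} (hφ : IsXLinear φ)
    (hψ : IsXLinear ψ) (f : A⟦X⟧) (g : B⟦X⟧) :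
    tensorMap φ ψ (ptensor R f g) = ptensor R (φ f) (ψ g) := by
  refine IsXLinear.ext (φ := fun f => tensorMap φ ψ (ptensor R f g))
    (ψ := fun f => ptensor R (φ f) (ψ g)) ((isXLinear_tensorMap φ ψ).comp
      (isXLinear_ptensor_left g)) ((isXLinear_ptensor_left _).comp hφ) (fun a => ?_) f
  refine IsXLinear.ext (φ := fun g => tensorMap φ ψ (ptensor R (PowerSeries.C a) g))
    (ψ := fun g => ptensor R (φ (PowerSeries.C a)) (ψ g)) ((isXLinear_tensorMap φ ψ).comp
      (isXLinear_ptensor_right _)) ((isXLinear_ptensor_right _).comp hψ) (fun b => ?_) g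
  rw [ptensor_C, tensorMap, extend_C]
  rfl

/-- `X`-linear maps on a completed tensor product agree if they agree on constant pure tensors. -/
theorem IsXLinear.ext_tensor {E : Type*} [Ring E] {φ ψ : (A ⊗[R] B)⟦X⟧ → E⟦X⟧}
    (hφ : IsXLinear φ) (hψ : IsXLinear ψ)
    (h : ∀ a b, φ (ptensor R (PowerSeries.C a) (PowerSeries.C b)) =
      ψ (ptensor R (PowerSeries.C a) (PowerSeries.C b))) (f) : φ f = ψ f := by
  refine hφ.ext hψ (fun z => ?_) f
  induction z using TensorProduct.induction_on with
  | zero => rw [_root_.map_zero, hφ.map_zero, hψ.map_zero]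
  | tmul a b => simpa only [ptensor_C] using h a b
  | add x y hx hy => rw [_root_.map_add, hφ.map_add, hψ.map_add, hx, hy]

theorem tensorMap_mul {φ : A⟦X⟧ →ₐ[R] C⟦X⟧} {ψ : B⟦X⟧ →ₐ[R] D⟦X⟧} (hφ : IsXLinear φ)
    (hψ : IsXLinear ψ) (f g : (A ⊗[R] B)⟦X⟧) :
    tensorMap φ.toLinearMap ψ.toLinearMap (f * g) =
      tensorMap φ.toLinearMap ψ.toLinearMap f * tensorMap φ.toLinearMap ψ.toLinearMap g := by
  have hX := isXLinear_tensorMap φ.toLinearMap ψ.toLinearMap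
  have hT := tensorMap_ptensor (φ := φ.toLinearMap) (ψ := ψ.toLinearMap) hφ hψ
  refine IsXLinear.ext_tensor (hX.comp (IsXLinear.id.mul_right g)) (hX.mul_right _)
    (fun a b => ?_) f
  refine IsXLinear.ext_tensor (hX.comp (IsXLinear.id.mul_left _)) (hX.mul_left _)
    (fun c d => ?_) g
  rw [ptensor_mul, hT, hT, hT, ptensor_mul]
  simp

/-- The completed tensor product of algebra morphisms. -/
def tensorAlgHom {φ : A⟦X⟧ →ₐ[R] C⟦X⟧} {ψ : B⟦X⟧ →ₐ[R] D⟦X⟧} (hφ : IsXLinear φ)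
    (hψ : IsXLinear ψ) : (A ⊗[R] B)⟦X⟧ →ₐ[R] (C ⊗[R] D)⟦X⟧ :=
  AlgHom.ofLinearMap (extendLin (tensorMapAux φ.toLinearMap ψ.toLinearMap))
    (by
      have := tensorMap_ptensor (φ := φ.toLinearMap) (ψ := ψ.toLinearMap) hφ hψ 1 1
      simp only [ptensor_eq, map_one, mul_one, AlgHom.toLinearMap_apply] at this
      exact this)
    (tensorMap_mul hφ hψ)

theorem tensorAlgHom_apply {φ : A⟦X⟧ →ₐ[R] C⟦X⟧} {ψ : B⟦X⟧ →ₐ[R] D⟦X⟧} (hφ : IsXLinear φ)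
    (hψ : IsXLinear ψ) (f) :
    tensorAlgHom hφ hψ f = tensorMap φ.toLinearMap ψ.toLinearMap f := rfl

end

end FormalAlg

namespace FormalAlg

/-! ### Rising products -/

section rising

variable {A B : Type*} [Ring A] [Ring B]

theorem rising_zero (x : A) (a : ℤ) : rising x a 0 = 1 := rfl

theorem rising_succ (x : A) (a : ℤ) (ℓ : ℕ) :
    rising x a (ℓ + 1) = rising x a ℓ * (x + (a : A) + (ℓ : A)) := rfl

theorem map_rising (φ : A →+* B) (x : A) (a : ℤ) (ℓ : ℕ) :
    φ (rising x a ℓ) = rising (φ x) a ℓ := by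
  induction ℓ with
  | zero => simp [rising_zero]
  | succ ℓ ih => simp [rising_succ, ih]

theorem commute_rising {x y : A} (h : Commute y x) (a : ℤ) (ℓ : ℕ) : Commute y (rising x a ℓ) := by
  induction ℓ with
  | zero => exact Commute.one_right y
  | succ ℓ ih =>
    exact ih.mul_right ((h.add_right (Int.commute_cast y a)).add_right (Nat.commute_cast y ℓ))

theorem rising_succ' (x : A) (a : ℤ) (ℓ : ℕ) :
    rising x a (ℓ + 1) = (x + (a : A)) * rising x (a + 1) ℓ := by
  induction ℓ with
  | zero => simp [rising]
  | succ ℓ ih =>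
    rw [rising_succ, ih, rising_succ x (a + 1) ℓ, mul_assoc]
    congr 2
    push_cast; abel

theorem rising_add (x : A) (a : ℤ) (m ℓ : ℕ) :
    rising x a (m + ℓ) = rising x a m * rising x (a + m) ℓ := by
  induction ℓ with
  | zero => simp [rising_zero]
  | succ ℓ ih =>
    rw [← add_assoc, rising_succ, ih, rising_succ, mul_assoc]
    congr 2
    push_cast; abel

theorem rising_mul_of_shift {x y : A} {w : ℤ} (h : x * y = y * (x + (w : A))) (a : ℤ) (ℓ : ℕ) :
    rising x a ℓ * y = y * rising x (a + w) ℓ := by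
  induction ℓ with
  | zero => simp [rising_zero]
  | succ ℓ ih =>
    have h2 : (x + (a : A) + (ℓ : A)) * y = y * (x + ((a + w : ℤ) : A) + (ℓ : A)) := by
      rw [add_mul, add_mul, h, (Int.commute_cast y a).eq.symm, (Nat.commute_cast y ℓ).eq.symm,
        ← mul_add, ← mul_add]
      congr 1
      push_cast; abel
    rw [rising_succ, mul_assoc, h2, ← mul_assoc, ih, rising_succ, mul_assoc]

/-- Both terms on the left contain `rising x (c + 1) ℓ`, and the remaining factors add up: (x + c) +
(ℓ + 1) = x + (c + 1) + ℓ. This is what absorbs the commutator with `e` into a unit shift of the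
parameter. -/
theorem rising_step (x : A) (c : ℤ) (ℓ : ℕ) :
    rising x c (ℓ + 1) + ((ℓ : A) + 1) * rising x (c + 1) ℓ = rising x (c + 1) (ℓ + 1) := by
  rw [rising_succ', rising_succ, ← add_mul,
    ← (commute_rising (x := x) (y := x + ((c + 1 : ℤ) : A) + (ℓ : A))
      (((Commute.refl x).add_left (Int.cast_commute _ _)).add_left (Nat.cast_commute _ _)) _ _).eq]
  congr 1
  push_cast; abel

theorem rising_zero_zero_succ (ℓ : ℕ) : rising (0 : A) 0 (ℓ + 1) = 0 := by
  rw [rising_succ']; simp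

/-- For u⁻¹ the hypothesis is used at c - 1, so a rule for one unit extends to all its integral
powers. -/
theorem zpow_mul_of_shift (u : Aˣ) (F : ℤ → A) (h : ∀ c, F c * u = u * F (c + 1)) (c z : ℤ) :
    F c * ((u ^ z : Aˣ) : A) = ((u ^ z : Aˣ) : A) * F (c + z) := by
  have h' : ∀ c, F c * ((u⁻¹ : Aˣ) : A) = ((u⁻¹ : Aˣ) : A) * F (c - 1) := fun c => by
    rw [Units.mul_inv_eq_iff_eq_mul, mul_assoc, h, Units.inv_mul_cancel_left, sub_add_cancel]
  induction z using Int.induction_on generalizing c with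
  | zero => simp
  | succ n ih =>
    rw [zpow_add_one, Units.val_mul, ← mul_assoc, ih, mul_assoc, h, mul_assoc, add_assoc]
  | pred n ih =>
    rw [zpow_sub_one, Units.val_mul, ← mul_assoc, ih, mul_assoc, h', mul_assoc, add_sub_assoc]

end rising

/-! ### Integral powers of 1 - et. -/

section oneSub

variable {A : Type*} [Ring A] (e : A)

theorem oneSubPow_zero : oneSubPow e 0 = 1 := by simp [oneSubPow]

theorem oneSubPow_one : oneSubPow e 1 = 1 - PowerSeries.C e * PowerSeries.X := by
  simp [oneSubPow, oneSub]

theorem oneSubPow_mul (a b : ℤ) : oneSubPow e a * oneSubPow e b = oneSubPow e (a + b) := by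
  rw [oneSubPow, oneSubPow, ← Units.val_mul, ← zpow_add]; rfl

theorem oneSubPow_mul_of_shift (F : ℤ → A⟦X⟧)
    (h : ∀ c, F c * oneSubPow e 1 = oneSubPow e 1 * F (c + 1)) (c z : ℤ) :
    F c * oneSubPow e z = oneSubPow e z * F (c + z) :=
  zpow_mul_of_shift (oneSub e) F (by simpa [oneSubPow] using h) c z

theorem map_oneSubPow {B : Type*} [Ring B] (φ : A →+* B) (z : ℤ) :
    PowerSeries.map φ (oneSubPow e z) = oneSubPow (φ e) z := by
  have h : Units.map (PowerSeries.map φ : A⟦X⟧ →* B⟦X⟧) (oneSub e) = oneSub (φ e) := by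
    ext1; simp [oneSub]
  rw [oneSubPow, oneSubPow, ← h, ← map_zpow]; rfl

theorem constantCoeff_oneSubPow (z : ℤ) : PowerSeries.constantCoeff (oneSubPow e z) = 1 := by
  have h : Units.map ((PowerSeries.constantCoeff : A⟦X⟧ →+* A) : A⟦X⟧ →* A) (oneSub e) = 1 := by
    ext1; simp [oneSub]
  have h2 := congrArg Units.val
    (map_zpow (Units.map ((PowerSeries.constantCoeff : A⟦X⟧ →+* A) : A⟦X⟧ →* A)) (oneSub e) z)
  rw [h, one_zpow] at h2
  exact h2

theorem constantCoeff_formalSum (f : ℕ → A⟦X⟧) :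
    PowerSeries.constantCoeff (formalSum f) = PowerSeries.constantCoeff (f 0) := by
  rw [formalSum_eq]; simp

theorem formalSum_add_X_mul {f g k : ℕ → A⟦X⟧} (h0 : f 0 = k 0)
    (hs : ∀ ℓ, f (ℓ + 1) + g ℓ = k (ℓ + 1)) :
    formalSum f + PowerSeries.X * formalSum g = formalSum k := by
  rw [formalSum_eq f, formalSum_eq k, h0, add_assoc, ← mul_add, ← formalSum_add]
  simp only [hs]

theorem formalSum_congr {f g : ℕ → A⟦X⟧} (h : ∀ ℓ, f ℓ = g ℓ) : formalSum f = formalSum g := by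
  rw [funext h]

end oneSub

end FormalAlg

/-! ### Graded Lie algebras with a Jordanian pair, and the morphism behind the antipode. -/

namespace Env

open FormalAlg UniversalEnvelopingAlgebra
open PowerSeries (X)

attribute [local instance 100] LieRing.ofAssociativeRing

variable {R L ι' : Type*} [CommRing R] [LieRing L] [LieAlgebra R L]

/-- The span of the basis vectors of weight `w`. -/
def weightSpace (b : Module.Basis ι' R L) (wt : ι' → ℤ) (w : ℤ) : Submodule R L :=
  Submodule.span R (b '' {i | wt i = w})

/-- A `ℤ`-graded Lie algebra, the grading being given on a basis, with elements `h` and `e` such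
that `h` acts by the weight, `e` has weight one, and the adjoint action of `e` has a system `d` of
divided powers. -/
structure JordanianDatum (R L ι' : Type*) [CommRing R] [LieRing L] [LieAlgebra R L] where
  /-- a homogeneous basis -/
  basis : Module.Basis ι' R L
  /-- the weights of the basis vectors -/
  wt : ι' → ℤ
  /-- the element acting by the weight -/
  h : L
  /-- the element of weight one -/
  e : L
  /-- the divided powers of the adjoint action of `e` -/
  d : ℕ → L →ₗ[R] L
  lie_mem : ∀ {w v x y}, x ∈ weightSpace basis wt w → y ∈ weightSpace basis wt v →
    ⁅x, y⁆ ∈ weightSpace basis wt (w + v)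
  d_mem : ∀ {w x} (ℓ : ℕ), x ∈ weightSpace basis wt w → d ℓ x ∈ weightSpace basis wt (w + ℓ)
  h_mem : h ∈ weightSpace basis wt 0
  e_mem : e ∈ weightSpace basis wt 1
  h_lie : ∀ {w x}, x ∈ weightSpace basis wt w → ⁅h, x⁆ = w • x
  d_zero : ∀ x, d 0 x = x
  d_one : ∀ x, d 1 x = ⁅e, x⁆
  -- These are the formal properties of (ad e)^ℓ / ℓ!, taken as axioms because ℓ! need not be
  -- invertible in `R`. The last two say that [e, e] = 0 and that [e, h] is a multiple of e.
  d_d : ∀ m ℓ x, d m (d ℓ x) = (m + ℓ).choose m • d (m + ℓ) x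
  d_lie : ∀ N x y, d N ⁅x, y⁆ = ∑ ij ∈ Finset.HasAntidiagonal.antidiagonal N, ⁅d ij.1 x, d ij.2 y⁆
  d_e : ∀ ℓ, d (ℓ + 1) e = 0
  d_h : ∀ ℓ, d (ℓ + 2) h = 0

theorem el_add (x y : L) : el R (x + y) = el R x + el R y := by simp [el, cst]

theorem el_smul (r : R) (x : L) : el R (r • x) = r • el R x := by
  simp only [el, cst, map_smul, C_smul]

theorem el_zero : el R (0 : L) = 0 := by simp [el, cst]

theorem el_nsmul (n : ℕ) (x : L) : el R (n • x) = (n : (U R L)⟦X⟧) * el R x := by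
  simp [el, cst]

theorem el_lie (x y : L) : el R ⁅x, y⁆ = el R x * el R y - el R y * el R x := by
  simp only [el, cst, LieHom.map_lie, LieRing.of_associative_ring_bracket, map_sub, map_mul]

theorem el_sum {κ : Type*} (s : Finset κ) (f : κ → L) :
    el R (∑ i ∈ s, f i) = ∑ i ∈ s, el R (f i) := by
  simp [el, cst]

namespace JordanianDatum

variable (D : JordanianDatum R L ι')

/-- The homogeneous component of weight `w`. -/
abbrev piece (w : ℤ) : Submodule R L := weightSpace D.basis D.wt w

theorem basis_mem (i : ι') : D.basis i ∈ D.piece (D.wt i) := Submodule.subset_span ⟨i, rfl, rfl⟩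

/-- The linear map which is `f w` on vectors of weight `w`. -/
def glue {M : Type*} [AddCommGroup M] [Module R M] (f : ℤ → L →ₗ[R] M) : L →ₗ[R] M :=
  D.basis.constr R fun i => f (D.wt i) (D.basis i)

theorem glue_of_mem {M : Type*} [AddCommGroup M] [Module R M] (f : ℤ → L →ₗ[R] M) {w : ℤ} {x : L}
    (hx : x ∈ D.piece w) : D.glue f x = f w x := by
  refine LinearMap.eqOn_span (s := D.basis '' {i | D.wt i = w}) ?_ hx
  rintro _ ⟨i, rfl, rfl⟩
  rw [glue, Module.Basis.constr_basis]

/-- Scalar multiples of basis vectors are themselves homogeneous, so no separate case for scalars is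
needed. -/
theorem weight_induction {P : L → Prop} (zero : P 0) (add : ∀ x y, P x → P y → P (x + y))
    (mem : ∀ w x, x ∈ D.piece w → P x) (x : L) : P x := by
  have hx : x ∈ Submodule.span R (Set.range D.basis) := by simp
  induction hx using Submodule.closure_induction with
  | zero => exact zero
  | add x y _ _ hx hy => exact add x y hx hy
  | smul_mem r x hx =>
    obtain ⟨i, rfl⟩ := hx
    exact mem _ _ (Submodule.smul_mem _ r (D.basis_mem i))

/-- A linear map to an associative algebra compatible with brackets of homogeneous elements is a
morphism of Lie algebras. -/
def lieHomMk {E : Type*} [Ring E] [Algebra R E] (f : L →ₗ[R] E)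
    (hf : ∀ w v x y, x ∈ D.piece w → y ∈ D.piece v → f ⁅x, y⁆ = f x * f y - f y * f x) : L →ₗ⁅R⁆ E :=
  { f with
    map_lie' := fun {x y} => by
      change f ⁅x, y⁆ = f x * f y - f y * f x
      induction x using D.weight_induction with
      | zero => simp
      | add x x' hx hx' => rw [add_lie, map_add, map_add, hx, hx', add_mul, mul_add]; abel
      | mem w x hx =>
        induction y using D.weight_induction with
        | zero => simp
        | add y y' hy hy' => rw [lie_add, map_add, map_add, hy, hy', add_mul, mul_add]; abel
        | mem v y hy => exact hf _ _ _ _ hx hy }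

@[simp] theorem lieHomMk_apply {E : Type*} [Ring E] [Algebra R E] (f : L →ₗ[R] E)
    (hf : ∀ w v x y, x ∈ D.piece w → y ∈ D.piece v → f ⁅x, y⁆ = f x * f y - f y * f x) (x : L) :
    D.lieHomMk f hf x = f x := rfl

/-- The power `(1 - e t) ^ z`. -/
abbrev P (z : ℤ) : (U R L)⟦X⟧ := oneSubPow (inU R D.e) z

/-- The element `h` as a constant power series. -/
abbrev H : (U R L)⟦X⟧ := el R D.h

theorem cst_rising_h (c : ℤ) (ℓ : ℕ) : cst (rising (inU R D.h) c ℓ) = rising D.H c ℓ :=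
  map_rising (PowerSeries.C : U R L →+* (U R L)⟦X⟧) (inU R D.h) c ℓ

theorem P_one : D.P 1 = 1 - el R D.e * X := oneSubPow_one _

theorem h_mul {w : ℤ} {x : L} (hx : x ∈ D.piece w) : D.H * el R x = el R x * (D.H + (w : (U R L)⟦X⟧)) := by
  have := el_lie (R := R) D.h x
  rw [D.h_lie hx] at this
  have h2 : el R (w • x) = el R x * (w : (U R L)⟦X⟧) := by
    simp only [el, cst, map_zsmul]
    rw [zsmul_eq_mul]
    exact (Int.cast_commute w (PowerSeries.C (ι R x))).eq
  rw [mul_add, ← h2, this]; abel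

theorem rising_h_mul {w : ℤ} {x : L} (hx : x ∈ D.piece w) (c : ℤ) (ℓ : ℕ) :
    rising D.H c ℓ * el R x = el R x * rising D.H (c + w) ℓ := rising_mul_of_shift (D.h_mul hx) c ℓ

theorem d_succ (ℓ : ℕ) (x : L) : ⁅D.e, D.d ℓ x⁆ = (ℓ + 1) • D.d (ℓ + 1) x := by
  rw [← D.d_one, D.d_d, add_comm 1 ℓ, Nat.choose_one_right]

theorem d_mul_e (ℓ : ℕ) (x : L) : el R (D.d ℓ x) * el R D.e =
    el R D.e * el R (D.d ℓ x) - ((ℓ : (U R L)⟦X⟧) + 1) * el R (D.d (ℓ + 1) x) := by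
  have := el_lie (R := R) D.e (D.d ℓ x)
  rw [D.d_succ, el_nsmul] at this
  push_cast at this
  rw [this]; abel

/-- The correction term is the bracket [e, d_ℓ x] = (ℓ + 1) d_{ℓ+1} x, multiplied by t. -/
theorem d_mul_P_one (ℓ : ℕ) (x : L) : el R (D.d ℓ x) * D.P 1 =
    D.P 1 * el R (D.d ℓ x) + X * (((ℓ : (U R L)⟦X⟧) + 1) * el R (D.d (ℓ + 1) x)) := by
  rw [P_one, mul_sub, ← mul_assoc, D.d_mul_e, sub_mul, sub_mul, PowerSeries.X_mul, mul_assoc,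
    mul_assoc (el R D.e), ← PowerSeries.X_mul (φ := el R (D.d ℓ x))]
  simp only [mul_one, one_mul, mul_assoc]
  abel

/-! ### The series `∑ x_ℓ (h + c)^⟨ℓ⟩ t^ℓ` -/

/-- The series `∑ d_ℓ(x) (h + c)^⟨ℓ⟩ t^ℓ`. -/
def T (c : ℤ) : L →ₗ[R] (U R L)⟦X⟧ where
  toFun x := formalSum fun ℓ => el R (D.d ℓ x) * rising D.H c ℓ
  map_add' x y := by simp only [map_add, el_add, add_mul, formalSum_add]
  map_smul' r x := by simp only [map_smul, el_smul, smul_mul_assoc, formalSum_smul, RingHom.id_apply]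

theorem T_apply (c : ℤ) (x : L) :
    D.T c x = formalSum fun ℓ => el R (D.d ℓ x) * rising D.H c ℓ := rfl

/-- Passing `e` to the left shifts each (h + c)^⟨ℓ⟩ to (h + c + 1)^⟨ℓ⟩ and leaves the bracket terms
(ℓ + 1) d_{ℓ+1}(x) (h + c + 1)^⟨ℓ⟩. Multiplied by t, these are exactly the difference between the
series with parameters c + 1 and c, by `rising_step`. -/
theorem T_mul_P_one (x : L) (c : ℤ) : D.T c x * D.P 1 = D.P 1 * D.T (c + 1) x := by
  have h1 : D.T c x * el R D.e = el R D.e * D.T (c + 1) x -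
      formalSum fun ℓ => ((ℓ : (U R L)⟦X⟧) + 1) * el R (D.d (ℓ + 1) x) * rising D.H (c + 1) ℓ := by
    rw [T_apply, T_apply, formalSum_mul, mul_formalSum, ← formalSum_sub]
    refine formalSum_congr fun ℓ => ?_
    rw [mul_assoc, D.rising_h_mul D.e_mem, ← mul_assoc, D.d_mul_e, sub_mul, mul_assoc]
  have h2 : D.T c x + X * formalSum (fun ℓ => ((ℓ : (U R L)⟦X⟧) + 1) * el R (D.d (ℓ + 1) x) *
      rising D.H (c + 1) ℓ) = D.T (c + 1) x := by
    rw [T_apply, T_apply]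
    refine formalSum_add_X_mul rfl fun ℓ => ?_
    rw [← rising_step D.H, mul_add, ← mul_assoc (el R _),
      ← ((Nat.cast_commute ℓ (el R (D.d (ℓ + 1) x))).add_left
        (Commute.one_left (el R (D.d (ℓ + 1) x)))).eq]
  rw [P_one, mul_sub, ← mul_assoc, h1, sub_mul, sub_mul, mul_one, one_mul, mul_assoc (el R D.e),
    ← PowerSeries.X_mul (φ := D.T (c + 1) x), ← mul_assoc (el R D.e),
    ← PowerSeries.X_mul (φ := formalSum _)]
  nth_rw 2 [← h2]
  abel

theorem T_mul_P (x : L) (c z : ℤ) : D.T c x * D.P z = D.P z * D.T (c + z) x :=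
  oneSubPow_mul_of_shift _ (fun c => D.T c x) (D.T_mul_P_one x) c z

/-- Moving (h + c - v)^⟨i⟩ past d_j(y), of weight v + j, turns it into (h + c + j)^⟨i⟩, which
continues (h + c)^⟨j⟩ to (h + c)^⟨i+j⟩. The factor in `h` then depends on i + j only, so
antisymmetrizing in x and y produces d_N of the bracket. -/
theorem T_mul_T {v : ℤ} {y : L} (x : L) (hy : y ∈ D.piece v) (c : ℤ) :
    D.T (c - v) x * D.T c y = formalSum fun N => ∑ ij ∈ Finset.HasAntidiagonal.antidiagonal N,
      el R (D.d ij.1 x) * el R (D.d ij.2 y) * rising D.H c N := by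
  rw [T_apply, formalSum_mul]
  simp only [T_apply, mul_formalSum]
  rw [formalSum_formalSum]
  refine formalSum_congr fun N => Finset.sum_congr rfl fun ij hij => ?_
  rw [mul_assoc, ← mul_assoc (rising D.H (c - v) ij.1), D.rising_h_mul (D.d_mem _ hy)]
  have h1 : c - v + (v + (ij.2 : ℤ)) = c + ij.2 := by ring
  rw [h1, mul_assoc (el R _) (rising _ _ _), (commute_rising (commute_rising (Commute.refl D.H)
    c ij.2).symm _ _).symm.eq, ← rising_add, ← mul_assoc, add_comm,
    Finset.HasAntidiagonal.mem_antidiagonal.mp hij]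

theorem formalSum_d_lie (x y : L) (g : ℕ → (U R L)⟦X⟧) :
    formalSum (fun N => el R (D.d N ⁅x, y⁆) * g N) =
      formalSum (fun N => ∑ ij ∈ Finset.HasAntidiagonal.antidiagonal N,
        el R (D.d ij.1 x) * el R (D.d ij.2 y) * g N) -
      formalSum (fun N => ∑ ij ∈ Finset.HasAntidiagonal.antidiagonal N,
        el R (D.d ij.1 y) * el R (D.d ij.2 x) * g N) := by
  rw [← formalSum_sub]
  refine formalSum_congr fun N => ?_
  rw [← Finset.Nat.sum_antidiagonal_swap (n := N)
    (f := fun ij => el R (D.d ij.1 y) * el R (D.d ij.2 x) * g N), ← Finset.sum_sub_distrib,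
    D.d_lie, el_sum, Finset.sum_mul]
  refine Finset.sum_congr rfl fun ij _ => ?_
  rw [el_lie, sub_mul]; rfl

/-- The morphism `x ↦ (1 - e t)^(-w) ∑ d_ℓ(x) (h + 1)^⟨ℓ⟩ t^ℓ`, for `x` of weight `w`. -/
def twist : L →ₗ⁅R⁆ (U R L)⟦X⟧ :=
  D.lieHomMk (D.glue fun w => (LinearMap.mulLeft R (D.P (-w))).comp (D.T 1)) <| by
    -- Bringing (1 - et)^(-v) to the left of the series of x lowers its parameter from 1 to 1 - v,
    -- which is precisely the offset required by `T_mul_T`.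
    have key : ∀ {w v x y}, x ∈ D.piece w → y ∈ D.piece v → (D.P (-w) * D.T 1 x) * (D.P (-v) * D.T 1 y) =
        D.P (-(w + v)) * formalSum fun N => ∑ ij ∈ Finset.HasAntidiagonal.antidiagonal N,
          el R (D.d ij.1 x) * el R (D.d ij.2 y) * rising D.H 1 N := by
      intro w v x y hx hy
      rw [mul_assoc, ← mul_assoc (D.T 1 x), D.T_mul_P, mul_assoc, ← mul_assoc, oneSubPow_mul,
        ← sub_eq_add_neg 1 v, D.T_mul_T x hy]
      congr 2
      ring
    intro w v x y hx hy
    rw [D.glue_of_mem _ hx, D.glue_of_mem _ hy, D.glue_of_mem _ (D.lie_mem hx hy)]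
    simp only [LinearMap.comp_apply, LinearMap.mulLeft_apply]
    rw [key hx hy, key hy hx, add_comm v w, ← mul_sub, T_apply, D.formalSum_d_lie]

theorem twist_apply {w : ℤ} {x : L} (hx : x ∈ D.piece w) : D.twist x = D.P (-w) * D.T 1 x := by
  rw [twist, lieHomMk_apply, D.glue_of_mem _ hx]; rfl

end JordanianDatum

end Env

/-! ### The coproduct on the Lie algebra as a morphism to the completed tensor square. -/

namespace Env

open FormalAlg UniversalEnvelopingAlgebra
open PowerSeries (X)

attribute [local instance 100] LieRing.ofAssociativeRing

variable {R L ι' : Type*} [CommRing R] [LieRing L] [LieAlgebra R L]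

theorem algHom_rising {A B : Type*} [Ring A] [Algebra R A] [Ring B] [Algebra R B] (φ : A →ₐ[R] B)
    (x : A) (a : ℤ) (ℓ : ℕ) : φ (rising x a ℓ) = rising (φ x) a ℓ :=
  map_rising (φ : A →+* B) x a ℓ

/-- Induction on elements of an enveloping algebra. -/
theorem U_induction {p : U R L → Prop} (algebraMap : ∀ r, p (algebraMap R (U R L) r))
    (ι : ∀ x, p (ι R x)) (add : ∀ a b, p a → p b → p (a + b))
    (mul : ∀ a b, p a → p b → p (a * b)) (a : U R L) : p a := by
  let s : Subalgebra R (U R L) :=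
    { carrier := {a | p a}
      mul_mem' := fun {a b} ha hb => mul a b ha hb
      add_mem' := fun {a b} ha hb => add a b ha hb
      algebraMap_mem' := algebraMap }
  let f : L →ₗ⁅R⁆ s :=
    { toFun := fun x => ⟨UniversalEnvelopingAlgebra.ι R x, ι x⟩
      map_add' := fun x y => Subtype.ext (map_add _ x y)
      map_smul' := fun r x => Subtype.ext (map_smul _ r x)
      map_lie' := fun {x y} => Subtype.ext (by
        simp only [LieHom.map_lie, LieRing.of_associative_ring_bracket]
        rfl) }
  -- The Lie algebra maps into the subalgebra `s`, and the induced morphism followed by the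
  -- inclusion is the identity on generators, hence everywhere; so `s` is everything.
  have h : s.val.comp (lift R f) = AlgHom.id R (U R L) := by
    refine hom_ext R ?_
    ext x
    change ((lift R f (UniversalEnvelopingAlgebra.ι R x) : s) : U R L) = _
    rw [lift_ι_apply]
    rfl
  have := (lift R f a).2
  have h2 : ((lift R f a : s) : U R L) = a := DFunLike.congr_fun h a
  rwa [h2] at this

namespace JordanianDatum

variable (D : JordanianDatum R L ι')

/-- `X`-linear morphisms of algebras on `U(L)⟦X⟧` agree if they agree on homogeneous elements of
`L`. -/
theorem algHom_ext {E : Type*} [Ring E] [Algebra R E] {φ ψ : (U R L)⟦X⟧ →ₐ[R] E⟦X⟧}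
    (hφ : IsXLinear φ) (hψ : IsXLinear ψ)
    (h : ∀ w x, x ∈ D.piece w → φ (el R x) = ψ (el R x)) (f : (U R L)⟦X⟧) : φ f = ψ f := by
  refine hφ.ext hψ (fun a => ?_) f
  induction a using U_induction with
  | algebraMap r => rw [← PowerSeries.algebraMap_apply, AlgHom.commutes, AlgHom.commutes]
  | ι x =>
    induction x using D.weight_induction with
    | zero => simp
    | add x y hx hy => rw [map_add, map_add, map_add, map_add, hx, hy]
    | mem w x hx => exact h w x hx
  | add a b ha hb => rw [map_add, map_add, map_add, ha, hb]
  | mul a b ha hb => rw [map_mul, map_mul, map_mul, ha, hb]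

section Psi

variable {E : Type*} [Ring E] [Algebra R E] (j : (U R L)⟦X⟧ →ₐ[R] E⟦X⟧) (Z : E⟦X⟧)

/-- The series `∑ (-1)^ℓ (Z + c)^⟨ℓ⟩ (1 - e t)^(-ℓ) d_ℓ(x) t^ℓ`. -/
def Psi (c : ℤ) : L →ₗ[R] E⟦X⟧ where
  toFun x := formalSum fun ℓ => (-1 : R) ^ ℓ • (rising Z c ℓ * j (D.P (-ℓ) * el R (D.d ℓ x)))
  map_add' x y := by simp only [map_add, el_add, mul_add, smul_add, formalSum_add]
  map_smul' r x := by
    simp only [map_smul, el_smul, mul_smul_comm, smul_comm _ r, formalSum_smul, RingHom.id_apply]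

theorem Psi_apply (c : ℤ) (x : L) : D.Psi j Z c x =
    formalSum fun ℓ => (-1 : R) ^ ℓ • (rising Z c ℓ * j (D.P (-ℓ) * el R (D.d ℓ x))) := rfl

theorem Psi_zero_zero (x : L) : D.Psi j 0 0 x = j (el R x) := by
  rw [Psi_apply, formalSum_eq_single _ fun ℓ => by
    rw [rising_zero_zero_succ, zero_mul, smul_zero]]
  simp [rising_zero, oneSubPow_zero, D.d_zero]

/-- This is the reason for keeping `j` and `Z` arbitrary: algebra morphisms send one such series to
another, so the counit and coassociativity axioms become comparisons of series with different `j`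
and `Z`. -/
theorem map_Psi {E' : Type*} [Ring E'] [Algebra R E'] {φ : E⟦X⟧ →ₐ[R] E'⟦X⟧} (hφ : IsXLinear φ)
    (c : ℤ) (x : L) : φ (D.Psi j Z c x) = D.Psi (φ.comp j) (φ Z) c x := by
  rw [Psi_apply, Psi_apply, hφ.map_formalSum]
  refine formalSum_congr fun ℓ => ?_
  rw [map_smul, map_mul, algHom_rising]
  rfl

variable {j Z}

/-- The counterpart of `T_mul_P_one`: `Z` commutes with the image of `j`, and the sign (-1)^ℓ makes
the bracket terms lower the parameter instead of raising it. -/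
theorem Psi_mul_P_one (hj : IsXLinear j) (hZ : ∀ f, Commute (j f) Z) (x : L) (c : ℤ) :
    D.Psi j Z c x * j (D.P 1) = j (D.P 1) * D.Psi j Z (c - 1) x := by
  have hr : ∀ f c ℓ, j f * rising Z c ℓ = rising Z c ℓ * j f := fun f c ℓ =>
    (commute_rising (hZ f) c ℓ).eq
  let f : ℕ → E⟦X⟧ := fun ℓ =>
    (-1 : R) ^ ℓ • (rising Z c ℓ * (j (D.P 1) * j (D.P (-ℓ) * el R (D.d ℓ x))))
  let g : ℕ → E⟦X⟧ := fun ℓ => (-1 : R) ^ ℓ • (rising Z c ℓ *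
    (((ℓ : E⟦X⟧) + 1) * j (D.P (-ℓ) * el R (D.d (ℓ + 1) x))))
  have hL : D.Psi j Z c x * j (D.P 1) = formalSum f + X * formalSum g := by
    rw [Psi_apply, formalSum_mul, mul_formalSum, ← formalSum_add]
    refine formalSum_congr fun ℓ => ?_
    have h1 : D.P (-ℓ) * el R (D.d ℓ x) * D.P 1 = D.P 1 * (D.P (-ℓ) * el R (D.d ℓ x)) +
        X * (((ℓ : (U R L)⟦X⟧) + 1) * (D.P (-ℓ) * el R (D.d (ℓ + 1) x))) := by
      rw [mul_assoc, D.d_mul_P_one, mul_add, ← mul_assoc, ← mul_assoc (D.P 1), oneSubPow_mul,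
        oneSubPow_mul, add_comm (1 : ℤ), ← mul_assoc (D.P (-ℓ)) X, ← PowerSeries.X_mul,
        mul_assoc X, ← mul_assoc (D.P (-ℓ)), ← mul_assoc (_ + 1) (D.P (-ℓ)),
        ((Nat.cast_commute ℓ (D.P (-ℓ))).add_left (Commute.one_left _)).eq]
    rw [smul_mul_assoc, mul_assoc, ← map_mul, h1, map_add, hj.map_X_mul, mul_add, smul_add,
      map_mul, map_mul j ((ℓ : (U R L)⟦X⟧) + 1), map_add j (ℓ : (U R L)⟦X⟧), map_natCast, map_one, mul_smul_comm,
      ← mul_assoc _ X, ← PowerSeries.X_mul, mul_assoc X]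
  rw [hL, Psi_apply, mul_formalSum (j (D.P 1))]
  refine formalSum_add_X_mul (A := E) ?_ fun ℓ => ?_
  · simp [f, rising_zero]
  · have h2 : j (D.P 1) * j (D.P (-(ℓ + 1 : ℕ)) * el R (D.d (ℓ + 1) x)) =
        j (D.P (-ℓ) * el R (D.d (ℓ + 1) x)) := by
      rw [← map_mul, ← mul_assoc, oneSubPow_mul]
      congr 3
      push_cast; ring
    simp only [f, g]
    have h3 := rising_step Z (c - 1) ℓ
    rw [sub_add_cancel] at h3
    rw [mul_smul_comm, ← mul_assoc (j _), hr, mul_assoc, h2, pow_succ, mul_neg_one, neg_smul,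
      neg_smul, ← h3, ← mul_assoc (rising Z c ℓ), add_mul, smul_add,
      ((Nat.cast_commute ℓ (rising Z c ℓ)).add_left (Commute.one_left _)).eq]
    abel

theorem Psi_mul_P (hj : IsXLinear j) (hZ : ∀ f, Commute (j f) Z) (x : L) (c z : ℤ) :
    D.Psi j Z c x * j (D.P z) = j (D.P z) * D.Psi j Z (c - z) x := by
  have h : ∀ z, j (D.P z) = ((Units.map (j : (U R L)⟦X⟧ →* E⟦X⟧) (oneSub (inU R D.e)) ^ z :
      E⟦X⟧ˣ) : E⟦X⟧) := fun z => by rw [← map_zpow]; rfl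
  have h1 := zpow_mul_of_shift (Units.map (j : (U R L)⟦X⟧ →* E⟦X⟧) (oneSub (inU R D.e)))
    -- The parameter is negated because `zpow_mul_of_shift` expects an upward shift.
    (fun c => D.Psi j Z (-c) x) (fun c => by
      have := D.Psi_mul_P_one hj hZ x (-c)
      rw [h 1, zpow_one] at this
      rw [this, neg_add, sub_eq_add_neg]) (-c) z
  rw [h z]
  simpa [sub_eq_add_neg, add_comm] using h1

theorem commute_Psi {y : E⟦X⟧} (hy : Commute y Z) (hj : ∀ f, Commute y (j f)) (c : ℤ) (x : L) :
    Commute y (D.Psi j Z c x) := by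
  rw [Psi_apply, commute_iff_eq, mul_formalSum, formalSum_mul]
  exact formalSum_congr fun ℓ => (((commute_rising hy c ℓ).mul_right (hj _)).smul_right _).eq

/-- The series of x commutes with Z^⟨m⟩, and passing (1 - et)^(-m) raises its parameter from 0 to m.
Then Z^⟨m⟩ (Z + m)^⟨ℓ⟩ = Z^⟨m+ℓ⟩, so again the outer factors depend on the total degree only. -/
theorem Psi_mul_Psi (hj : IsXLinear j) (hZ : ∀ f, Commute (j f) Z) (x y : L) :
    D.Psi j Z 0 x * D.Psi j Z 0 y = formalSum fun N =>
      ∑ ij ∈ Finset.HasAntidiagonal.antidiagonal N, (-1 : R) ^ N •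
        (rising Z 0 N * j (D.P (-N) * (el R (D.d ij.1 x) * el R (D.d ij.2 y)))) := by
  have h1 : D.Psi j Z 0 x * D.Psi j Z 0 y = formalSum fun m => formalSum fun ℓ =>
      (-1 : R) ^ (m + ℓ) • (rising Z 0 (m + ℓ) *
        j (D.P (-(m + ℓ : ℕ)) * (el R (D.d ℓ x) * el R (D.d m y)))) := by
    rw [D.Psi_apply (x := y), mul_formalSum]
    refine formalSum_congr fun m => ?_
    have hc : D.Psi j Z 0 x * rising Z 0 m = rising Z 0 m * D.Psi j Z 0 x :=
      (commute_rising (D.commute_Psi (Commute.refl Z) (fun f => (hZ f).symm) 0 x).symm 0 m).eq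
    rw [map_mul, mul_smul_comm, ← mul_assoc, hc, mul_assoc, ← mul_assoc (D.Psi j Z 0 x),
      D.Psi_mul_P hj hZ, Psi_apply]
    simp only [mul_formalSum, formalSum_mul, ← formalSum_smul]
    refine formalSum_congr fun ℓ => ?_
    have e1 : (0 : ℤ) - -(m : ℤ) = 0 + m := by ring
    have e2 : (-((m + ℓ : ℕ) : ℤ)) = -m + -ℓ := by push_cast; ring
    have e3 : D.P (-m + -ℓ) = D.P (-m) * D.P (-ℓ) := (oneSubPow_mul _ _ _).symm
    rw [e1, e2, e3, pow_add, mul_smul, rising_add]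
    simp only [mul_smul_comm, smul_mul_assoc, map_mul, mul_assoc]
    rw [← mul_assoc (j (D.P (-m))), (commute_rising (hZ (D.P (-m))) _ ℓ).eq]
    simp only [mul_assoc]
  rw [h1, formalSum_formalSum]
  refine formalSum_congr fun N => ?_
  rw [← Finset.Nat.sum_antidiagonal_swap]
  refine Finset.sum_congr rfl fun ij hij => ?_
  have := Finset.HasAntidiagonal.mem_antidiagonal.mp hij
  simp only [Prod.fst_swap, Prod.snd_swap, add_comm ij.2 ij.1, this]

theorem Psi_lie (hj : IsXLinear j) (hZ : ∀ f, Commute (j f) Z) (x y : L) :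
    D.Psi j Z 0 ⁅x, y⁆ = D.Psi j Z 0 x * D.Psi j Z 0 y - D.Psi j Z 0 y * D.Psi j Z 0 x := by
  rw [D.Psi_mul_Psi hj hZ, D.Psi_mul_Psi hj hZ, ← formalSum_sub, Psi_apply]
  refine formalSum_congr fun N => ?_
  rw [← Finset.Nat.sum_antidiagonal_swap (n := N) (f := fun ij => (-1 : R) ^ N • (rising Z 0 N *
      j (D.P (-N) * (el R (D.d ij.1 y) * el R (D.d ij.2 x))))), ← Finset.sum_sub_distrib,
    D.d_lie, el_sum, Finset.mul_sum, map_sum, Finset.mul_sum, Finset.smul_sum]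
  refine Finset.sum_congr rfl fun ij _ => ?_
  rw [el_lie, mul_sub, map_sub, mul_sub, smul_sub]; rfl

end Psi

/-! ### The coproduct -/

/-- The element `h ⊗ 1`. -/
abbrev H₁ : (U R L ⊗[R] U R L)⟦X⟧ := inl R (U R L) (U R L) D.H

theorem commute_inr_inl (f g : (U R L)⟦X⟧) :
    Commute (inr R (U R L) (U R L) f) (inl R (U R L) (U R L) g) := inl_mul_inr g f

/-- The map `x ↦ x ⊗ (1 - e t)^w`. -/
def Phi (w : ℤ) : L →ₗ[R] (U R L ⊗[R] U R L)⟦X⟧ where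
  toFun x := ptensor R (el R x) (D.P w)
  map_add' x y := by simp only [ptensor_eq, el_add, map_add, add_mul]
  map_smul' r x := by simp only [ptensor_eq, el_smul, map_smul, smul_mul_assoc, RingHom.id_apply]

theorem Phi_apply (w : ℤ) (x : L) : D.Phi w x = ptensor R (el R x) (D.P w) := rfl

theorem Phi_lie (w v : ℤ) (x y : L) :
    D.Phi (w + v) ⁅x, y⁆ = D.Phi w x * D.Phi v y - D.Phi v y * D.Phi w x := by
  simp only [Phi_apply, ptensor_mul, oneSubPow_mul, add_comm v w, el_lie]
  simp only [ptensor_eq, map_sub, sub_mul]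

/-- Two shifts cancel: passing x ⊗ 1 moves the parameter from 0 to w, and passing 1 ⊗ (1 - et)^w
moves it back. This is what forces the exponent of 1 - et to be the weight of x. -/
theorem Phi_mul_Psi {w : ℤ} {x : L} (hx : x ∈ D.piece w) (y : L) :
    D.Phi w x * D.Psi (inr R _ _) D.H₁ 0 y = D.Psi (inr R _ _) D.H₁ 0 y * D.Phi w x := by
  have h1 : D.Psi (inr R _ _) D.H₁ 0 y * inl R _ _ (el R x) =
      inl R _ _ (el R x) * D.Psi (inr R _ _) D.H₁ w y := by
    rw [Psi_apply, Psi_apply, mul_formalSum, formalSum_mul]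
    refine formalSum_congr fun ℓ => ?_
    rw [smul_mul_assoc, mul_smul_comm, mul_assoc, (commute_inr_inl _ _).eq, ← mul_assoc,
      ← mul_assoc, ← algHom_rising, ← map_mul, D.rising_h_mul hx, zero_add, map_mul, algHom_rising]
  rw [Phi_apply, ptensor_eq, ← mul_assoc (D.Psi _ _ _ _), h1, mul_assoc (inl R _ _ _) (D.Psi _ _ _ _),
    D.Psi_mul_P isXLinear_inr (fun f => commute_inr_inl _ _), sub_self, mul_assoc]

/-- The coproduct on `L`. -/
def comulL : L →ₗ⁅R⁆ (U R L ⊗[R] U R L)⟦X⟧ :=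
  D.lieHomMk (D.glue fun w => D.Phi w + D.Psi (inr R _ _) D.H₁ 0) <| by
    intro w v x y hx hy
    rw [D.glue_of_mem _ hx, D.glue_of_mem _ hy, D.glue_of_mem _ (D.lie_mem hx hy)]
    simp only [LinearMap.add_apply]
    -- Since the `Phi` and `Psi` parts commute with each other, the mixed terms of the commutator
    -- cancel and only the two separate brackets remain.
    rw [D.Phi_lie, D.Psi_lie isXLinear_inr (fun f => commute_inr_inl _ _), add_mul, add_mul,
      mul_add, mul_add, mul_add, mul_add, D.Phi_mul_Psi hx, D.Phi_mul_Psi hy]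
    abel

/-- The coproduct. -/
def comul : (U R L)⟦X⟧ →ₐ[R] (U R L ⊗[R] U R L)⟦X⟧ := extendAlgHom (lift R D.comulL)

theorem isXLinear_comul : IsXLinear D.comul := isXLinear_extendAlgHom _

theorem comul_el {w : ℤ} {x : L} (hx : x ∈ D.piece w) : D.comul (el R x) =
    ptensor R (el R x) (D.P w) + D.Psi (inr R _ _) D.H₁ 0 x := by
  rw [comul, el, cst, extendAlgHom_C, lift_ι_apply, comulL, lieHomMk_apply, D.glue_of_mem _ hx]
  rfl

end JordanianDatum

end Env

/-! ### Vandermonde identities for rising products of non-commuting elements. -/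

namespace FormalAlg

open Finset hiding antidiagonal mem_antidiagonal
open Finset.HasAntidiagonal (antidiagonal mem_antidiagonal)

variable {A : Type*} [Ring A]

theorem rising_succ_left (x : A) (a : ℤ) (ℓ : ℕ) :
    rising x a (ℓ + 1) = (x + (a : A) + (ℓ : A)) * rising x a ℓ := by
  rw [rising_succ]
  exact (commute_rising (((Commute.refl x).add_left (Int.cast_commute _ _)).add_left
    (Nat.cast_commute _ _)) _ _).eq.symm

theorem rising_mul_of_semiconj {x x' y : A} (h : x * y = y * x') (a : ℤ) (ℓ : ℕ) :
    rising x a ℓ * y = y * rising x' a ℓ := by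
  induction ℓ with
  | zero => simp [rising_zero]
  | succ ℓ ih =>
    rw [rising_succ, mul_assoc, add_mul, add_mul, h, (Int.commute_cast y a).eq.symm,
      (Nat.commute_cast y ℓ).eq.symm, ← mul_add, ← mul_add, ← mul_assoc, ih, rising_succ, mul_assoc]

theorem rising_add_cast (x : A) (c a : ℤ) (ℓ : ℕ) :
    rising (x + (c : A)) a ℓ = rising x (a + c) ℓ := by
  induction ℓ with
  | zero => rfl
  | succ ℓ ih =>
    rw [rising_succ, rising_succ, ih]
    congr 2
    push_cast; abel

/-- The falling product as a rising product. -/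
theorem rising_neg (x : A) (ℓ : ℕ) : rising x (1 - ℓ) ℓ = (-1) ^ ℓ * rising (-x) 0 ℓ := by
  induction ℓ with
  | zero => simp [rising_zero]
  | succ ℓ ih =>
    have h1 : (1 - ((ℓ + 1 : ℕ) : ℤ)) = -ℓ := by push_cast; ring
    have h2 : (-(ℓ : ℤ) + 1) = 1 - ℓ := by ring
    rw [h1, rising_succ', h2, ih, rising_succ_left, pow_succ, mul_assoc, ← mul_assoc _ ((-1) ^ ℓ),
      ((Commute.neg_one_right (x + ((-(ℓ : ℤ) : ℤ) : A))).pow_right ℓ).eq, mul_assoc]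
    congr 1
    rw [← mul_assoc]
    congr 1
    push_cast; noncomm_ring

/-- The hypothesis reads G v = v (G + v - 1), so each factor v passed by G contributes v - 1. -/
theorem semiconj_pow {G v : A} (h : G * v = v * G + v * v - v) (i : ℕ) :
    G * v ^ i = v ^ i * G + i • v ^ (i + 1) - i • v ^ i := by
  induction i with
  | zero => simp
  | succ i ih =>
    rw [pow_succ, ← mul_assoc, ih, sub_mul, add_mul, mul_assoc _ G, h, mul_sub, mul_add]
    simp only [smul_mul_assoc, ← pow_succ, ← mul_assoc, add_smul, one_smul]
    abel

/-- A Vandermonde identity for rising products of elements with `G v = v G + v ^ 2 - v`. -/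
theorem rising_add_mul {Z G v : A} (hG : Commute Z G) (hv : Commute Z v)
    (h : G * v = v * G + v * v - v) (N : ℕ) :
    rising (G + Z * v) 0 N = ∑ ij ∈ antidiagonal N,
      N.choose ij.1 • (rising Z 0 ij.1 * v ^ ij.1 * rising G 0 ij.2) := by
  induction N with
  | zero => simp [rising_zero]
  | succ N ih =>
    rw [sum_antidiagonal_choose_succ_nsmul (fun i j => rising Z 0 i * v ^ i * rising G 0 j),
      rising_succ_left, ih, mul_sum, ← sum_add_distrib]
    refine sum_congr rfl fun ij hij => ?_
    obtain ⟨i, j⟩ := ij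
    have hN : i + j = N := mem_antidiagonal.mp hij
    dsimp only
    rw [Nat.choose_symm_of_eq_add (hN.symm.trans (add_comm i j)), ← smul_add, mul_smul_comm]
    congr 1
    rw [rising_succ_left, rising_succ_left, ← hN]
    -- Pascal's rule leaves one identity for each pair (i, j): multiplying by G + Zv + i + j must
    -- give the sum of the terms for (i + 1, j) and (i, j + 1). Moving G past v^i yields i v^(i+1) -
    -- i v^i: the first turns Z into Z + i, the second reduces i + j to j.
    have h1 : G * rising Z 0 i = rising Z 0 i * G := (commute_rising hG.symm 0 i).eq
    have h2 : v * rising Z 0 i = rising Z 0 i * v := (commute_rising hv.symm 0 i).eq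
    have h3 := semiconj_pow h i
    have e1 : G * (rising Z 0 i * v ^ i * rising G 0 j) =
        rising Z 0 i * (v ^ i * G + i • v ^ (i + 1) - i • v ^ i) * rising G 0 j := by
      rw [← h3]; simp only [← mul_assoc, h1]
    have e2 : Z * v * (rising Z 0 i * v ^ i * rising G 0 j) =
        Z * rising Z 0 i * v ^ (i + 1) * rising G 0 j := by
      rw [pow_succ']
      simp only [mul_assoc]
      rw [← mul_assoc v, h2, mul_assoc]
    simp only [Int.cast_zero, add_zero, Nat.cast_add]
    rw [add_mul, add_mul, e1, e2]
    simp only [add_mul, mul_add, mul_sub, sub_mul, ← nsmul_eq_mul, smul_mul_assoc, mul_smul_comm,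
      ← mul_assoc]
    simp only [nsmul_eq_mul, (Nat.cast_commute j _).eq, mul_assoc]
    abel

theorem rising_zero_left_commute (x : A) (w : ℤ) (N : ℕ) : Commute x (rising 0 w N) :=
  commute_rising (Commute.zero_right x) w N

/-- The absorption rule i (N choose i) = N (N - 1 choose i - 1). The truncated subtractions are
harmless, as the terms where they occur carry a factor i = 0 or N = 0. -/
theorem sum_choose_mul_pred {M : Type*} [AddCommMonoid M] (f : ℕ → ℕ → M) (N : ℕ) :
    ∑ ij ∈ antidiagonal N, N.choose ij.1 • (ij.1 • f (ij.1 - 1) ij.2) =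
      N • ∑ ij ∈ antidiagonal (N - 1), (N - 1).choose ij.1 • f ij.1 ij.2 := by
  cases N with
  | zero => simp
  | succ N =>
    rw [Nat.sum_antidiagonal_succ]
    simp only [zero_smul, smul_zero, zero_add, Nat.add_sub_cancel]
    rw [smul_sum]
    refine sum_congr rfl fun ij _ => ?_
    rw [smul_smul, smul_smul, Nat.add_one_mul_choose_eq]

/-- Were `G` and `v` to commute, this would be Vandermonde for (G + wv) + (-G) = wv, giving (wv)^⟨N⟩
instead. The relation between G and v turns this into w^⟨N⟩ v^N. It carries the right antipode
axiom. -/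
theorem sum_rising_mul_rising_neg {G v : A} (h : G * v = v * G + v * v - v) (N : ℕ) (w : ℤ) :
    ∑ ij ∈ antidiagonal N, N.choose ij.1 • (rising (G + w * v) 0 ij.1 * rising (-G) 0 ij.2) =
      rising 0 w N * v ^ N := by
  induction N using Nat.strong_induction_on generalizing w with
  | _ N IH =>
    cases N with
    | zero => simp [rising_zero]
    | succ N =>
      set Q := G + w * v with hQ
      set Q' := G + ((w + 1 : ℤ) : A) * v with hQ'
      have hQv : Q * v = v * (Q' + ((-1 : ℤ) : A)) := by
        have : (w : A) * v * v = v * ((w : A) * v) := by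
          rw [← mul_assoc, (Int.cast_commute w v).eq]
        rw [hQ, hQ', add_mul, h, this]
        push_cast
        simp only [mul_add, add_mul, one_mul, mul_neg, mul_one]
        abel
      have hr : ∀ i, rising Q 0 i * v = v * (rising Q' 0 i - i • rising Q' 0 (i - 1)) := by
        intro i
        rw [rising_mul_of_semiconj hQv, rising_add_cast]
        cases i with
        | zero => simp [rising_zero]
        | succ i =>
          have := rising_step Q' (-1) i
          rw [neg_add_cancel] at this
          rw [zero_add, ← this, Nat.add_sub_cancel, nsmul_eq_mul]
          push_cast
          rw [add_sub_cancel_right]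
      -- Pascal's rule puts (Q + i) + (-G + j) = wv + N between the two rising products. Moving v to
      -- the left by `hr` changes w to w + 1, whence the sums for `Q'`; the induction therefore
      -- needs every w and the two preceding values of N.
      have hstep : ∑ ij ∈ antidiagonal (N + 1), (N + 1).choose ij.1 •
            (rising Q 0 ij.1 * rising (-G) 0 ij.2) =
          N • (∑ ij ∈ antidiagonal N, N.choose ij.1 • (rising Q 0 ij.1 * rising (-G) 0 ij.2)) +
          w * v * ((∑ ij ∈ antidiagonal N, N.choose ij.1 •
            (rising Q' 0 ij.1 * rising (-G) 0 ij.2)) -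
          N • ∑ ij ∈ antidiagonal (N - 1), (N - 1).choose ij.1 •
            (rising Q' 0 ij.1 * rising (-G) 0 ij.2)) := by
        rw [sum_antidiagonal_choose_succ_nsmul (fun i j => rising Q 0 i * rising (-G) 0 j),
          ← sum_choose_mul_pred (fun i j => rising Q' 0 i * rising (-G) 0 j), ← sum_sub_distrib,
          mul_sum, smul_sum, ← sum_add_distrib, ← sum_add_distrib]
        refine sum_congr rfl fun ij hij => ?_
        obtain ⟨i, j⟩ := ij
        have hN : i + j = N := mem_antidiagonal.mp hij
        dsimp only
        rw [Nat.choose_symm_of_eq_add (hN.symm.trans (add_comm i j)), ← smul_add, ← smul_sub,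
          mul_smul_comm, smul_comm N, ← smul_add]
        congr 1
        rw [← smul_mul_assoc i, ← sub_mul, ← mul_assoc, mul_assoc (w : A), ← hr, rising_succ Q,
          rising_succ_left (-G), ← mul_assoc, ← add_mul, ← hN, ← smul_mul_assoc, ← mul_assoc (w : A),
          ← add_mul]
        congr 1
        rw [(Int.cast_commute w (rising Q 0 i)).eq, hQ]
        simp only [Int.cast_zero, add_zero, mul_add, nsmul_eq_mul, Nat.cast_add, add_mul,
          mul_neg, mul_assoc]
        rw [(Nat.cast_commute i _).eq, (Nat.cast_commute j _).eq]
        abel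
      rw [hstep, IH N (by omega), IH N (by omega)]
      cases N with
      | zero => simp [rising]
      | succ M =>
        rw [Nat.add_sub_cancel, IH M (by omega), rising_succ' 0 w (M + 1), rising_succ' 0 w M,
          pow_succ' v (M + 1), mul_sub, mul_smul_comm, zero_add]
        have c1 : ∀ n, v * rising 0 (w + 1) n = rising 0 (w + 1) n * v := fun n =>
          (rising_zero_left_commute v _ _).eq
        simp only [mul_assoc]
        rw [← mul_assoc v (rising _ _ _), ← mul_assoc v (rising _ _ _), c1, c1, mul_assoc,
          mul_assoc, ← pow_succ', ← pow_succ']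
        abel

end FormalAlg

/-! ### Commutation of h with powers of 1 - et, and the coproducts of e, 1 - et and h. -/

namespace Env

open FormalAlg UniversalEnvelopingAlgebra
open PowerSeries (X)

attribute [local instance 100] LieRing.ofAssociativeRing

variable {R L ι' : Type*} [CommRing R] [LieRing L] [LieAlgebra R L]

namespace JordanianDatum

variable (D : JordanianDatum R L ι')

theorem P_mul_P (a b : ℤ) : D.P a * D.P b = D.P (a + b) := oneSubPow_mul _ a b

theorem P_zero : D.P 0 = 1 := oneSubPow_zero _

theorem P_neg_natCast (ℓ : ℕ) : D.P (-ℓ) = D.P (-1) ^ ℓ := by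
  induction ℓ with
  | zero => simp [P_zero]
  | succ ℓ ih => rw [pow_succ, ← ih, P_mul_P]; congr 1; push_cast; ring

theorem P_neg_one_mul_e : D.P (-1) * (el R D.e * X) = D.P (-1) - 1 := by
  have h := D.P_mul_P (-1) 1
  rw [P_one, mul_sub, mul_one, neg_add_cancel, P_zero] at h
  rw [← h]; abel

theorem H_mul_e : D.H * el R D.e = el R D.e * D.H + el R D.e := by
  rw [D.h_mul D.e_mem]; simp [mul_add]

theorem H_mul_P_one : D.H * D.P 1 = D.P 1 * D.H + D.P 1 - 1 := by
  rw [P_one, mul_sub, ← mul_assoc, H_mul_e, add_mul, sub_mul, mul_assoc _ X, PowerSeries.X_mul,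
    mul_assoc]
  simp only [mul_one, one_mul]
  abel

/-- The family c ↦ h + c (1 - (1 - et)^(-1)) is shifted by one on passing 1 - et, since [h, e] = e;
this is the case c = 0. -/
theorem H_mul_P (z : ℤ) : D.H * D.P z = D.P z * (D.H + (z : (U R L)⟦X⟧) * (1 - D.P (-1))) := by
  have h := oneSubPow_mul_of_shift (inU R D.e)
    (fun c : ℤ => D.H + (c : (U R L)⟦X⟧) * (1 - D.P (-1))) (fun c => by
      change _ * D.P 1 = D.P 1 * _
      have h1 : D.P 1 * (1 - D.P (-1)) = D.P 1 - 1 := by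
        rw [mul_sub, D.P_mul_P, add_neg_cancel, P_zero, mul_one]
      have h2 : (1 - D.P (-1)) * D.P 1 = D.P 1 - 1 := by
        rw [sub_mul, D.P_mul_P, neg_add_cancel, P_zero, one_mul]
      rw [add_mul, D.H_mul_P_one, mul_assoc, h2, mul_add, ← mul_assoc (D.P 1),
        ((Int.cast_commute (c + 1) (D.P 1)).symm).eq, mul_assoc, h1]
      push_cast
      noncomm_ring) 0 z
  simp only [Int.cast_zero, zero_mul, add_zero, zero_add] at h
  exact h

theorem H_mul_P_neg_one :
    D.H * D.P (-1) = D.P (-1) * D.H + D.P (-1) * D.P (-1) - D.P (-1) := by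
  rw [H_mul_P]; push_cast; noncomm_ring

theorem comul_e : D.comul (el R D.e) =
    ptensor R (el R D.e) (D.P 1) + inr R _ _ (el R D.e) := by
  rw [D.comul_el D.e_mem, Psi_apply, formalSum_eq_single _ fun ℓ => by
    rw [D.d_e, el_zero]; simp]
  simp [rising_zero, P_zero, D.d_zero]

/-- Since Δ(e) = e ⊗ (1 - et) + 1 ⊗ e, the element 1 - et is grouplike. Its image is a product of
two commuting units, so the same holds for all integral powers. -/
theorem comul_P (z : ℤ) : D.comul (D.P z) = ptensor R (D.P z) (D.P z) := by
  have h1 : D.comul (D.P 1) = inl R _ _ (D.P 1) * inr R _ _ (D.P 1) := by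
    have hX := D.isXLinear_comul.map_X
    rw [P_one, map_sub, map_one, map_mul, hX, comul_e, ptensor_eq, P_one]
    simp only [map_sub, map_mul, map_one, isXLinear_inl.map_X, isXLinear_inr.map_X]
    have hx : ∀ a b : (U R L ⊗[R] U R L)⟦X⟧, a * X * (b * X) = a * b * X * X := fun a b => by
      rw [mul_assoc, ← mul_assoc X, PowerSeries.X_mul]; simp only [mul_assoc]
    rw [sub_mul, mul_sub (_ * X), hx]
    noncomm_ring
  have h2 : Units.map (D.comul : (U R L)⟦X⟧ →* (U R L ⊗[R] U R L)⟦X⟧) (oneSub (inU R D.e)) =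
      Units.map (inl R (U R L) (U R L) : (U R L)⟦X⟧ →* (U R L ⊗[R] U R L)⟦X⟧)
          (oneSub (inU R D.e)) *
        Units.map (inr R (U R L) (U R L) : (U R L)⟦X⟧ →* (U R L ⊗[R] U R L)⟦X⟧)
          (oneSub (inU R D.e)) := by
    ext1
    simpa [P, oneSubPow] using h1
  have h3 := congrArg (fun u => ((u ^ z : ((U R L ⊗[R] U R L)⟦X⟧)ˣ) : (U R L ⊗[R] U R L)⟦X⟧)) h2
  rw [Commute.mul_zpow (Units.ext (inl_mul_inr _ _).symm), ← map_zpow, ← map_zpow, ← map_zpow] at h3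
  rw [ptensor_eq]
  exact h3

/-- As d_1(h) = -e and higher terms vanish, h ⊗ 1 and h ⊗ (1 - et)^(-1) e t are collected into h ⊗
(1 - et)^(-1). The result has the form G + Zv of `rising_add_mul`. -/
theorem comul_H : D.comul D.H = inr R _ _ D.H + inl R _ _ D.H * inr R _ _ (D.P (-1)) := by
  have hd : D.d 1 D.h = -D.e := by
    have := D.h_lie D.e_mem
    rw [D.d_one, ← lie_skew, this, one_smul]
  have he : el R (-D.e) = -el R D.e := by simp [el, cst]
  rw [D.comul_el D.h_mem, P_zero, Psi_apply, formalSum_eq, formalSum_eq_single _ fun ℓ => by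
    rw [D.d_h, el_zero]; simp]
  simp only [zero_add, hd, he, rising, ptensor_eq, D.d_zero]
  have h1 : inr R (U R L) (U R L) (D.P (-1)) = 1 + X * inr R (U R L) (U R L) (D.P (-1) * el R D.e) := by
    rw [← isXLinear_inr.map_X_mul, PowerSeries.X_mul, mul_assoc, P_neg_one_mul_e]; simp
  rw [h1]
  simp only [pow_zero, one_smul, pow_one, neg_smul, Nat.cast_zero, neg_zero, P_zero, one_mul,
    map_one, mul_one, Int.cast_zero, add_zero, mul_neg, map_neg, neg_neg, Nat.cast_one, mul_add]
  rw [← mul_assoc X, PowerSeries.X_mul, mul_assoc]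
  abel

end JordanianDatum

end Env

/-! ### Completed tensor products of algebra morphisms on the two legs, and the associator. -/

namespace FormalAlg

variable {R A B C D E : Type*} [CommRing R]
  [Ring A] [Algebra R A] [Ring B] [Algebra R B] [Ring C] [Algebra R C] [Ring D] [Algebra R D]
  [Ring E] [Algebra R E]

theorem isXLinear_mapAlgHom (φ : A →ₐ[R] B) : IsXLinear (PowerSeries.mapAlgHom φ) :=
  IsXLinear.map (φ : A →+* B)

theorem coeff_mapAlgHom (φ : A →ₐ[R] B) (f : A⟦X⟧) (m : ℕ) :
    PowerSeries.coeff m (PowerSeries.mapAlgHom φ f) = φ (PowerSeries.coeff m f) :=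
  PowerSeries.coeff_map (φ : A →+* B) m f

theorem mapCoeff_eq_mapAlgHom {φ : A →ₗ[R] B} {ψ : A →ₐ[R] B} (h : ∀ a, φ a = ψ a) (f : A⟦X⟧) :
    mapCoeff φ f = PowerSeries.mapAlgHom ψ f := by
  ext m; rw [coeff_mapAlgHom, mapCoeff, PowerSeries.coeff_mk, h]

theorem tensorAlgHom_inl {φ : A⟦X⟧ →ₐ[R] C⟦X⟧} {ψ : B⟦X⟧ →ₐ[R] D⟦X⟧} (hφ : IsXLinear φ)
    (hψ : IsXLinear ψ) (f : A⟦X⟧) : tensorAlgHom hφ hψ (inl R A B f) = inl R C D (φ f) := by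
  have := tensorMap_ptensor (φ := φ.toLinearMap) (ψ := ψ.toLinearMap) hφ hψ f 1
  simpa only [← tensorAlgHom_apply hφ hψ, ptensor_eq, map_one, mul_one, AlgHom.toLinearMap_apply] using this

theorem tensorAlgHom_inr {φ : A⟦X⟧ →ₐ[R] C⟦X⟧} {ψ : B⟦X⟧ →ₐ[R] D⟦X⟧} (hφ : IsXLinear φ)
    (hψ : IsXLinear ψ) (g : B⟦X⟧) : tensorAlgHom hφ hψ (inr R A B g) = inr R C D (ψ g) := by
  have := tensorMap_ptensor (φ := φ.toLinearMap) (ψ := ψ.toLinearMap) hφ hψ 1 g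
  simpa only [← tensorAlgHom_apply hφ hψ, ptensor_eq, map_one, one_mul, AlgHom.toLinearMap_apply] using this

theorem mapCoeff_mul'_ptensor (f g : A⟦X⟧) :
    mapCoeff (LinearMap.mul' R A) (ptensor R f g) = f * g := by
  ext m; simp [mapCoeff, ptensor, PowerSeries.coeff_mul]

variable (R A) in
/-- The associativity isomorphism on power series. -/
def assocHom : ((A ⊗[R] A) ⊗[R] A)⟦X⟧ →ₐ[R] (A ⊗[R] (A ⊗[R] A))⟦X⟧ :=
  PowerSeries.mapAlgHom (Algebra.TensorProduct.assoc R R R A A A : _ →ₐ[R] _)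

theorem assocHom_inl_inl (f : A⟦X⟧) :
    assocHom R A (inl R _ _ (inl R _ _ f)) = inl R _ _ f := by
  ext m; rw [assocHom, coeff_mapAlgHom, coeff_inl, coeff_inl, coeff_inl]; rfl

theorem assocHom_inl_inr (f : A⟦X⟧) :
    assocHom R A (inl R _ _ (inr R _ _ f)) = inr R _ _ (inl R _ _ f) := by
  ext m; rw [assocHom, coeff_mapAlgHom, coeff_inl, coeff_inr, coeff_inr, coeff_inl]; rfl

theorem assocHom_inr (f : A⟦X⟧) :
    assocHom R A (inr R _ _ f) = inr R _ _ (inr R _ _ f) := by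
  ext m; rw [assocHom, coeff_mapAlgHom, coeff_inr, coeff_inr, coeff_inr]; rfl

theorem oneSubPow_of_zero (z : ℤ) : oneSubPow (0 : A) z = 1 := by
  have h : oneSub (0 : A) = 1 := by ext1; simp [oneSub]
  rw [oneSubPow, h, one_zpow]; rfl

end FormalAlg

/-! ### The Hopf axioms for a Jordanian datum. -/

namespace Env

open FormalAlg UniversalEnvelopingAlgebra
open PowerSeries (X)

attribute [local instance 100] LieRing.ofAssociativeRing

variable {R L ι' : Type*} [CommRing R] [LieRing L] [LieAlgebra R L]

theorem counit₀_ι (x : L) : counit₀ R L (ι R x) = 0 := by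
  rw [counit₀, lift_ι_apply]; rfl

theorem antipode₀_ι (x : L) : antipode₀ R L (ι R x) = -ι R x := by
  change MulOpposite.unop (antipodeOp R L (ι R x)) = _
  rw [antipodeOp, lift_ι_apply]; rfl

theorem antipode₀_mul (a b : U R L) :
    antipode₀ R L (a * b) = antipode₀ R L b * antipode₀ R L a := by
  change MulOpposite.unop (antipodeOp R L (a * b)) = _
  rw [map_mul]; rfl

theorem antipode₀_one : antipode₀ R L 1 = 1 := by
  change MulOpposite.unop (antipodeOp R L 1) = _
  rw [map_one]; rfl

namespace JordanianDatum

variable (D : JordanianDatum R L ι')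

/-- The counit. -/
def counit : (U R L)⟦X⟧ →ₐ[R] R⟦X⟧ := PowerSeries.mapAlgHom (counit₀ R L)

theorem isXLinear_counit : IsXLinear (counit (R := R) (L := L)) := isXLinear_mapAlgHom _

theorem counit_C (a : U R L) : counit (PowerSeries.C a) = PowerSeries.C (counit₀ R L a) :=
  PowerSeries.map_C _ _

theorem counit_el (x : L) : counit (el R x) = 0 := by
  rw [el, cst, counit_C, counit₀_ι, map_zero]

theorem counit_P (z : ℤ) : counit (D.P z) = 1 := by
  refine (map_oneSubPow (inU R D.e) (counit₀ R L : U R L →+* R) z).trans ?_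
  rw [← oneSubPow_of_zero (A := R) z]
  congr 1
  exact counit₀_ι D.e

/-- The counit kills x and h, so the first term disappears and the series collapses to x by
`Psi_zero_zero`. -/
theorem counit_left (f : (U R L)⟦X⟧) :
    mapCoeff (TensorProduct.lid R (U R L)).toLinearMap
      (tensorMap counit.toLinearMap LinearMap.id (D.comul f)) = f := by
  have hid : IsXLinear (AlgHom.id R (U R L)⟦X⟧) := IsXLinear.id
  let μ : (R ⊗[R] U R L)⟦X⟧ →ₐ[R] (U R L)⟦X⟧ :=
    PowerSeries.mapAlgHom (Algebra.TensorProduct.lid R (U R L) : _ →ₐ[R] _)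
  let Λ := μ.comp (tensorAlgHom (isXLinear_counit (R := R) (L := L)) hid)
  have hμl : ∀ f, μ (inl R _ _ f) = scal R (U R L) f := fun f => by
    ext m; rw [coeff_mapAlgHom, coeff_inl, scal, PowerSeries.coeff_map, Algebra.algebraMap_eq_smul_one]
    exact TensorProduct.lid_tmul _ _
  have hμr : ∀ f, μ (inr R _ _ f) = f := fun f => by
    ext m; rw [coeff_mapAlgHom, coeff_inr]
    exact (TensorProduct.lid_tmul _ _).trans (one_smul _ _)
  have hμ : IsXLinear μ := isXLinear_mapAlgHom _
  have hΛ : IsXLinear Λ := hμ.comp (isXLinear_tensorMap _ _)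
  have h1 : Λ.comp (inr R _ _) = AlgHom.id R _ := AlgHom.ext fun f => by
    simp only [Λ, AlgHom.comp_apply, tensorAlgHom_inr, hμr, AlgHom.id_apply]
  have h2 : ∀ f, Λ (inl R _ _ f) = scal R (U R L) (counit f) := fun f => by
    simp only [Λ, AlgHom.comp_apply, tensorAlgHom_inl, hμl]
  have key := D.algHom_ext (φ := Λ.comp D.comul) (ψ := AlgHom.id R _)
    (hΛ.comp D.isXLinear_comul) hid (fun w x hx => by
      rw [AlgHom.comp_apply, D.comul_el hx, map_add, D.map_Psi _ _ hΛ, h1, h2, ptensor_eq, map_mul,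
        h2, counit_el, counit_el]
      simp [scal, D.Psi_zero_zero]) f
  exact (mapCoeff_eq_mapAlgHom (ψ := (Algebra.TensorProduct.lid R (U R L)).toAlgHom)
    (fun _ => rfl) _).trans key

/-- The counit sends (1 - et)^w to 1 and kills every d_ℓ(x), so only the first term survives. -/
theorem counit_right (f : (U R L)⟦X⟧) :
    mapCoeff (TensorProduct.rid R (U R L)).toLinearMap
      (tensorMap LinearMap.id counit.toLinearMap (D.comul f)) = f := by
  have hid : IsXLinear (AlgHom.id R (U R L)⟦X⟧) := IsXLinear.id
  let μ : (U R L ⊗[R] R)⟦X⟧ →ₐ[R] (U R L)⟦X⟧ :=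
    PowerSeries.mapAlgHom (Algebra.TensorProduct.rid R R (U R L) : _ →ₐ[R] _)
  let Λ := μ.comp (tensorAlgHom hid (isXLinear_counit (R := R) (L := L)))
  have hμl : ∀ f, μ (inl R _ _ f) = f := fun f => by
    ext m; rw [coeff_mapAlgHom, coeff_inl]
    exact (TensorProduct.rid_tmul _ _).trans (one_smul _ _)
  have hμr : ∀ f, μ (inr R _ _ f) = scal R (U R L) f := fun f => by
    ext m
    rw [coeff_mapAlgHom, coeff_inr, scal, PowerSeries.coeff_map, Algebra.algebraMap_eq_smul_one]
    exact TensorProduct.rid_tmul _ _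
  have hμ : IsXLinear μ := isXLinear_mapAlgHom _
  have hΛ : IsXLinear Λ := hμ.comp (isXLinear_tensorMap _ _)
  have h1 : ∀ f, Λ (inl R _ _ f) = f := fun f => by
    simp only [Λ, AlgHom.comp_apply, tensorAlgHom_inl, hμl]; rfl
  have h2 : ∀ f, Λ (inr R _ _ f) = scal R (U R L) (counit f) := fun f => by
    simp only [Λ, AlgHom.comp_apply, tensorAlgHom_inr, hμr]
  have key := D.algHom_ext (φ := Λ.comp D.comul) (ψ := AlgHom.id R _)
    (hΛ.comp D.isXLinear_comul) hid (fun w x hx => by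
      rw [AlgHom.comp_apply, D.comul_el hx, map_add, D.map_Psi _ _ hΛ, h1, ptensor_eq, map_mul,
        h1, h2, counit_P, Psi_apply]
      simp only [AlgHom.comp_apply, h2, map_mul, counit_el, mul_zero, scal, map_zero, smul_zero,
        formalSum_zero, map_one, mul_one, add_zero]
      rfl) f
  exact (mapCoeff_eq_mapAlgHom (ψ := (Algebra.TensorProduct.rid R R (U R L)).toAlgHom)
    (fun _ => rfl) _).trans key

/-! ### Coassociativity -/

/-- This is coassociativity on x after removal of the term of x on the first leg. Applying Δ inside
the series gives two kinds of terms. One sums to the first summand; the other is a double sum, in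
which d_m d_ℓ = (ℓ + m choose ℓ) d_{ℓ+m} supplies the binomials of the Vandermonde expansion of (1 ⊗
h ⊗ 1 + h ⊗ (1 - et)^(-1) ⊗ 1)^⟨N⟩. -/
theorem Psi_comul {w : ℤ} {x : L} (hx : x ∈ D.piece w) :
    D.Psi ((inr R (U R L) _).comp (inl R _ (U R L))) (inl R _ _ D.H) 0 x *
        inr R (U R L) _ (inr R (U R L) (U R L) (D.P w)) +
      D.Psi ((inr R (U R L) _).comp (inr R (U R L) (U R L)))
        (inr R _ _ (inl R _ _ D.H) + inl R _ _ D.H * inr R _ _ (inl R _ _ (D.P (-1)))) 0 x =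
    D.Psi ((inr R (U R L) _).comp D.comul) (inl R _ _ D.H) 0 x := by
  let j2 : (U R L)⟦X⟧ →ₐ[R] (U R L ⊗[R] (U R L ⊗[R] U R L))⟦X⟧ := (inr R (U R L) _).comp (inl R _ _)
  let j3 : (U R L)⟦X⟧ →ₐ[R] (U R L ⊗[R] (U R L ⊗[R] U R L))⟦X⟧ := (inr R (U R L) _).comp (inr R _ _)
  let Z : (U R L ⊗[R] (U R L ⊗[R] U R L))⟦X⟧ := inl R _ _ D.H
  change D.Psi j2 Z 0 x * j3 (D.P w) + D.Psi j3 (j2 D.H + Z * j2 (D.P (-1))) 0 x =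
    D.Psi ((inr R (U R L) _).comp D.comul) Z 0 x
  have h23 : ∀ f g, j3 f * j2 g = j2 g * j3 f := fun f g => by
    simp only [j2, j3, AlgHom.comp_apply, ← map_mul, (commute_inr_inl f g).eq]
  have hZ2 : ∀ f, Commute Z (j2 f) := fun f => (inl_mul_inr _ _).symm
  have hG : j2 D.H * j2 (D.P (-1)) =
      j2 (D.P (-1)) * j2 D.H + j2 (D.P (-1)) * j2 (D.P (-1)) - j2 (D.P (-1)) := by
    rw [← map_mul, H_mul_P_neg_one, map_sub, map_add, map_mul, map_mul]
  -- The weight of d_ℓ(x) is w + ℓ, so on the third leg (1 - et)^(-ℓ) (1 - et)^(w+ℓ) is independent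
  -- of ℓ.
  have hterm : ∀ ℓ : ℕ, inr R (U R L) _ (D.comul (D.P (-ℓ) * el R (D.d ℓ x))) =
      j2 (D.P (-ℓ) * el R (D.d ℓ x)) * j3 (D.P w) +
        j2 (D.P (-ℓ)) * j3 (D.P (-ℓ)) * D.Psi j3 (j2 D.H) 0 (D.d ℓ x) := fun ℓ => by
    have e1 : D.P (-ℓ) * D.P (w + ℓ) = D.P w := by rw [P_mul_P]; congr 1; ring
    rw [map_mul D.comul, comul_P, D.comul_el (D.d_mem ℓ hx), mul_add, ptensor_mul, e1]
    simp only [map_add, ptensor_eq, map_mul]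
    rw [D.map_Psi _ _ isXLinear_inr]
    rfl
  have hR : D.Psi ((inr R (U R L) _).comp D.comul) Z 0 x = D.Psi j2 Z 0 x * j3 (D.P w) +
      formalSum fun ℓ => formalSum fun m => (-1 : R) ^ (ℓ + m) • ((ℓ + m).choose ℓ •
        (rising Z 0 ℓ * j2 (D.P (-1)) ^ ℓ * rising (j2 D.H) 0 m *
          j3 (D.P (-(ℓ + m : ℕ)) * el R (D.d (ℓ + m) x)))) := by
    rw [Psi_apply, Psi_apply, formalSum_mul, ← formalSum_add]
    refine formalSum_congr fun ℓ => ?_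
    rw [AlgHom.comp_apply, hterm, mul_add, smul_add, smul_mul_assoc]
    congr 1
    · rw [mul_assoc]
    rw [Psi_apply, mul_formalSum, mul_formalSum, ← formalSum_smul]
    refine formalSum_congr fun m => ?_
    have e2 : D.P (-(ℓ + m : ℕ)) = D.P (-ℓ) * D.P (-m) := by
      rw [P_mul_P]; congr 1; push_cast; ring
    have e3 : el R (D.d m (D.d ℓ x)) = (ℓ + m).choose ℓ • el R (D.d (ℓ + m) x) := by
      rw [D.d_d, add_comm m ℓ, el_nsmul, nsmul_eq_mul, Nat.choose_symm_add]
    rw [e3, e2, ← map_pow, ← P_neg_natCast, pow_add, mul_smul]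
    simp only [map_mul, map_nsmul, mul_smul_comm, mul_assoc]
    rw [← mul_assoc (j3 (D.P (-ℓ))) (rising _ _ _),
      (commute_rising (x := j2 D.H) (y := j3 (D.P (-ℓ))) (h23 _ _) 0 m).eq, mul_assoc]
  rw [hR]
  congr 1
  rw [formalSum_formalSum, Psi_apply]
  refine formalSum_congr fun N => ?_
  rw [rising_add_mul (hZ2 _) (hZ2 _) hG, Finset.sum_mul, Finset.smul_sum]
  refine Finset.sum_congr rfl fun ij hij => ?_
  rw [Finset.HasAntidiagonal.mem_antidiagonal.mp hij, smul_mul_assoc]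

theorem coassoc (f : (U R L)⟦X⟧) :
    mapCoeff (TensorProduct.assoc R (U R L) (U R L) (U R L)).toLinearMap
      (tensorMap D.comul.toLinearMap LinearMap.id (D.comul f)) =
    tensorMap LinearMap.id D.comul.toLinearMap (D.comul f) := by
  have hid : IsXLinear (AlgHom.id R (U R L)⟦X⟧) := IsXLinear.id
  let Λ := (assocHom R (U R L)).comp (tensorAlgHom D.isXLinear_comul hid)
  let M := tensorAlgHom hid D.isXLinear_comul
  have hα : IsXLinear (assocHom R (U R L)) := isXLinear_mapAlgHom _
  have hΛ : IsXLinear Λ := hα.comp (isXLinear_tensorMap _ _)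
  have hM : IsXLinear M := isXLinear_tensorMap _ _
  let α' := (assocHom R (U R L)).comp (inl R _ _)
  have hα' : IsXLinear α' := hα.comp isXLinear_inl
  have h1 : Λ.comp (inr R _ _) = (inr R _ _).comp (inr R _ _) := AlgHom.ext fun f => by
    simp only [Λ, AlgHom.comp_apply, tensorAlgHom_inr, assocHom_inr]; rfl
  have h2 : ∀ f, Λ (inl R _ _ f) = α' (D.comul f) := fun f => by
    simp only [Λ, α', AlgHom.comp_apply, tensorAlgHom_inl]
  have h3 : α'.comp (inr R _ _) = (inr R _ _).comp (inl R _ _) := AlgHom.ext fun f => by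
    simp only [α', AlgHom.comp_apply, assocHom_inl_inr]
  have h4 : ∀ f, α' (inl R _ _ f) = inl R _ _ f := fun f => by
    simp only [α', AlgHom.comp_apply, assocHom_inl_inl]
  have h5 : M.comp (inr R _ _) = (inr R _ _).comp D.comul := AlgHom.ext fun f => by
    simp only [M, AlgHom.comp_apply, tensorAlgHom_inr]
  have h6 : ∀ f, M (inl R _ _ f) = inl R _ _ f := fun f => by
    simp only [M, tensorAlgHom_inl]; rfl
  have h1' := fun f => DFunLike.congr_fun h1 f
  have h3' := fun f => DFunLike.congr_fun h3 f
  have h5' := fun f => DFunLike.congr_fun h5 f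
  simp only [AlgHom.comp_apply] at h1' h3' h5'
  -- Both sides are algebra morphisms commuting with X, so homogeneous elements suffice;
  -- grouplikeness of (1 - et)^w matches the terms starting with x, and `Psi_comul` the rest.
  have key := D.algHom_ext (φ := Λ.comp D.comul) (ψ := M.comp D.comul)
    (hΛ.comp D.isXLinear_comul) (hM.comp D.isXLinear_comul) (fun w x hx => by
      change Λ (D.comul (el R x)) = M (D.comul (el R x))
      rw [D.comul_el hx, map_add Λ, map_add M,
        D.map_Psi _ _ hΛ, D.map_Psi _ _ hM, h1, h2, h5, h6, ptensor_eq, map_mul Λ, map_mul M, h2, h6,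
        h1', h5', comul_P, comul_H, D.comul_el hx, map_add, map_add, map_mul,
        D.map_Psi _ _ hα', h3, h3', h3', h4, ptensor_eq, ptensor_eq, map_mul, map_mul, h4, h3',
        ← D.Psi_comul hx, add_mul, mul_assoc, add_assoc]) f
  exact (mapCoeff_eq_mapAlgHom (ψ := (Algebra.TensorProduct.assoc R R R (U R L) (U R L) (U R L)).toAlgHom)
    (fun _ => rfl) _).trans key

/-! ### The antipode -/

/-- The antipode. -/
def antipode : (U R L)⟦X⟧ →ₗ[R] (U R L)⟦X⟧ :=
  extendLin ((lift R D.twist).toLinearMap ∘ₗ antipode₀ R L)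

theorem isXLinear_antipode : IsXLinear D.antipode := isXLinear_extend _

theorem antipode_C (a : U R L) :
    D.antipode (PowerSeries.C a) = lift R D.twist (antipode₀ R L a) := extend_C _ _

/-- S is the standard antipode followed by a genuine algebra morphism, so it reverses products on
constants. -/
theorem antipode_mul (f g : (U R L)⟦X⟧) :
    D.antipode (f * g) = D.antipode g * D.antipode f := by
  have hS := D.isXLinear_antipode
  refine IsXLinear.ext (φ := fun f => D.antipode (f * g))
    (ψ := fun f => D.antipode g * D.antipode f)
    (hS.comp (IsXLinear.id.mul_right g)) (hS.mul_left _) (fun a => ?_) f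
  refine IsXLinear.ext (φ := fun g => D.antipode (PowerSeries.C a * g))
    (ψ := fun g => D.antipode g * D.antipode (PowerSeries.C a))
    (hS.comp (IsXLinear.id.mul_left _)) (hS.mul_right _) (fun b => ?_) g
  simp only [← map_mul (PowerSeries.C (R := U R L)), antipode_C, antipode₀_mul]
  rw [map_mul]

theorem antipode_one : D.antipode 1 = 1 := by
  rw [← map_one (PowerSeries.C (R := U R L)), antipode_C, antipode₀_one, map_one, map_one]

theorem antipode_el {w : ℤ} {x : L} (hx : x ∈ D.piece w) :
    D.antipode (el R x) = -(D.P (-w) * D.T 1 x) := by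
  rw [el, cst, antipode_C, antipode₀_ι, map_neg, lift_ι_apply, D.twist_apply hx]

theorem antipode_P_one : D.antipode (D.P 1) = D.P (-1) := by
  have h : D.antipode (el R D.e) = -(D.P (-1) * el R D.e) := by
    rw [D.antipode_el D.e_mem, T_apply, formalSum_eq_single _ fun ℓ => by
      rw [D.d_e, el_zero, zero_mul]]
    simp [rising_zero, D.d_zero]
  rw [P_one, ← PowerSeries.X_mul, map_sub, antipode_one, D.isXLinear_antipode.map_X_mul, h,
    PowerSeries.X_mul, neg_mul, mul_assoc, P_neg_one_mul_e]
  abel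

theorem antipode_P (z : ℤ) : D.antipode (D.P z) = D.P (-z) := by
  have h1 : D.antipode (D.P (-1)) = D.P 1 := by
    have h := D.antipode_mul (D.P (-1)) (D.P 1)
    rw [P_mul_P, neg_add_cancel, P_zero, antipode_one, antipode_P_one] at h
    calc D.antipode (D.P (-1)) = D.P 1 * (D.P (-1) * D.antipode (D.P (-1))) := by
          rw [← mul_assoc, P_mul_P, add_neg_cancel, P_zero, one_mul]
      _ = D.P 1 := by rw [← h, mul_one]
  induction z using Int.induction_on with
  | zero => rw [neg_zero, P_zero, antipode_one]
  | succ n ih =>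
    rw [← P_mul_P, antipode_mul, ih, antipode_P_one, P_mul_P, neg_add_rev]
  | pred n ih =>
    rw [sub_eq_add_neg, ← P_mul_P, antipode_mul, ih, h1, P_mul_P, neg_add_rev, neg_neg, neg_neg]

/-- Only two terms of the series survive, h - e (h + 1) t, and e (h + 1) = h e. -/
theorem antipode_H : D.antipode D.H = -(D.H * D.P 1) := by
  have hd : D.d 1 D.h = -D.e := by
    have := D.h_lie D.e_mem
    rw [D.d_one, ← lie_skew, this, one_smul]
  have he : el R (-D.e) = -el R D.e := by simp [el, cst]
  rw [D.antipode_el D.h_mem, neg_zero, P_zero, one_mul, T_apply, formalSum_eq,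
    formalSum_eq_single _ fun ℓ => by rw [D.d_h, el_zero, zero_mul]]
  simp only [zero_add, hd, he, rising, D.d_zero]
  have hh : D.H * (el R D.e * X) = (el R D.e * D.H + el R D.e) * X := by
    rw [← mul_assoc, H_mul_e]
  rw [P_one, mul_sub, hh, PowerSeries.X_mul]
  simp only [mul_add, add_mul, mul_assoc, mul_one, one_mul, Int.cast_one, Nat.cast_zero, add_zero,
    neg_mul]
  change -(D.H + _) = _
  abel

theorem antipode_smul_one (n : ℕ) : D.antipode (n : (U R L)⟦X⟧) = n := by
  rw [← nsmul_one, map_nsmul, antipode_one]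

theorem P_natCast_mul_H (ℓ : ℕ) :
    D.P ℓ * D.H * D.P 1 = D.H * D.P (ℓ + 1) - ℓ • D.P (ℓ + 1) + ℓ • D.P ℓ := by
  have h1 : D.P (ℓ + 1) * (((ℓ + 1 : ℤ) : (U R L)⟦X⟧) * (1 - D.P (-1))) =
      ((ℓ + 1 : ℤ) : (U R L)⟦X⟧) * (D.P (ℓ + 1) - D.P ℓ) := by
    rw [← mul_assoc, ((Int.cast_commute _ (D.P _)).symm).eq, mul_assoc, mul_sub, P_mul_P, mul_one,
      add_neg_cancel_right]
  rw [H_mul_P, mul_add, h1, mul_assoc, H_mul_P_one, mul_sub, mul_add, ← mul_assoc, P_mul_P, mul_one]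
  push_cast
  simp only [nsmul_eq_mul]
  noncomm_ring

/-- S reverses products and S(h) = -h (1 - et). Collecting the powers of 1 - et on the right lowers
h by one each time, so the rising product becomes a falling one, written as a rising product from 1
- ℓ. -/
theorem antipode_rising (ℓ : ℕ) :
    D.antipode (rising D.H 0 ℓ) = (-1 : R) ^ ℓ • (rising D.H (1 - ℓ) ℓ * D.P ℓ) := by
  induction ℓ with
  | zero => simp [rising_zero, P_zero, antipode_one]
  | succ ℓ ih =>
    have h1 : (1 - ((ℓ + 1 : ℕ) : ℤ)) = -ℓ := by push_cast; ring
    have h2 : (-(ℓ : ℤ) + 1) = 1 - ℓ := by ring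
    have h3 : (D.H + ((-(ℓ : ℤ) : ℤ) : (U R L)⟦X⟧)) * rising D.H (1 - ℓ) ℓ =
        rising D.H (1 - ℓ) ℓ * (D.H + ((-(ℓ : ℤ) : ℤ) : (U R L)⟦X⟧)) :=
      (commute_rising ((Commute.refl D.H).add_left (Int.cast_commute _ _)) _ _).eq
    rw [rising_succ_left, antipode_mul, ih, map_add, map_add, antipode_H, antipode_smul_one, h1,
      rising_succ', h2, h3, smul_mul_assoc, pow_succ, mul_smul, mul_assoc, mul_assoc]
    congr 1
    rw [neg_one_smul, ← mul_neg (rising _ _ _)]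
    congr 1
    have h4 := D.P_natCast_mul_H ℓ
    rw [mul_assoc] at h4
    rw [Int.cast_zero, map_zero, add_zero, mul_add, mul_neg, h4]
    push_cast
    rw [← ((Nat.cast_commute ℓ (D.P ℓ))).eq, nsmul_eq_mul, nsmul_eq_mul]
    noncomm_ring

theorem T_eq {w : ℤ} {x : L} (hx : x ∈ D.piece w) (c : ℤ) :
    D.T c x = formalSum fun ℓ => rising D.H (c - w - ℓ) ℓ * el R (D.d ℓ x) := by
  rw [T_apply]
  refine formalSum_congr fun ℓ => ?_
  rw [D.rising_h_mul (D.d_mem ℓ hx)]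
  congr 2; ring

/-- The convolution of the antipode and the identity, on the completed tensor square. -/
def convLeft (F : (U R L ⊗[R] U R L)⟦X⟧) : (U R L)⟦X⟧ :=
  mapCoeff (LinearMap.mul' R (U R L)) (tensorMap D.antipode LinearMap.id F)

theorem isXLinear_convLeft : IsXLinear D.convLeft :=
  (isXLinear_mapCoeff _).comp (isXLinear_tensorMap _ _)

theorem convLeft_ptensor (f g : (U R L)⟦X⟧) :
    D.convLeft (ptensor R f g) = D.antipode f * g := by
  rw [convLeft, tensorMap_ptensor D.isXLinear_antipode IsXLinear.id, mapCoeff_mul'_ptensor]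
  rfl

theorem convLeft_mul_ptensor (F : (U R L ⊗[R] U R L)⟦X⟧) (f g : (U R L)⟦X⟧) :
    D.convLeft (F * ptensor R f g) = D.antipode f * D.convLeft F * g := by
  refine IsXLinear.ext_tensor (φ := fun F => D.convLeft (F * ptensor R f g))
    (ψ := fun F => D.antipode f * D.convLeft F * g)
    (D.isXLinear_convLeft.comp (IsXLinear.id.mul_right _))
    ((D.isXLinear_convLeft.mul_left _).mul_right _) (fun a b => ?_) F
  rw [ptensor_mul, convLeft_ptensor, convLeft_ptensor, antipode_mul]
  simp only [mul_assoc]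

/-- For a second factor a ⊗ b the value is S(a) · convLeft(F) · b, and a scalar in the middle is
central. The antipode axiom is thus inherited by products and need only be checked on generators. -/
theorem convLeft_mul {F : (U R L ⊗[R] U R L)⟦X⟧} {c : R⟦X⟧} (h : D.convLeft F = scal R (U R L) c)
    (G : (U R L ⊗[R] U R L)⟦X⟧) : D.convLeft (F * G) = scal R (U R L) c * D.convLeft G := by
  refine IsXLinear.ext_tensor (φ := fun G => D.convLeft (F * G))
    (ψ := fun G => scal R (U R L) c * D.convLeft G)
    (D.isXLinear_convLeft.comp (IsXLinear.id.mul_left _))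
    (D.isXLinear_convLeft.mul_left _) (fun a b => ?_) G
  rw [convLeft_mul_ptensor, convLeft_ptensor, h, ← scal_mul_comm, mul_assoc]

/-- Conjugation by (1 - et)^w turns the first contribution into minus the series of x with parameter
1 + w. With `h` moved to the left, its terms are those of the second contribution by
`antipode_rising`, where (1 - et)^ℓ cancels (1 - et)^(-ℓ). -/
theorem convLeft_comul_el {w : ℤ} {x : L} (hx : x ∈ D.piece w) :
    D.convLeft (D.comul (el R x)) = 0 := by
  have hS := D.isXLinear_convLeft
  rw [D.comul_el hx, hS.map_add, convLeft_ptensor, D.antipode_el hx, neg_mul, mul_assoc,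
    T_mul_P, ← mul_assoc, P_mul_P, neg_add_cancel, P_zero, one_mul, D.T_eq hx, Psi_apply,
    hS.map_formalSum, neg_add_eq_zero]
  refine formalSum_congr fun ℓ => ?_
  rw [← algHom_rising, ← smul_mul_assoc, ← map_smul, ← ptensor_eq, convLeft_ptensor, map_smul,
    antipode_rising, smul_smul, ← mul_pow, neg_one_mul, neg_neg, one_pow, one_smul, mul_assoc,
    ← mul_assoc (D.P ℓ), P_mul_P, add_neg_cancel, P_zero, one_mul]
  congr 2; ring

theorem antipode_left (f : (U R L)⟦X⟧) : D.convLeft (D.comul f) = scal R (U R L) (counit f) := by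
  have hL := D.isXLinear_convLeft.comp D.isXLinear_comul
  have hR : IsXLinear fun f : (U R L)⟦X⟧ => scal R (U R L) (counit f) :=
    (IsXLinear.map _).comp isXLinear_counit
  refine hL.ext hR (fun a => ?_) f
  induction a using U_induction with
  | algebraMap r =>
    rw [← PowerSeries.algebraMap_apply, AlgHom.commutes, AlgHom.commutes]
    have h1 : algebraMap R (U R L ⊗[R] U R L)⟦X⟧ r = r • ptensor R 1 1 := by
      rw [ptensor_eq, map_one, map_one, mul_one, Algebra.algebraMap_eq_smul_one]
    have h2 : r • ptensor R 1 1 = ptensor R (r • 1 : (U R L)⟦X⟧) (1 : (U R L)⟦X⟧) := by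
      rw [ptensor_eq, ptensor_eq, map_smul, smul_mul_assoc]
    rw [h1, h2, convLeft_ptensor, map_smul, antipode_one, mul_one, ← PowerSeries.C_eq_algebraMap,
      scal, PowerSeries.map_C, ← PowerSeries.algebraMap_apply, Algebra.algebraMap_eq_smul_one]
  | ι x =>
    induction x using D.weight_induction with
    | zero => rw [map_zero, map_zero, hL.map_zero, hR.map_zero]
    | add x y hx hy => rw [map_add, map_add, hL.map_add, hR.map_add, hx, hy]
    | mem w x hx =>
      refine (D.convLeft_comul_el hx).trans ?_
      rw [show PowerSeries.C (ι R x) = el R x from rfl, counit_el, scal, map_zero]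
  | add a b ha hb => rw [map_add, hL.map_add, hR.map_add, ha, hb]
  | mul a b ha hb => rw [map_mul, map_mul, D.convLeft_mul ha, hb, map_mul, scal, map_mul]

/-- The convolution of the identity and the antipode, on the completed tensor square. -/
def convRight (F : (U R L ⊗[R] U R L)⟦X⟧) : (U R L)⟦X⟧ :=
  mapCoeff (LinearMap.mul' R (U R L)) (tensorMap LinearMap.id D.antipode F)

theorem isXLinear_convRight : IsXLinear D.convRight :=
  (isXLinear_mapCoeff _).comp (isXLinear_tensorMap _ _)

theorem convRight_ptensor (f g : (U R L)⟦X⟧) :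
    D.convRight (ptensor R f g) = f * D.antipode g := by
  rw [convRight, tensorMap_ptensor IsXLinear.id D.isXLinear_antipode, mapCoeff_mul'_ptensor]
  rfl

theorem convRight_ptensor_mul (F : (U R L ⊗[R] U R L)⟦X⟧) (f g : (U R L)⟦X⟧) :
    D.convRight (ptensor R f g * F) = f * D.convRight F * D.antipode g := by
  refine IsXLinear.ext_tensor (φ := fun F => D.convRight (ptensor R f g * F))
    (ψ := fun F => f * D.convRight F * D.antipode g)
    (D.isXLinear_convRight.comp (IsXLinear.id.mul_left _))
    ((D.isXLinear_convRight.mul_left _).mul_right _) (fun a b => ?_) F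
  rw [ptensor_mul, convRight_ptensor, convRight_ptensor, antipode_mul]
  simp only [mul_assoc]

theorem convRight_mul {F : (U R L ⊗[R] U R L)⟦X⟧} {c : R⟦X⟧}
    (h : D.convRight F = scal R (U R L) c) (G : (U R L ⊗[R] U R L)⟦X⟧) :
    D.convRight (G * F) = D.convRight G * scal R (U R L) c := by
  refine IsXLinear.ext_tensor (φ := fun G => D.convRight (G * F))
    (ψ := fun G => D.convRight G * scal R (U R L) c)
    (D.isXLinear_convRight.comp (IsXLinear.id.mul_right _))
    (D.isXLinear_convRight.mul_right _) (fun a b => ?_) G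
  rw [convRight_ptensor_mul, convRight_ptensor, h, mul_assoc, scal_mul_comm, mul_assoc]

/-- Here the cancellation is not term by term. After (1 - et)^(-w) is taken out on the left, the
coefficients of d_N(x) agree by `sum_rising_mul_rising_neg` with G = h - w and v = (1 - et)^(-1). -/
theorem convRight_comul_el {w : ℤ} {x : L} (hx : x ∈ D.piece w) :
    D.convRight (D.comul (el R x)) = 0 := by
  have hS := D.isXLinear_convRight
  -- The conjugate of x by a power of 1 - et is read off from `Psi_mul_P` with Z = 0, where the
  -- series of parameter 0 is x itself.
  have h1 : el R x * D.P (-w) = D.P (-w) * formalSum fun N => (-1 : R) ^ N •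
      (rising 0 w N * D.P (-1) ^ N * el R (D.d N x)) := by
    have := D.Psi_mul_P (j := AlgHom.id R _) (Z := 0) IsXLinear.id
      (fun f => Commute.zero_right _) x 0 (-w)
    rw [Psi_zero_zero, sub_neg_eq_add, zero_add, Psi_apply] at this
    simpa only [AlgHom.id_apply, P_neg_natCast, mul_assoc] using this
  have hHG : ∀ ℓ, rising D.H 0 ℓ * D.P (-w) = D.P (-w) *
      rising (D.H - (w : (U R L)⟦X⟧) + (w : (U R L)⟦X⟧) * D.P (-1)) 0 ℓ := fun ℓ => by
    refine rising_mul_of_semiconj ?_ 0 ℓ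
    rw [H_mul_P]
    congr 1
    push_cast; noncomm_ring
  have hG : (D.H - (w : (U R L)⟦X⟧)) * D.P (-1) = D.P (-1) * (D.H - (w : (U R L)⟦X⟧)) +
      D.P (-1) * D.P (-1) - D.P (-1) := by
    rw [sub_mul, H_mul_P_neg_one, mul_sub, (Int.cast_commute w (D.P (-1))).eq]
    abel
  have h2 : D.convRight (D.Psi (inr R _ _) D.H₁ 0 x) = -(D.P (-w) * formalSum fun ℓ =>
      formalSum fun m => (-1 : R) ^ (ℓ + m) • ((ℓ + m).choose ℓ •
        (rising (D.H - (w : (U R L)⟦X⟧) + (w : (U R L)⟦X⟧) * D.P (-1)) 0 ℓ *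
          rising (-(D.H - (w : (U R L)⟦X⟧))) 0 m * el R (D.d (ℓ + m) x)))) := by
    rw [Psi_apply, hS.map_formalSum, mul_formalSum, ← formalSum_neg]
    refine formalSum_congr fun ℓ => ?_
    have e0 : D.P (-(w + ℓ)) * D.P ℓ = D.P (-w) := by rw [P_mul_P]; congr 1; ring
    rw [← algHom_rising, ← smul_mul_assoc, ← map_smul, ← ptensor_eq, convRight_ptensor,
      antipode_mul, antipode_P, neg_neg, D.antipode_el (D.d_mem ℓ hx), neg_mul, mul_assoc,
      T_mul_P, ← mul_assoc (D.P _), e0, mul_neg, smul_mul_assoc, ← mul_assoc, hHG, mul_assoc,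
      ← mul_smul_comm, D.T_eq (D.d_mem ℓ hx), mul_formalSum, ← formalSum_smul]
    congr 2
    refine formalSum_congr fun m => ?_
    have e1 : (1 + ℓ - (w + ℓ) - m : ℤ) = 1 - m + -w := by ring
    have e3 : el R (D.d m (D.d ℓ x)) = (ℓ + m).choose ℓ • el R (D.d (ℓ + m) x) := by
      rw [D.d_d, add_comm m ℓ, el_nsmul, nsmul_eq_mul, Nat.choose_symm_add]
    have e4 : D.H + ((-w : ℤ) : (U R L)⟦X⟧) = D.H - (w : (U R L)⟦X⟧) := by push_cast; abel
    have e5 : ∀ y : (U R L)⟦X⟧, (-1) ^ m * y = (-1 : R) ^ m • y := fun y => by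
      rw [Algebra.smul_def, map_pow, map_neg, map_one]
    rw [e1, ← rising_add_cast, e4, rising_neg, e3, e5, pow_add, mul_smul]
    simp only [smul_mul_assoc, mul_smul_comm, mul_assoc]
    rw [smul_comm ((ℓ + m).choose ℓ)]
  rw [D.comul_el hx, hS.map_add, h2, convRight_ptensor, antipode_P, h1, formalSum_formalSum,
    ← sub_eq_add_neg, ← mul_sub, ← formalSum_sub]
  suffices h : ∀ N : ℕ, (-1 : R) ^ N • (rising 0 w N * D.P (-1) ^ N * el R (D.d N x)) =
      ∑ ij ∈ Finset.HasAntidiagonal.antidiagonal N, (-1 : R) ^ (ij.1 + ij.2) •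
        ((ij.1 + ij.2).choose ij.1 •
          (rising (D.H - (w : (U R L)⟦X⟧) + (w : (U R L)⟦X⟧) * D.P (-1)) 0 ij.1 *
            rising (-(D.H - (w : (U R L)⟦X⟧))) 0 ij.2 * el R (D.d (ij.1 + ij.2) x))) by
    simp only [h, sub_self, formalSum_zero, mul_zero]
  intro N
  rw [← sum_rising_mul_rising_neg hG, Finset.sum_mul, Finset.smul_sum]
  refine Finset.sum_congr rfl fun ij hij => ?_
  rw [Finset.HasAntidiagonal.mem_antidiagonal.mp hij, smul_mul_assoc]

theorem antipode_right (f : (U R L)⟦X⟧) :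
    D.convRight (D.comul f) = scal R (U R L) (counit f) := by
  have hL := D.isXLinear_convRight.comp D.isXLinear_comul
  have hR : IsXLinear fun f : (U R L)⟦X⟧ => scal R (U R L) (counit f) :=
    (IsXLinear.map _).comp isXLinear_counit
  refine hL.ext hR (fun a => ?_) f
  induction a using U_induction with
  | algebraMap r =>
    rw [← PowerSeries.algebraMap_apply, AlgHom.commutes, AlgHom.commutes]
    have h1 : algebraMap R (U R L ⊗[R] U R L)⟦X⟧ r = r • ptensor R 1 1 := by
      rw [ptensor_eq, map_one, map_one, mul_one, Algebra.algebraMap_eq_smul_one]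
    have h2 : r • ptensor R 1 1 = ptensor R (r • 1 : (U R L)⟦X⟧) (1 : (U R L)⟦X⟧) := by
      rw [ptensor_eq, ptensor_eq, map_smul, smul_mul_assoc]
    rw [h1, h2, convRight_ptensor, antipode_one, mul_one, ← PowerSeries.C_eq_algebraMap,
      scal, PowerSeries.map_C, ← PowerSeries.algebraMap_apply, Algebra.algebraMap_eq_smul_one]
  | ι x =>
    induction x using D.weight_induction with
    | zero => rw [map_zero, map_zero, hL.map_zero, hR.map_zero]
    | add x y hx hy => rw [map_add, map_add, hL.map_add, hR.map_add, hx, hy]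
    | mem w x hx =>
      refine (D.convRight_comul_el hx).trans ?_
      rw [show PowerSeries.C (ι R x) = el R x from rfl, counit_el, scal, map_zero]
  | add a b ha hb => rw [map_add, hL.map_add, hR.map_add, ha, hb]
  | mul a b ha hb => rw [map_mul, map_mul, D.convRight_mul hb, ha, map_mul, scal, map_mul]

/-- The Hopf structure. -/
def hopf : HopfU R L where
  comul := D.comul
  counit := counit
  antipode := D.antipode
  comul_scal := D.isXLinear_comul.map_scal
  counit_scal c := by
    rw [isXLinear_counit.map_scal]
    ext m; simp [scal]
  antipode_scal := D.isXLinear_antipode.map_scal_mul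
  coassoc := D.coassoc
  counit_left := D.counit_left
  counit_right := D.counit_right
  antipode_left := D.antipode_left
  antipode_right := D.antipode_right

end JordanianDatum

end Env

/-! ### Reduction modulo t to the standard structure, and functoriality in the datum. -/

namespace FormalAlg

section

variable {R A B : Type*} [CommRing R] [Ring A] [Algebra R A] [Ring B] [Algebra R B]

theorem constantCoeff_ptensor (f : A⟦X⟧) (g : B⟦X⟧) :
    PowerSeries.constantCoeff (ptensor R f g) =
      PowerSeries.constantCoeff f ⊗ₜ PowerSeries.constantCoeff g := by
  simp only [← PowerSeries.coeff_zero_eq_constantCoeff_apply, ptensor, PowerSeries.coeff_mk]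
  simp

/-- An X-linear map is well defined modulo t, so the quantization conditions concern constants only.
-/
theorem IsXLinear.constantCoeff_eq {A B : Type*} [Ring A] [Ring B] {φ : A⟦X⟧ → B⟦X⟧}
    (hφ : IsXLinear φ) (f : A⟦X⟧) : PowerSeries.constantCoeff (φ f) =
      PowerSeries.constantCoeff (φ (PowerSeries.C (PowerSeries.constantCoeff f))) := by
  rw [f.eq_X_mul_shift_add_const, hφ.map_add, hφ.map_X_mul]
  simp

theorem neg_one_pow_smul (ℓ : ℕ) (a : A) : (-1 : R) ^ ℓ • a = (-1) ^ ℓ * a := by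
  rw [Algebra.smul_def, map_pow, map_neg, map_one]

end

section

variable {R S A B : Type*} [CommRing R] [CommRing S] [Ring A] [Algebra R A] [Ring B] [Algebra S B]
  {σ : R →+* S} {φ : A →+* B} (h : ∀ r, φ (algebraMap R A r) = algebraMap S B (σ r))

theorem tensorSq_tmul (a b : A) : tensorSq σ φ h (a ⊗ₜ b) = φ a ⊗ₜ φ b := rfl

/-- The map `a ⊗ b ↦ φ a ⊗ φ b` is a morphism of rings. -/
def tensorSqHom : A ⊗[R] A →+* B ⊗[S] B where
  toFun := tensorSq σ φ h
  map_zero' := map_zero _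
  map_add' := map_add _
  map_one' := by
    rw [Algebra.TensorProduct.one_def, tensorSq_tmul, map_one, Algebra.TensorProduct.one_def]
  map_mul' x y := by
    induction x using TensorProduct.induction_on with
    | zero => rw [zero_mul, map_zero, zero_mul]
    | add x x' hx hx' => rw [add_mul, map_add, map_add, hx, hx', add_mul]
    | tmul a b =>
      induction y using TensorProduct.induction_on with
      | zero => rw [mul_zero, map_zero, mul_zero]
      | add x x' hx hx' => rw [mul_add, map_add, map_add, hx, hx', mul_add]
      | tmul c d =>
        rw [Algebra.TensorProduct.tmul_mul_tmul, tensorSq_tmul, tensorSq_tmul, tensorSq_tmul,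
          Algebra.TensorProduct.tmul_mul_tmul, map_mul, map_mul]

theorem map_tensorSqHom_ptensor (f g : A⟦X⟧) :
    PowerSeries.map (tensorSqHom h) (ptensor R f g) =
      ptensor S (PowerSeries.map φ f) (PowerSeries.map φ g) := by
  ext m
  simp only [PowerSeries.coeff_map, ptensor, PowerSeries.coeff_mk, map_sum]
  rfl

end

end FormalAlg

namespace Env

open FormalAlg UniversalEnvelopingAlgebra
open PowerSeries (X)

attribute [local instance 100] LieRing.ofAssociativeRing

variable {R L ι' : Type*} [CommRing R] [LieRing L] [LieAlgebra R L]

theorem comul₀_ι (x : L) : comul₀ R L (ι R x) = ι R x ⊗ₜ 1 + 1 ⊗ₜ ι R x := by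
  rw [comul₀, lift_ι_apply]; rfl

namespace JordanianDatum

variable (D : JordanianDatum R L ι')

theorem constantCoeff_comul_C (a : U R L) :
    PowerSeries.constantCoeff (D.comul (PowerSeries.C a)) = comul₀ R L a := by
  induction a using U_induction with
  | algebraMap r =>
    rw [← PowerSeries.algebraMap_apply, AlgHom.commutes, AlgHom.commutes,
      PowerSeries.algebraMap_apply, PowerSeries.constantCoeff_C]
  | ι x =>
    induction x using D.weight_induction with
    | zero => simp
    | add x y hx hy => rw [map_add, map_add, map_add, map_add, map_add, hx, hy]
    | mem w x hx =>
      have h := D.comul_el hx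
      rw [el, cst] at h
      rw [h, comul₀_ι, map_add, constantCoeff_ptensor, PowerSeries.constantCoeff_C,
        constantCoeff_oneSubPow, Psi_apply, constantCoeff_formalSum, D.d_zero, pow_zero, one_smul,
        rising_zero, one_mul, Nat.cast_zero, neg_zero, P_zero, one_mul, el, cst, inr_C,
        PowerSeries.constantCoeff_C]
  | add a b ha hb => rw [map_add, map_add, map_add, map_add, ha, hb]
  | mul a b ha hb => rw [map_mul, map_mul, map_mul, map_mul, ha, hb]

theorem constantCoeff_lift_twist (a : U R L) :
    PowerSeries.constantCoeff (lift R D.twist a) = a := by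
  induction a using U_induction with
  | algebraMap r =>
    rw [AlgHom.commutes, PowerSeries.algebraMap_apply, PowerSeries.constantCoeff_C]
  | ι x =>
    rw [lift_ι_apply]
    induction x using D.weight_induction with
    | zero => simp
    | add x y hx hy => rw [map_add, map_add, map_add, hx, hy]
    | mem w x hx =>
      rw [D.twist_apply hx, map_mul, constantCoeff_oneSubPow, one_mul, T_apply,
        constantCoeff_formalSum, D.d_zero, rising_zero, mul_one, el, cst,
        PowerSeries.constantCoeff_C]
  | add a b ha hb => rw [map_add, map_add, ha, hb]
  | mul a b ha hb => rw [map_mul, map_mul, ha, hb]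

theorem isQuantization : IsQuantization D.hopf where
  comul f := (D.isXLinear_comul.constantCoeff_eq f).trans (D.constantCoeff_comul_C _)
  counit f := by
    change PowerSeries.constantCoeff (counit f) = _
    rw [isXLinear_counit.constantCoeff_eq f, counit_C, PowerSeries.constantCoeff_C]
  antipode f := by
    change PowerSeries.constantCoeff (D.antipode f) = _
    rw [D.isXLinear_antipode.constantCoeff_eq f, antipode_C, constantCoeff_lift_twist]

theorem hopf_comul_el {w : ℤ} {x : L} (hx : x ∈ D.piece w) : D.hopf.comul (el R x) =
    ptensor R (el R x) (oneSubPow (inU R D.e) w) + formalSum fun ℓ => (-1 : R) ^ ℓ •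
      ptensor R (cst (rising (inU R D.h) 0 ℓ))
        (oneSubPow (inU R D.e) (-ℓ) * el R (D.d ℓ x)) := by
  refine (D.comul_el hx).trans ?_
  rw [Psi_apply]
  congr 1
  refine formalSum_congr fun ℓ => ?_
  rw [ptensor_eq, cst_rising_h, algHom_rising]

theorem hopf_antipode_el {w : ℤ} {x : L} (hx : x ∈ D.piece w) : D.hopf.antipode (el R x) =
    -(oneSubPow (inU R D.e) (-w) * formalSum fun ℓ =>
      el R (D.d ℓ x) * cst (rising (inU R D.h) 1 ℓ)) := by
  refine (D.antipode_el hx).trans ?_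
  rw [T_apply]
  simp only [cst_rising_h]

theorem hopf_counit_el (x : L) : D.hopf.counit (el R x) = 0 := counit_el x

/-- A morphism of graded Lie algebras compatible with the data induces a morphism of the Hopf
structures. -/
theorem isInducedBy {S L' κ : Type*} [CommRing S] [LieRing L'] [LieAlgebra S L']
    (D' : JordanianDatum S L' κ) {σ : R →+* S} {π : U R L →+* U S L'}
    (compat : ∀ r, π (algebraMap R (U R L) r) = algebraMap S (U S L') (σ r)) {ϖ : L → L'}
    (hπ : ∀ x, π (ι R x) = ι S (ϖ x)) (hh : ϖ D.h = D'.h) (he : ϖ D.e = D'.e)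
    (hd : ∀ ℓ x, ϖ (D.d ℓ x) = D'.d ℓ (ϖ x)) (hW : ∀ w x, x ∈ D.piece w → ϖ x ∈ D'.piece w) :
    IsInducedBy σ π D.hopf D'.hopf := by
  have hel : ∀ x, PowerSeries.map π (el R x) = el S (ϖ x) := fun x => by
    rw [el, cst, PowerSeries.map_C, hπ]; rfl
  have hP : ∀ z, PowerSeries.map π (D.P z) = D'.P z := fun z => by
    rw [P, map_oneSubPow, hπ, he]
  have hr : ∀ c ℓ, PowerSeries.map π (rising D.H c ℓ) = rising D'.H c ℓ := fun c ℓ => by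
    rw [map_rising, hel, hh]
  have hmapC : ∀ r, PowerSeries.map π (PowerSeries.C (algebraMap R _ r)) =
      algebraMap S _ (σ r) := fun r => by
    rw [PowerSeries.map_C, compat, PowerSeries.algebraMap_apply]
  refine ⟨compat, fun f m => ?_, fun f => ?_, fun f => ?_⟩
  · have key : D'.comul (PowerSeries.map π f) =
        PowerSeries.map (tensorSqHom compat) (D.comul f) := by
      have h1 : IsXLinear fun f => D'.comul (PowerSeries.map π f) :=
        D'.isXLinear_comul.comp (IsXLinear.map π)
      have h2 : IsXLinear fun f => PowerSeries.map (tensorSqHom compat) (D.comul f) :=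
        (IsXLinear.map _).comp D.isXLinear_comul
      refine h1.ext h2 (fun a => ?_) f
      induction a using U_induction with
      | algebraMap r =>
        rw [hmapC, AlgHom.commutes, ← PowerSeries.algebraMap_apply, AlgHom.commutes,
          PowerSeries.algebraMap_apply, PowerSeries.algebraMap_apply, PowerSeries.map_C]
        congr 1
        rw [Algebra.TensorProduct.algebraMap_apply, Algebra.TensorProduct.algebraMap_apply, ← compat,
          ← map_one π]
        rfl
      | ι x =>
        induction x using D.weight_induction with
        | zero => simp
        | add x y hx hy => rw [map_add, map_add, h1.map_add, h2.map_add, hx, hy]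
        | mem w x hx =>
          change D'.comul (PowerSeries.map π (el R x)) =
            PowerSeries.map (tensorSqHom compat) (D.comul (el R x))
          rw [D.comul_el hx, hel, D'.comul_el (hW _ _ hx), map_add, map_tensorSqHom_ptensor, hel,
            hP, Psi_apply, Psi_apply, (IsXLinear.map _).map_formalSum]
          congr 1
          refine formalSum_congr fun ℓ => ?_
          rw [← algHom_rising, ← ptensor_eq, ← algHom_rising, ← ptensor_eq, neg_one_pow_smul,
            neg_one_pow_smul, map_mul, map_pow, map_neg, map_one, map_tensorSqHom_ptensor, hr,
            map_mul, hP, hel, hd]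
      | add a b ha hb => rw [map_add, h1.map_add, h2.map_add, ha, hb]
      | mul a b ha hb => rw [map_mul, map_mul, map_mul, map_mul, map_mul, ha, hb]
    change PowerSeries.coeff m (D'.comul (PowerSeries.map π f)) = _
    rw [key, PowerSeries.coeff_map]
    rfl
  · have hc : ∀ a, counit₀ S L' (π a) = σ (counit₀ R L a) := fun a => by
      induction a using U_induction with
      | algebraMap r =>
        rw [compat, AlgHom.commutes, AlgHom.commutes]; rfl
      | ι x => rw [hπ, counit₀_ι, counit₀_ι, map_zero]
      | add a b ha hb => rw [map_add, map_add, map_add, map_add, ha, hb]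
      | mul a b ha hb => rw [map_mul, map_mul, map_mul, map_mul, ha, hb]
    change counit (PowerSeries.map π f) = PowerSeries.map σ (counit f)
    ext m
    rw [counit, coeff_mapAlgHom, PowerSeries.coeff_map, PowerSeries.coeff_map, counit,
      coeff_mapAlgHom, hc]
  · change D'.antipode (PowerSeries.map π f) = PowerSeries.map π (D.antipode f)
    have h1 : IsXLinear fun f => D'.antipode (PowerSeries.map π f) :=
      D'.isXLinear_antipode.comp (IsXLinear.map π)
    have h2 : IsXLinear fun f => PowerSeries.map π (D.antipode f) :=
      (IsXLinear.map _).comp D.isXLinear_antipode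
    refine h1.ext h2 (fun a => ?_) f
    induction a using U_induction with
    | algebraMap r =>
      rw [hmapC, ← PowerSeries.algebraMap_apply, Algebra.algebraMap_eq_smul_one,
        Algebra.algebraMap_eq_smul_one, map_smul, map_smul, antipode_one, antipode_one,
        ← Algebra.algebraMap_eq_smul_one, ← Algebra.algebraMap_eq_smul_one,
        PowerSeries.algebraMap_apply, PowerSeries.algebraMap_apply, PowerSeries.map_C, compat]
    | ι x =>
      induction x using D.weight_induction with
      | zero => rw [map_zero, map_zero, h1.map_zero, h2.map_zero]
      | add x y hx hy => rw [map_add, map_add, h1.map_add, h2.map_add, hx, hy]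
      | mem w x hx =>
        change D'.antipode (PowerSeries.map π (el R x)) = PowerSeries.map π (D.antipode (el R x))
        rw [D.antipode_el hx, hel, D'.antipode_el (hW _ _ hx), map_neg, map_mul, hP, T_apply,
          T_apply, (IsXLinear.map _).map_formalSum]
        simp only [map_mul, hel, hr, hd]
    | add a b ha hb => rw [map_add, h1.map_add, h2.map_add, ha, hb]
    | mul a b ha hb =>
      rw [map_mul, map_mul, antipode_mul, antipode_mul, map_mul, ha, hb]

end JordanianDatum

end Env

/-! ### Jordanian data on torsion-free Lie rings. -/

namespace Env

open scoped Nat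

variable {L ι' : Type*} [LieRing L]

theorem nsmul_cancel_of_basis (b : Module.Basis ι' ℤ L) {m : ℕ} (hm : m ≠ 0) {x y : L}
    (h : m • x = m • y) : x = y := by
  refine b.ext_elem fun i => ?_
  have := congrArg (fun z => b.repr z i) h
  simp only [map_nsmul, Finsupp.smul_apply, nsmul_eq_mul] at this
  exact mul_left_cancel₀ (Nat.cast_ne_zero.mpr hm) this

/-- Comparing coordinates gives (wt i - w) x_i = 0, and ℤ has no zero divisors. Weight spaces are
thus eigenspaces of ad h, which makes compatibility with brackets a case of the Jacobi identity. -/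
theorem mem_weightSpace_iff (b : Module.Basis ι' ℤ L) (wt : ι' → ℤ) (h : L)
    (hb : ∀ i, ⁅h, b i⁆ = wt i • b i) (w : ℤ) (x : L) :
    x ∈ weightSpace b wt w ↔ ⁅h, x⁆ = w • x := by
  constructor
  · intro hx
    have := LinearMap.eqOn_span (s := b '' {i | wt i = w}) (f := (LieAlgebra.ad ℤ L h).toAddMonoidHom.toIntLinearMap)
      (g := w • LinearMap.id) ?_ hx
    · simpa using this
    · rintro _ ⟨i, rfl, rfl⟩
      simp [hb]
  · intro hx
    rw [weightSpace, b.mem_span_image]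
    intro i hi
    have hr : b.repr ⁅h, x⁆ i = wt i * b.repr x i := by
      conv_lhs => rw [← b.linearCombination_repr x, Finsupp.linearCombination_apply, Finsupp.sum,
        lie_sum, map_sum]
      rw [Finsupp.finsetSum_apply]
      simp only [lie_smul, hb, map_smul, Module.Basis.repr_self, Finsupp.smul_single, smul_eq_mul,
        mul_one]
      rw [Finset.sum_eq_single_of_mem i hi fun j _ hj => Finsupp.single_eq_of_ne hj.symm,
        Finsupp.single_eq_same, mul_comm]
    rw [hx, map_smul, Finsupp.smul_apply, smul_eq_mul] at hr
    exact (mul_right_cancel₀ (Finsupp.mem_support_iff.mp hi) hr).symm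

variable (b : Module.Basis ι' ℤ L) (wt : ι' → ℤ) (h e : L) (d : ℕ → L →ₗ[ℤ] L)

/-- The datum given by a Lie ring with a homogeneous basis on which the divided powers of the
adjoint action of `e` are defined. -/
def JordanianDatum.ofAd (hh : ∀ i, ⁅h, b i⁆ = wt i • b i)
    (h_mem : h ∈ weightSpace b wt 0) (e_mem : e ∈ weightSpace b wt 1)
    (hd : ∀ (ℓ : ℕ) x, ℓ ! • d ℓ x = (fun y => ⁅e, y⁆)^[ℓ] x)
    (d_mem : ∀ (ℓ : ℕ) i, d ℓ (b i) ∈ weightSpace b wt (wt i + ℓ)) : JordanianDatum ℤ L ι' :=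
  have hmem := mem_weightSpace_iff b wt h hh
  have hlin : ∀ (ℓ m : ℕ) (x : L), (fun y => ⁅e, y⁆)^[ℓ] (m • x) = m • (fun y => ⁅e, y⁆)^[ℓ] x := by
    intro ℓ m
    induction ℓ with
    | zero => intro x; rfl
    | succ ℓ ih => intro x; simp only [Function.iterate_succ_apply, lie_nsmul, ih]
  have hhe : ⁅e, h⁆ = -e := by rw [← lie_skew, (hmem 1 e).mp e_mem, one_smul]
  { basis := b
    wt := wt
    h := h
    e := e
    d := d
    lie_mem := fun {w v x y} hx hy => by
      rw [hmem] at hx hy ⊢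
      rw [leibniz_lie, hx, hy, smul_lie, lie_smul, add_smul]
    d_mem := fun {w x} ℓ hx => by
      have : weightSpace b wt w ≤ (weightSpace b wt (w + ℓ)).comap (d ℓ) := by
        rw [weightSpace, Submodule.span_le]
        rintro _ ⟨i, rfl, rfl⟩
        exact d_mem ℓ i
      exact this hx
    h_mem := h_mem
    e_mem := e_mem
    h_lie := fun {w x} hx => (hmem w x).mp hx
    d_zero := fun x => by simpa using hd 0 x
    d_one := fun x => by simpa using hd 1 x
    -- Here and below, the identity is multiplied by factorials to become one about iterates of ad e
    -- (for brackets, the iterated Leibniz rule), and the factor is then cancelled.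
    d_d := fun m ℓ x => by
      refine nsmul_cancel_of_basis b (mul_ne_zero m.factorial_ne_zero ℓ.factorial_ne_zero) ?_
      rw [mul_comm, mul_smul, hd, ← hlin, hd, ← Function.iterate_add_apply, ← hd, smul_smul,
        ← Nat.add_choose_mul_factorial_mul_factorial m ℓ, Nat.choose_symm_add]
      congr 1; ring
    d_lie := fun N x y => by
      refine nsmul_cancel_of_basis b N.factorial_ne_zero ?_
      have key := (LieDerivation.ad ℤ L e).iterate_apply_lie N x y
      have hf : ⇑(LieDerivation.ad ℤ L e) = fun y => ⁅e, y⁆ := by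
        funext y; exact LieDerivation.ad_apply_apply ℤ L e y
      rw [hf] at key
      rw [hd, key, Finset.smul_sum]
      refine Finset.sum_congr rfl fun ij hij => ?_
      rw [← hd, ← hd, nsmul_lie, lie_nsmul, smul_smul, smul_smul,
        ← Finset.HasAntidiagonal.mem_antidiagonal.mp hij,
        ← Nat.add_choose_mul_factorial_mul_factorial, mul_assoc, mul_assoc, Nat.choose_symm_add]
    d_e := fun ℓ => by
      refine nsmul_cancel_of_basis b (ℓ + 1).factorial_ne_zero ?_
      rw [hd, Function.iterate_succ_apply, lie_self, smul_zero]
      simpa using hlin ℓ 0 0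
    d_h := fun ℓ => by
      refine nsmul_cancel_of_basis b (ℓ + 2).factorial_ne_zero ?_
      rw [hd, Function.iterate_succ_apply, Function.iterate_succ_apply, hhe, lie_neg, lie_self,
        smul_zero, neg_zero]
      simpa using hlin ℓ 0 0 }

end Env

/-! ### The integral form: divided powers of ad(x_k² D_k) on polynomial derivations. -/

namespace Witt

open Env
open scoped Nat

section

variable {n : ℕ}

/-- For i = k, subtracting ℓ ∏_{j<ℓ-1} (a - 1 + j) from ∏_{j<ℓ} (a - 1 + j) replaces the last factor
by a - 2. The right-hand side is the scalar in (ad x_k² D_k)^ℓ, so C_ℓ is its quotient by ℓ!. -/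
theorem factorial_mul_coeffC (a : ℕ) (i k : Fin n) (ℓ : ℕ) :
    (ℓ ! : ℤ) * coeffC a i k ℓ = ∏ j ∈ Finset.range ℓ, ((a : ℤ) - 2 * kron i k + (j : ℤ)) := by
  rw [coeffC, mul_sub, coeffA_spec]
  rcases ℓ with _ | ℓ
  · simp [coeffB]
  · rw [coeffB, Nat.factorial_succ, mul_left_comm, Nat.cast_mul, mul_assoc (((ℓ + 1 : ℕ) : ℤ)),
      coeffA_spec]
    by_cases h : i = k
    · rw [kron, if_pos h, Finset.prod_range_succ, Finset.prod_range_succ']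
      rw [Finset.prod_congr rfl (g := fun j : ℕ => (a : ℤ) - 1 + j) (s₂ := Finset.range ℓ)
        (f := fun j : ℕ => (a : ℤ) - 2 * 1 + ((j + 1 : ℕ) : ℤ)) (fun j _ => by push_cast; ring)]
      push_cast; ring
    · rw [kron, if_neg h]; simp

theorem coeffC_succ (a : ℕ) (i k : Fin n) (ℓ : ℕ) :
    ((ℓ : ℤ) + 1) * coeffC a i k (ℓ + 1) = ((a : ℤ) + ℓ - 2 * kron i k) * coeffC a i k ℓ := by
  have h1 := factorial_mul_coeffC a i k (ℓ + 1)
  rw [Finset.prod_range_succ, ← factorial_mul_coeffC, Nat.factorial_succ] at h1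
  refine mul_left_cancel₀ (Nat.cast_ne_zero.mpr ℓ.factorial_ne_zero : (ℓ ! : ℤ) ≠ 0) ?_
  push_cast at h1
  linear_combination h1

theorem coeffC_zero (a : ℕ) (i k : Fin n) : coeffC a i k 0 = 1 := by
  simpa using factorial_mul_coeffC a i k 0

end

section

variable {R : Type*} [CommRing R] {n : ℕ}

open MvPolynomial in
theorem xDPlus_apply_X (α : Fin n →₀ ℕ) (i j : Fin n) :
    xDPlus R α i (X j) = if j = i then monomial α 1 else 0 := by
  rw [xDPlus, Derivation.smul_apply, pderiv_X, smul_eq_mul, Pi.single_apply, mul_ite, mul_one,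
    mul_zero]

variable (R n) in
/-- The basis `x^α D_i` of `W⁺`, indexed by the pairs `⟨i, α⟩`. -/
def basisPlus : Module.Basis (Σ _ : Fin n, Fin n →₀ ℕ) R (WPlus R n) :=
  (Pi.basis fun _ : Fin n => MvPolynomial.basisMonomials (Fin n) R).map
    (MvPolynomial.mkDerivationEquiv R)

theorem basisPlus_apply (s : Σ _ : Fin n, Fin n →₀ ℕ) : basisPlus R n s = xDPlus R s.2 s.1 := by
  refine MvPolynomial.derivation_ext fun j => ?_
  rw [xDPlus_apply_X, basisPlus, Module.Basis.map_apply]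
  change MvPolynomial.mkDerivation R _ _ = _
  rw [MvPolynomial.mkDerivation_X, Pi.basis_apply, Pi.single_apply]
  rfl

open MvPolynomial in
-- The case m = 0 gives the action of `h`, the case m = 1 that of `e`.
theorem lie_xDPlus_single (m : ℕ) (α : Fin n →₀ ℕ) (i k : Fin n) :
    ⁅xDPlus R (Finsupp.single k (m + 1)) k, xDPlus R α i⁆ =
      (((α k : ℤ) - (m + 1) * kron i k) : ℤ) • xDPlus R (α + Finsupp.single k m) i := by
  refine derivation_ext fun j => ?_
  rw [Derivation.commutator_apply, Derivation.smul_apply, xDPlus_apply_X, xDPlus_apply_X,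
    xDPlus_apply_X]
  have h1 : xDPlus R (Finsupp.single k (m + 1)) k (monomial α (1 : R)) =
      (α k : ℤ) • monomial (α + Finsupp.single k m) (1 : R) := by
    rw [xDPlus, Derivation.smul_apply, Finsupp.single_add, ← one_mul (1 : R), ← monomial_mul,
      smul_eq_mul, mul_assoc]
    change _ * (X k * _) = _
    rw [one_mul, X_mul_pderiv_monomial, mul_smul_comm, monomial_mul, one_mul, add_comm, natCast_zsmul]
  have h2 : xDPlus R α i (monomial (Finsupp.single k (m + 1)) (1 : R)) =
      (((m : ℤ) + 1) * kron i k) • monomial (α + Finsupp.single k m) (1 : R) := by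
    rw [xDPlus, Derivation.smul_apply]
    by_cases h : i = k
    · subst h
      rw [pderiv_monomial_single, smul_eq_mul, monomial_mul, kron, if_pos rfl, one_mul, one_mul,
        mul_one]
      simp only [← Int.cast_smul_eq_zsmul R, smul_monomial]
      simp
    · rw [pderiv_monomial, Finsupp.single_apply, if_neg (Ne.symm h), kron, if_neg h]
      simp
  have h3 : ∀ x y : MvPolynomial (Fin n) R, ∀ D : WPlus R n, D (if j = i then x else 0) =
    if j = i then D x else 0 := fun x y D => by split_ifs <;> simp
  by_cases hj : j = i
  · subst hj
    rw [if_pos rfl, if_pos rfl, h1]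
    by_cases hk : j = k
    · rw [if_pos hk, h2, sub_smul]
    · rw [if_neg hk, map_zero, sub_zero, kron, if_neg hk]; simp
  · rw [if_neg hj, if_neg hj, map_zero, smul_zero, zero_sub, neg_eq_zero]
    by_cases hk : j = k
    · have hik : i ≠ k := fun h => hj (hk.trans h.symm)
      rw [if_pos hk, h2, kron, if_neg hik, mul_zero, zero_smul]
    · rw [if_neg hk, map_zero]

end

section

variable {n : ℕ} (k : Fin n)

/-- The divided powers of the adjoint action of `x_k² D_k` on `W⁺`. -/
def divAdPlus (ℓ : ℕ) : WPlus ℤ n →ₗ[ℤ] WPlus ℤ n :=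
  (basisPlus ℤ n).constr ℤ fun s =>
    coeffC (s.2 k) s.1 k ℓ • xDPlus ℤ (s.2 + Finsupp.single k ℓ) s.1

theorem divAdPlus_xDPlus (ℓ : ℕ) (α : Fin n →₀ ℕ) (i : Fin n) :
    divAdPlus k ℓ (xDPlus ℤ α i) = coeffC (α k) i k ℓ • xDPlus ℤ (α + Finsupp.single k ℓ) i := by
  rw [← basisPlus_apply ⟨i, α⟩, divAdPlus, Module.Basis.constr_basis]

theorem factorial_smul_divAdPlus (ℓ : ℕ) (x : WPlus ℤ n) :
    ℓ ! • divAdPlus k ℓ x = (fun y => ⁅xDPlus ℤ (Finsupp.single k 2) k, y⁆)^[ℓ] x := by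
  induction ℓ generalizing x with
  | zero =>
    have : divAdPlus k 0 = LinearMap.id := (basisPlus ℤ n).ext fun s => by
      rw [basisPlus_apply, divAdPlus_xDPlus, coeffC_zero]; simp
    simp [this]
  | succ ℓ ih =>
    have : ∀ x, (ℓ + 1) • divAdPlus k (ℓ + 1) x =
        ⁅xDPlus ℤ (Finsupp.single k 2) k, divAdPlus k ℓ x⁆ := fun x => by
      have h : (ℓ + 1) • divAdPlus k (ℓ + 1) =
          (LieAlgebra.ad ℤ _ (xDPlus ℤ (Finsupp.single k 2) k)).comp (divAdPlus k ℓ) :=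
        (basisPlus ℤ n).ext fun s => by
          rw [basisPlus_apply, LinearMap.smul_apply, LinearMap.comp_apply, divAdPlus_xDPlus,
            divAdPlus_xDPlus, LieAlgebra.ad_apply, lie_smul, lie_xDPlus_single 1, smul_smul,
            ← natCast_zsmul, smul_smul, add_assoc, ← Finsupp.single_add]
          congr 1
          have := coeffC_succ (s.2 k) s.1 k ℓ
          push_cast
          rw [this]
          rw [Pi.add_apply, Finsupp.single_eq_same]
          push_cast; ring
      exact LinearMap.congr_fun h x
    rw [Nat.factorial_succ, mul_comm, mul_smul, this, Function.iterate_succ_apply', ← ih]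
    have hn : ∀ (m : ℕ) (x y : WPlus ℤ n), m • ⁅x, y⁆ = ⁅x, m • y⁆ := fun m x y =>
      Derivation.ext fun f => by
        simp only [Derivation.smul_apply, Derivation.commutator_apply, map_nsmul, smul_sub]
    exact hn _ _ _

/-- The weight of `x^α D_i` for the adjoint action of `x_k D_k`. -/
def wtPlus (s : Σ _ : Fin n, Fin n →₀ ℕ) : ℤ := (s.2 k : ℤ) - kron s.1 k

theorem xDPlus_mem (α : Fin n →₀ ℕ) (i : Fin n) {w : ℤ} (h : (α k : ℤ) - kron i k = w) :
    xDPlus ℤ α i ∈ weightSpace (basisPlus ℤ n) (wtPlus k) w :=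
  Submodule.subset_span ⟨⟨i, α⟩, h, basisPlus_apply _⟩

/-- The Jordanian datum of `W⁺` given by `h = x_k D_k` and `e = x_k² D_k`. -/
def datumPlus : JordanianDatum ℤ (WPlus ℤ n) (Σ _ : Fin n, Fin n →₀ ℕ) :=
  .ofAd (basisPlus ℤ n) (wtPlus k) (xDPlus ℤ (Finsupp.single k 1) k)
    (xDPlus ℤ (Finsupp.single k 2) k) (divAdPlus k)
    (fun s => by
      rw [basisPlus_apply, lie_xDPlus_single 0]
      simp [wtPlus])
    (xDPlus_mem k _ _ (by simp [kron]))
    (xDPlus_mem k _ _ (by simp [kron]))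
    (factorial_smul_divAdPlus k)
    (fun ℓ s => by
      rw [basisPlus_apply, divAdPlus_xDPlus]
      refine Submodule.smul_mem _ _ (xDPlus_mem k _ _ ?_)
      simp only [wtPlus, Finsupp.add_apply, Finsupp.single_eq_same]
      push_cast; ring)

end

end Witt

/-! ### Transport of a datum along a morphism whose image spans. -/

namespace Env

open scoped Nat

variable {L ι' S L' κ : Type*} [LieRing L] [CommRing S] [LieRing L'] [LieAlgebra S L']

theorem map_mem_weightSpace (b : Module.Basis ι' ℤ L) (wt : ι' → ℤ) (ϖ : L →+ L')
    (b' : Module.Basis κ S L') (wt' : κ → ℤ) (hW : ∀ i, ϖ (b i) ∈ weightSpace b' wt' (wt i)) {w : ℤ}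
    {x : L} (hx : x ∈ weightSpace b wt w) : ϖ x ∈ weightSpace b' wt' w := by
  induction hx using Submodule.span_induction with
  | mem x hx => obtain ⟨i, rfl, rfl⟩ := hx; exact hW i
  | zero => rw [map_zero]; exact Submodule.zero_mem _
  | add x y _ _ hx hy => rw [map_add]; exact Submodule.add_mem _ hx hy
  | smul m x _ hx => rw [map_zsmul]; exact zsmul_mem hx m

/-- The datum induced on a Lie algebra spanned by the image of a morphism of Lie rings. -/
def JordanianDatum.transfer (D : JordanianDatum ℤ L ι') (ϖ : L →+ L')
    (hlie : ∀ x y, ϖ ⁅x, y⁆ = ⁅ϖ x, ϖ y⁆) (b' : Module.Basis κ S L') (wt' : κ → ℤ)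
    (c : κ → S) (s : κ → ι') (hb : ∀ a, b' a = c a • ϖ (D.basis (s a)))
    (hwt : ∀ a, wt' a = D.wt (s a)) (hW : ∀ i, ϖ (D.basis i) ∈ weightSpace b' wt' (D.wt i))
    (h e : L') (hh : ϖ D.h = h) (he : ϖ D.e = e)
    (d : ℕ → L' →ₗ[S] L') (hd : ∀ ℓ x, ϖ (D.d ℓ x) = d ℓ (ϖ x)) : JordanianDatum S L' κ :=
  have hW' : ∀ {w x}, x ∈ D.piece w → ϖ x ∈ weightSpace b' wt' w :=
    map_mem_weightSpace D.basis D.wt ϖ b' wt' hW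
  have indW : ∀ {w : ℤ} {P : L' → Prop}, (∀ x ∈ D.piece w, P (ϖ x)) → P 0 →
      (∀ x y, P x → P y → P (x + y)) → (∀ (r : S) x, P x → P (r • x)) →
      ∀ x ∈ weightSpace b' wt' w, P x := fun {w P} h1 h2 h3 h4 x hx => by
    induction hx using Submodule.span_induction with
    | mem x hx =>
      obtain ⟨a, rfl, rfl⟩ := hx
      rw [hb]
      refine h4 _ _ (h1 _ ?_)
      rw [hwt]
      exact D.basis_mem _
    | zero => exact h2
    | add x y _ _ hx hy => exact h3 _ _ hx hy
    | smul r x _ hx => exact h4 _ _ hx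
  -- All the axioms are linear in each argument and the basis consists of scalar multiples of
  -- images, so they need only be checked on images.
  have ind : ∀ {P : L' → Prop}, (∀ x, P (ϖ x)) → P 0 →
      (∀ x y, P x → P y → P (x + y)) → (∀ (r : S) x, P x → P (r • x)) →
      ∀ x, P x := fun {P} h1 h2 h3 h4 x => by
    have hx : x ∈ Submodule.span S (Set.range b') := by simp
    induction hx using Submodule.span_induction with
    | mem x hx =>
      obtain ⟨a, rfl⟩ := hx
      rw [hb]
      exact h4 _ _ (h1 _)
    | zero => exact h2
    | add x y _ _ hx hy => exact h3 _ _ hx hy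
    | smul r x _ hx => exact h4 _ _ hx
  { basis := b'
    wt := wt'
    h := h
    e := e
    d := d
    lie_mem := fun {w v x y} hx hy => by
      refine indW (P := fun x => ⁅x, y⁆ ∈ weightSpace b' wt' (w + v)) (fun x hx => ?_) (by simp) (fun x x' hx hx' => ?_)
        (fun r x hx => ?_) x hx
      · refine indW (P := fun y => ⁅ϖ x, y⁆ ∈ weightSpace b' wt' (w + v)) (fun y hy => ?_) (by simp)
          (fun y y' hy hy' => ?_) (fun r y hy => ?_) y hy
        · rw [← hlie]; exact hW' (D.lie_mem hx hy)
        · rw [lie_add]; exact Submodule.add_mem _ hy hy'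
        · rw [lie_smul]; exact Submodule.smul_mem _ _ hy
      · rw [add_lie]; exact Submodule.add_mem _ hx hx'
      · rw [smul_lie]; exact Submodule.smul_mem _ _ hx
    d_mem := fun {w x} ℓ hx => by
      refine indW (P := fun x => d ℓ x ∈ weightSpace b' wt' (w + ℓ)) (fun x hx => ?_) (by simp) (fun x x' hx hx' => ?_)
        (fun r x hx => ?_) x hx
      · rw [← hd]; exact hW' (D.d_mem ℓ hx)
      · rw [map_add]; exact Submodule.add_mem _ hx hx'
      · rw [map_smul]; exact Submodule.smul_mem _ _ hx
    h_mem := hh ▸ hW' D.h_mem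
    e_mem := he ▸ hW' D.e_mem
    h_lie := fun {w x} hx => by
      refine indW (P := fun x => ⁅h, x⁆ = w • x) (fun x hx => ?_) (by simp) (fun x x' hx hx' => ?_)
        (fun r x hx => ?_) x hx
      · rw [← hh, ← hlie, D.h_lie hx, map_zsmul]
      · rw [lie_add, hx, hx', smul_add]
      · rw [lie_smul, hx, smul_comm]
    d_zero := ind (fun x => by rw [← hd, D.d_zero]) (map_zero _)
      (fun x x' hx hx' => by rw [map_add, hx, hx']) fun r x hx => by rw [map_smul, hx]
    d_one := ind (fun x => by rw [← hd, D.d_one, hlie, he]) (by simp)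
      (fun x x' hx hx' => by rw [map_add, hx, hx', lie_add])
      fun r x hx => by rw [map_smul, hx, lie_smul]
    d_d := fun m ℓ => ind (fun x => by rw [← hd, ← hd, D.d_d, map_nsmul, hd]) (by simp)
      (fun x x' hx hx' => by simp only [map_add, hx, hx', smul_add])
      fun r x hx => by simp only [map_smul, hx, smul_comm r]
    d_lie := fun N x y => by
      refine ind (P := fun x => d N ⁅x, y⁆ = ∑ ij ∈ Finset.HasAntidiagonal.antidiagonal N,
        ⁅d ij.1 x, d ij.2 y⁆) (fun x => ?_) (by simp) (fun x x' hx hx' => ?_) (fun r x hx => ?_) x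
      · refine ind (P := fun y => d N ⁅ϖ x, y⁆ = ∑ ij ∈ Finset.HasAntidiagonal.antidiagonal N,
          ⁅d ij.1 (ϖ x), d ij.2 y⁆) (fun y => ?_) (by simp) (fun y y' hy hy' => ?_)
          (fun r y hy => ?_) y
        · simp only [← hlie, ← hd, D.d_lie, map_sum]
        · simp only [lie_add, map_add, hy, hy', Finset.sum_add_distrib]
        · simp only [lie_smul, map_smul, hy, Finset.smul_sum]
      · simp only [add_lie, map_add, hx, hx', Finset.sum_add_distrib]
      · simp only [smul_lie, map_smul, hx, Finset.smul_sum]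
    d_e := fun ℓ => by rw [← he, ← hd, D.d_e, map_zero]
    d_h := fun ℓ => by rw [← hh, ← hd, D.d_h, map_zero] }

end Env

/-! ### Divided powers as a reduction of integral polynomials. -/

namespace DivPow

open scoped Nat

variable {p n : ℕ} {K : Type*}

theorem dpow_eq_zero [CommRing K] {α : Fin n → ℕ} {j : Fin n} (h : p ≤ α j) :
    dpow p K α = 0 := by
  ext γ
  rw [dpow, if_neg fun h' => ?_, zero_apply]
  have := h' j
  have := (γ j).2
  omega

theorem dpow_apply [CommRing K] (α γ : Fin n → Fin p) :
    dpow p K (fun i => (α i : ℕ)) γ = if γ = α then 1 else 0 := by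
  rw [dpow]
  simp only [Fin.val_inj, funext_iff]

theorem exists_of_lt {α : Fin n → ℕ} (h : ∀ j, α j < p) :
    ∃ γ : Fin n → Fin p, α = fun i => (γ i : ℕ) := ⟨fun j => ⟨α j, h j⟩, rfl⟩

/-- The basis `x^(γ)`. -/
def basis (p n : ℕ) (K : Type*) [CommRing K] :
    Module.Basis (Fin n → Fin p) K (DivPow p n K) :=
  .ofEquivFun
    { toFun := fun f => f
      invFun := fun f => f
      map_add' := fun _ _ => rfl
      map_smul' := fun _ _ => rfl }

theorem basis_apply [CommRing K] (γ : Fin n → Fin p) :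
    basis p n K γ = dpow p K (fun i => (γ i : ℕ)) := by
  ext δ
  rw [dpow_apply, basis, Module.Basis.coe_ofEquivFun]
  exact Pi.single_apply _ _ _

theorem dpow_mul [CommRing K] [hp : Fact p.Prime] (α β : Fin n → ℕ) :
    dpow p K α * dpow p K β = ((∏ i, (α i + β i).choose (α i) : ℕ) : K) • dpow p K (α + β) := by
  by_cases hα : ∀ j, α j < p
  · by_cases hβ : ∀ j, β j < p
    · obtain ⟨α, rfl⟩ := exists_of_lt hα
      obtain ⟨β, rfl⟩ := exists_of_lt hβ
      ext γ
      rw [mul_apply, Finset.sum_eq_single_of_mem α (Finset.mem_univ _),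
        Finset.sum_eq_single_of_mem β (Finset.mem_univ _), dpow_apply, dpow_apply, if_pos rfl,
        if_pos rfl, mul_one, mul_one, smul_apply, dpow, mul_ite, mul_one, mul_zero, mulCoeff]
      · split_ifs with h
        · refine congrArg _ (Finset.prod_congr rfl fun i _ => ?_)
          exact if_pos (h i).symm
        · push Not at h
          obtain ⟨i, hi⟩ := h
          rw [Finset.prod_eq_zero (Finset.mem_univ i), Nat.cast_zero]
          exact if_neg (Ne.symm hi)
      · intro b _ hb
        rw [dpow_apply β, if_neg hb, mul_zero, mul_zero]
      · intro a _ ha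
        refine Finset.sum_eq_zero fun b _ => ?_
        rw [dpow_apply α, if_neg ha, zero_mul, mul_zero]
    · push Not at hβ
      obtain ⟨j, hj⟩ := hβ
      rw [dpow_eq_zero hj, dpow_eq_zero (α := α + β) (j := j) (le_add_left hj), mul_zero, smul_zero]
  · push Not at hα
    obtain ⟨j, hj⟩ := hα
    rw [dpow_eq_zero hj, dpow_eq_zero (α := α + β) (j := j) (le_add_right hj), zero_mul, smul_zero]

theorem deriv_dpow_single [CommRing K] [hp : Fact p.Prime] [CharP K p] (i j : Fin n) :
    deriv i (dpow p K (Pi.single j 1)) = if i = j then 1 else 0 := by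
  have hp1 := hp.out.one_lt
  obtain ⟨α, hα⟩ := exists_of_lt (p := p) (α := Pi.single j 1) fun l => by
    rw [Pi.single_apply]; split_ifs <;> omega
  have hα' : ∀ l, (α l : ℕ) = if l = j then 1 else 0 := fun l => by
    rw [← Pi.single_apply, hα]
  ext γ
  change derivLin i _ γ = _
  rw [derivLin_apply, hα, Finset.sum_eq_single_of_mem α (Finset.mem_univ _), dpow_apply, if_pos rfl,
    mul_one, derCoeff]
  · by_cases hij : i = j
    · subst hij
      rw [if_pos rfl, one_apply]
      split_ifs with hγ
      · rw [Finset.prod_eq_one, Nat.cast_one]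
        intro l _
        by_cases hl : l = i
        · simp [hl, dc, hα', hγ]
        · simp [hl, hα', hγ, Fin.ext_iff]
      · push Not at hγ
        obtain ⟨l, hl⟩ := hγ
        rw [Finset.prod_eq_zero (Finset.mem_univ l), Nat.cast_zero]
        by_cases hli : l = i
        · subst hli; simp [dc, hα', hl]
        · simp [hli, hα', Fin.ext_iff, Ne.symm hl]
    · rw [if_neg hij, zero_apply, Finset.prod_eq_zero (Finset.mem_univ i), Nat.cast_zero]
      simp [dc, hα', hij]
  · intro b _ hb
    rw [dpow_apply, if_neg hb, mul_zero]

section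

variable [Field K] [hp : Fact p.Prime]

/-- The ring homomorphism from integral polynomials to the divided power algebra with
`x_j ↦ x^(ε_j)`. -/
def ofPoly (p n : ℕ) (K : Type*) [Field K] [Fact p.Prime] :
    MvPolynomial (Fin n) ℤ →+* DivPow p n K :=
  MvPolynomial.eval₂Hom (Int.castRingHom _) fun j => dpow p K (Pi.single j 1)

theorem ofPoly_X (j : Fin n) : ofPoly p n K (MvPolynomial.X j) = dpow p K (Pi.single j 1) :=
  MvPolynomial.eval₂Hom_X' _ _ _

/-- The binomials in the product of divided powers match (α + β)! / (α! β!), so the formula is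
stable under adding exponents. It also holds with some α_j ≥ p, where x^(α) = 0. -/
theorem ofPoly_monomial (α : Fin n →₀ ℕ) :
    ofPoly p n K (MvPolynomial.monomial α 1) = ((∏ j, (α j)! : ℕ) : K) • dpow p K α := by
  have hadd : ∀ α β : Fin n →₀ ℕ,
      ofPoly p n K (MvPolynomial.monomial α 1) = ((∏ j, (α j)! : ℕ) : K) • dpow p K α →
      ofPoly p n K (MvPolynomial.monomial β 1) = ((∏ j, (β j)! : ℕ) : K) • dpow p K β →
      ofPoly p n K (MvPolynomial.monomial (α + β) 1) =
        ((∏ j, ((α + β) j)! : ℕ) : K) • dpow p K ⇑(α + β) := fun α β hα hβ => by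
    rw [← one_mul (1 : ℤ), ← MvPolynomial.monomial_mul, map_mul, hα, hβ, smul_mul_smul_comm,
      dpow_mul, smul_smul, ← Nat.cast_mul, ← Nat.cast_mul, ← Finset.prod_mul_distrib,
      ← Finset.prod_mul_distrib, Finsupp.coe_add]
    congr 3
    funext j
    change _ = (α j + β j)!
    rw [← Nat.add_choose_mul_factorial_mul_factorial, Nat.choose_symm_add]
    ring
  induction α using Finsupp.induction_linear with
  | zero => simp; rfl
  | add α β hα hβ => exact hadd α β hα hβ
  | single j m =>
    induction m with
    | zero => simp; rfl
    | succ m ih =>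
      rw [Finsupp.single_add]
      refine hadd _ _ ih ?_
      rw [Finset.prod_eq_one, Nat.cast_one, one_smul, Finsupp.single_eq_pi_single]
      · exact ofPoly_X j
      · intro i _
        rw [Finsupp.single_apply]; split_ifs <;> rfl

theorem factorial_ne_zero [CharP K p] (γ : Fin n → Fin p) :
    ((∏ j, (γ j : ℕ)! : ℕ) : K) ≠ 0 := by
  rw [Ne, CharP.cast_eq_zero_iff K p, hp.out.prime.dvd_finsetProd_iff]
  rintro ⟨j, _, hj⟩
  exact absurd ((hp.out.dvd_factorial).mp hj) (not_le.mpr (γ j).2)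

/-- Each x^(γ) is the image of a monomial divided by γ!, which is nonzero in K because every γ_j <
p. A derivation is hence determined by its values on the x^(ε_j). -/
theorem adjoin_single [CharP K p] :
    Algebra.adjoin K (Set.range fun j : Fin n => dpow p K (Pi.single j 1)) = ⊤ := by
  set S := Algebra.adjoin K (Set.range fun j : Fin n => dpow p K (Pi.single j 1))
  have h1 : ∀ f, ofPoly p n K f ∈ S := fun f => by
    induction f using MvPolynomial.induction_on with
    | C z => rw [ofPoly, MvPolynomial.coe_eval₂Hom, MvPolynomial.eval₂_C]; exact intCast_mem S z
    | add f g hf hg => rw [map_add]; exact add_mem hf hg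
    | mul_X f j hf =>
      rw [map_mul, ofPoly_X]; exact mul_mem hf (Algebra.subset_adjoin ⟨j, rfl⟩)
  have h2 : Submodule.span K (Set.range (basis p n K)) ≤ Subalgebra.toSubmodule S := by
    rw [Submodule.span_le]
    rintro _ ⟨γ, rfl⟩
    have := h1 (MvPolynomial.monomial (Finsupp.equivFunOnFinite.symm fun j => (γ j : ℕ)) 1)
    rw [ofPoly_monomial] at this
    have h3 := S.smul_mem this ((∏ j, (γ j : ℕ)! : ℕ) : K)⁻¹
    rw [smul_smul] at h3
    simp only [Finsupp.coe_equivFunOnFinite_symm] at h3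
    rw [inv_mul_cancel₀ (factorial_ne_zero γ), one_smul, ← basis_apply] at h3
    exact h3
  rw [(basis p n K).span_eq] at h2
  exact eq_top_iff.mpr fun x _ => h2 trivial

theorem derivation_ext [CharP K p] {D E : Derivation K (DivPow p n K) (DivPow p n K)}
    (h : ∀ j, D (dpow p K (Pi.single j 1)) = E (dpow p K (Pi.single j 1))) : D = E := by
  refine Derivation.ext_of_adjoin_eq_top _ adjoin_single ?_
  rintro _ ⟨j, rfl⟩
  exact h j

end

end DivPow

/-! ### The Jacobson-Witt algebra as the reduction of the integral form. -/

namespace Witt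

open Env DivPow
open scoped Nat

variable {p n : ℕ} {K : Type*} [Field K] [hp : Fact p.Prime]

theorem sum_apply (D : Fin n → JW p n K) (f : DivPow p n K) : (∑ j, D j) f = ∑ j, D j f :=
  map_sum (⟨⟨fun D : JW p n K => D f, rfl⟩, fun _ _ => rfl⟩ : JW p n K →+ DivPow p n K) _ _

variable [CharP K p]

theorem xD_eq_zero {α : Fin n → ℕ} {j : Fin n} (h : p ≤ α j) (i : Fin n) : xD p K α i = 0 := by
  rw [xD, dpow_eq_zero h, zero_smul]

theorem xD_apply_single (α : Fin n → ℕ) (i j : Fin n) :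
    xD p K α i (dpow p K (Pi.single j 1)) = if j = i then dpow p K α else 0 := by
  rw [xD, Derivation.smul_apply, deriv_dpow_single, smul_eq_mul, mul_ite, mul_one, mul_zero]
  simp only [eq_comm]

variable (p n K) in
/-- The Jacobson-Witt algebra is free over the divided power algebra on the `D_i`. -/
def equivJW : (Fin n → DivPow p n K) ≃ₗ[K] JW p n K where
  toFun g := ∑ j, g j • DivPow.deriv j
  invFun D := fun j => D (dpow p K (Pi.single j 1))
  map_add' g g' := by simp only [Pi.add_apply, add_smul, Finset.sum_add_distrib]
  map_smul' r g := by simp only [Pi.smul_apply, smul_assoc, Finset.smul_sum, RingHom.id_apply]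
  left_inv g := by
    funext j
    change (∑ j, g j • DivPow.deriv j : JW p n K) (dpow p K (Pi.single j 1)) = g j
    rw [sum_apply, Finset.sum_eq_single_of_mem j (Finset.mem_univ j)]
    · rw [Derivation.smul_apply, deriv_dpow_single, if_pos rfl, smul_eq_mul, mul_one]
    · intro i _ hi
      rw [Derivation.smul_apply, deriv_dpow_single, if_neg hi, smul_zero]
  right_inv D := by
    refine DivPow.derivation_ext fun j => ?_
    change (∑ j, D (dpow p K (Pi.single j 1)) • DivPow.deriv j : JW p n K) _ = _
    rw [sum_apply, Finset.sum_eq_single_of_mem j (Finset.mem_univ j)]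
    · rw [Derivation.smul_apply, deriv_dpow_single, if_pos rfl, smul_eq_mul, mul_one]
    · intro i _ hi
      rw [Derivation.smul_apply, deriv_dpow_single, if_neg hi, smul_zero]

variable (p n K) in
/-- The basis `x^(γ) D_i` of `W(n; 1)`, indexed by the pairs `⟨i, γ⟩`. -/
def basisJW : Module.Basis (Σ _ : Fin n, Fin n → Fin p) K (JW p n K) :=
  (Pi.basis fun _ : Fin n => DivPow.basis p n K).map (equivJW p n K)

theorem basisJW_apply (s : Σ _ : Fin n, Fin n → Fin p) :
    basisJW p n K s = xD p K (fun j => (s.2 j : ℕ)) s.1 := by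
  rw [basisJW, Module.Basis.map_apply, ← (equivJW p n K).symm.injective.eq_iff,
    LinearEquiv.symm_apply_apply]
  funext j
  change _ = xD p K _ _ (dpow p K (Pi.single j 1))
  rw [xD_apply_single, Pi.basis_apply, Pi.single_apply, DivPow.basis_apply]

theorem toJW_aux (g : Fin n → DivPow p n K) (j : Fin n) :
    equivJW p n K g (dpow p K (Pi.single j 1)) = g j :=
  congrFun ((equivJW p n K).symm_apply_apply g) j

variable (p n K) in
/-- The additive map `W⁺ → W(n; 1)` induced by the reduction of polynomials. -/
def toJW : WPlus ℤ n →+ JW p n K where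
  toFun D := equivJW p n K fun j => ofPoly p n K (D (MvPolynomial.X j))
  map_zero' := by
    refine DivPow.derivation_ext fun j => ?_
    rw [toJW_aux]; simp
  map_add' D E := by
    refine DivPow.derivation_ext fun j => ?_
    rw [Derivation.add_apply, toJW_aux, toJW_aux, toJW_aux, Derivation.add_apply, map_add]

theorem toJW_apply_single (D : WPlus ℤ n) (j : Fin n) :
    toJW p n K D (dpow p K (Pi.single j 1)) = ofPoly p n K (D (MvPolynomial.X j)) :=
  toJW_aux _ j

/-- The reduced derivation intertwines with the original one on all polynomials, by the Leibniz
rule. Compatibility with brackets follows on generators. -/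
theorem toJW_apply_ofPoly (D : WPlus ℤ n) (f : MvPolynomial (Fin n) ℤ) :
    toJW p n K D (ofPoly p n K f) = ofPoly p n K (D f) := by
  induction f using MvPolynomial.induction_on with
  | C z =>
    rw [MvPolynomial.derivation_C, map_zero, ofPoly, MvPolynomial.coe_eval₂Hom,
      MvPolynomial.eval₂_C, eq_intCast, Derivation.map_intCast]
  | add f g hf hg => rw [map_add, map_add, map_add, map_add, hf, hg]
  | mul_X f j hf =>
    rw [map_mul, Derivation.leibniz, hf, ofPoly_X, toJW_apply_single, Derivation.leibniz, map_add,
      smul_eq_mul, smul_eq_mul, smul_eq_mul, smul_eq_mul, map_mul, map_mul, ofPoly_X]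

theorem toJW_lie (D E : WPlus ℤ n) : toJW p n K ⁅D, E⁆ = ⁅toJW p n K D, toJW p n K E⁆ := by
  refine DivPow.derivation_ext fun j => ?_
  rw [Derivation.commutator_apply, toJW_apply_single, toJW_apply_single, toJW_apply_single,
    toJW_apply_ofPoly, toJW_apply_ofPoly, Derivation.commutator_apply, map_sub]

theorem toJW_xDPlus (α : Fin n →₀ ℕ) (i : Fin n) :
    toJW p n K (xDPlus ℤ α i) = ((∏ j, (α j)! : ℕ) : K) • xD p K α i := by
  refine DivPow.derivation_ext fun j => ?_
  rw [toJW_apply_single, xDPlus_apply_X, Derivation.smul_apply, xD_apply_single]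
  split_ifs
  · rw [ofPoly_monomial]
  · rw [map_zero, smul_zero]

variable (p K) (k : Fin n)

/-- The linear maps of `W(n; 1)` induced by the divided powers of the adjoint action of `x_k² D_k`
on `W⁺`. -/
def divAd (ℓ : ℕ) : JW p n K →ₗ[K] JW p n K :=
  (basisJW p n K).constr K fun s =>
    coeffCbar K (s.2 k) s.1 k ℓ • xD p K ((fun j => (s.2 j : ℕ)) + Pi.single k ℓ) s.1

theorem divAd_xD (ℓ : ℕ) (α : Fin n → ℕ) (i : Fin n) :
    divAd p K k ℓ (xD p K α i) = coeffCbar K (α k) i k ℓ • xD p K (α + Pi.single k ℓ) i := by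
  by_cases hα : ∀ j, α j < p
  · obtain ⟨γ, rfl⟩ := exists_of_lt hα
    rw [← basisJW_apply ⟨i, γ⟩, divAd, Module.Basis.constr_basis]
  · push Not at hα
    obtain ⟨j, hj⟩ := hα
    rw [xD_eq_zero hj, xD_eq_zero (j := j) (le_add_right hj), map_zero, smul_zero]

/-- The factor between C̄_ℓ and C_ℓ is the ratio (α + ℓ ε_k)! / α! = ℓ! (α_k + ℓ choose ℓ) of the
scalars in the reduction morphism. -/
theorem toJW_divAdPlus (ℓ : ℕ) (x : WPlus ℤ n) :
    toJW p n K (divAdPlus k ℓ x) = divAd p K k ℓ (toJW p n K x) := by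
  have h : (toJW p n K).toIntLinearMap ∘ₗ divAdPlus k ℓ =
      (divAd p K k ℓ).toAddMonoidHom.toIntLinearMap ∘ₗ (toJW p n K).toIntLinearMap :=
    (basisPlus ℤ n).ext fun s => by
      change toJW p n K (divAdPlus k ℓ _) = divAd p K k ℓ (toJW p n K _)
      rw [basisPlus_apply, divAdPlus_xDPlus, map_zsmul, toJW_xDPlus, toJW_xDPlus, map_smul,
        divAd_xD, ← Int.cast_smul_eq_zsmul K, smul_smul, smul_smul, Finsupp.coe_add,
        Finsupp.single_eq_pi_single]
      congr 1
      have hprod : ∏ j, (s.2 j + (Pi.single k ℓ : Fin n → ℕ) j)! =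
          (∏ j, (s.2 j)!) * (ℓ ! * (s.2 k + ℓ).choose ℓ) := by
        rw [← Finset.mul_prod_erase _ _ (Finset.mem_univ k),
          ← Finset.mul_prod_erase _ (fun j => (s.2 j)!) (Finset.mem_univ k), Pi.single_eq_same,
          ← Nat.add_choose_mul_factorial_mul_factorial,
          Finset.prod_congr rfl (g := fun j => (s.2 j)!) fun j hj => by
            rw [Pi.single_eq_of_ne (Finset.ne_of_mem_erase hj), add_zero]]
        ring
      simp only [Pi.add_apply]
      rw [hprod, coeffCbar, coeffC]
      push_cast
      ring
  exact LinearMap.congr_fun h x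

/-- The weight of `x^(γ) D_i` for the adjoint action of `x_k D_k`. -/
def wtJW (s : Σ _ : Fin n, Fin n → Fin p) : ℤ := ((s.2 k : ℕ) : ℤ) - kron s.1 k

theorem xD_mem (α : Fin n → ℕ) (i : Fin n) {w : ℤ} (h : (α k : ℤ) - kron i k = w) :
    xD p K α i ∈ weightSpace (basisJW p n K) (wtJW p k) w := by
  by_cases hα : ∀ j, α j < p
  · obtain ⟨γ, rfl⟩ := exists_of_lt hα
    exact Submodule.subset_span ⟨⟨i, γ⟩, h, basisJW_apply _⟩
  · push Not at hα
    obtain ⟨j, hj⟩ := hα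
    rw [xD_eq_zero hj]
    exact Submodule.zero_mem _

theorem prod_factorial_single (m : ℕ) : ∏ j, ((Pi.single k m : Fin n → ℕ) j)! = m ! := by
  rw [Finset.prod_eq_single_of_mem k (Finset.mem_univ k), Pi.single_eq_same]
  intro j _ hj
  rw [Pi.single_eq_of_ne hj, Nat.factorial_zero]

theorem toJW_basisPlus_mem (s : Σ _ : Fin n, Fin n →₀ ℕ) :
    toJW p n K ((datumPlus k).basis s) ∈
      weightSpace (basisJW p n K) (wtJW p k) ((datumPlus k).wt s) := by
  change toJW p n K (basisPlus ℤ n s) ∈ _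
  rw [basisPlus_apply, toJW_xDPlus]
  exact Submodule.smul_mem _ _ (xD_mem p K k _ _ rfl)

theorem toJW_single_one :
    toJW p n K (xDPlus ℤ (Finsupp.single k 1) k) = xD p K (Pi.single k 1) k := by
  rw [toJW_xDPlus, Finsupp.single_eq_pi_single, prod_factorial_single]
  simp

/-- The coefficient of `e` in W(n; 1) is 2! from the reduction of x_k² D_k. -/
theorem toJW_single_two :
    toJW p n K (xDPlus ℤ (Finsupp.single k 2) k) = (2 : K) • xD p K (Pi.single k 2) k := by
  rw [toJW_xDPlus, Finsupp.single_eq_pi_single, prod_factorial_single]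
  simp

/-- The Jordanian datum of `W(n; 1)` given by `h = x^(ε_k) D_k` and `e = 2 x^(2 ε_k) D_k`. -/
def datumJW : JordanianDatum K (JW p n K) (Σ _ : Fin n, Fin n → Fin p) :=
  (datumPlus k).transfer (toJW p n K) toJW_lie (basisJW p n K) (wtJW p k)
    -- The vector x^(γ) D_i is (γ!)⁻¹ times the image of x^γ D_i.
    (fun s => ((∏ j, (s.2 j : ℕ)! : ℕ) : K)⁻¹)
    (fun s => ⟨s.1, Finsupp.equivFunOnFinite.symm fun j => (s.2 j : ℕ)⟩)
    (fun s => by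
      change _ = _ • toJW p n K (basisPlus ℤ n _)
      rw [basisPlus_apply, toJW_xDPlus, smul_smul]
      simp only [Finsupp.coe_equivFunOnFinite_symm]
      rw [inv_mul_cancel₀ (factorial_ne_zero s.2), one_smul, basisJW_apply])
    (fun _ => rfl) (toJW_basisPlus_mem p K k)
    (xD p K (Pi.single k 1) k) ((2 : K) • xD p K (Pi.single k 2) k)
    (toJW_single_one p K k) (toJW_single_two p K k)
    (divAd p K k) (toJW_divAdPlus p K k)

end Witt

/-! ### Induced morphisms of enveloping algebras, explicit formulas, and the theorem. -/

namespace Env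

open FormalAlg UniversalEnvelopingAlgebra

attribute [local instance 100] LieRing.ofAssociativeRing

/-- The ring homomorphism of enveloping algebras induced by a morphism of Lie rings. -/
def mapU {L S L' : Type*} [LieRing L] [CommRing S] [LieRing L'] [LieAlgebra S L'] (ϖ : L →+ L')
    (hlie : ∀ x y, ϖ ⁅x, y⁆ = ⁅ϖ x, ϖ y⁆) : U ℤ L →+* U S L' :=
  (lift ℤ (A := U S L')
    { toFun := fun x => ι S (ϖ x)
      map_add' := fun x y => by rw [map_add, map_add]
      map_smul' := fun m x => by rw [map_zsmul, map_zsmul]; rfl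
      map_lie' := fun {x y} => by rw [hlie, LieHom.map_lie] } : U ℤ L →ₐ[ℤ] U S L').toRingHom

theorem mapU_ι {L S L' : Type*} [LieRing L] [CommRing S] [LieRing L'] [LieAlgebra S L']
    (ϖ : L →+ L') (hlie : ∀ x y, ϖ ⁅x, y⁆ = ⁅ϖ x, ϖ y⁆) (x : L) :
    mapU (S := S) ϖ hlie (ι ℤ x) = ι S (ϖ x) :=
  lift_ι_apply _ _ _

theorem ptensor_smul_right {R A B : Type*} [CommRing R] [Ring A] [Algebra R A] [Ring B] [Algebra R B]
    (r : R) (f : A⟦X⟧) (g : B⟦X⟧) : ptensor R f (r • g) = r • ptensor R f g := by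
  rw [ptensor_eq, ptensor_eq, map_smul, mul_smul_comm]

namespace JordanianDatum

variable {R L ι' : Type*} [CommRing R] [LieRing L] [LieAlgebra R L] (D : JordanianDatum R L ι')

/-- The coproduct of a homogeneous element on which the divided powers act by scalars on given
vectors. -/
theorem hopf_comul_el_of_smul {w : ℤ} {x : L} (hx : x ∈ D.piece w) (c : ℕ → R) (y : ℕ → L)
    (hd : ∀ ℓ, D.d ℓ x = c ℓ • y ℓ) : D.hopf.comul (el R x) =
    ptensor R (el R x) (oneSubPow (inU R D.e) w) + formalSum fun ℓ => ((-1) ^ ℓ * c ℓ) •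
      ptensor R (cst (rising (inU R D.h) 0 ℓ)) (oneSubPow (inU R D.e) (-ℓ) * el R (y ℓ)) := by
  rw [D.hopf_comul_el hx]
  congr 1
  refine formalSum_congr fun ℓ => ?_
  rw [hd, el_smul, mul_smul_comm, ptensor_smul_right, smul_smul]

theorem hopf_antipode_el_of_smul {w : ℤ} {x : L} (hx : x ∈ D.piece w) (c : ℕ → R) (y : ℕ → L)
    (hd : ∀ ℓ, D.d ℓ x = c ℓ • y ℓ) : D.hopf.antipode (el R x) =
    -(oneSubPow (inU R D.e) (-w) * formalSum fun ℓ => c ℓ •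
      (el R (y ℓ) * cst (rising (inU R D.h) 1 ℓ))) := by
  rw [D.hopf_antipode_el hx]
  congr 2
  refine formalSum_congr fun ℓ => ?_
  rw [hd, el_smul, smul_mul_assoc]

end JordanianDatum

end Env

end
theorem theorem3p1 (p : ℕ) [Fact p.Prime] (K : Type*) [Field K] [CharP K p] (n : ℕ) (k : Fin n) :
    -- the two distinguished elements of `W(n; 1)`
    let h : JW p n K := xD p K (Pi.single k 1) k
    let e : JW p n K := (2 : K) • xD p K (Pi.single k 2) k
    -- the two distinguished elements of the integral form of `W⁺`
    let hZ : WPlus ℤ n := xDPlus ℤ (Finsupp.single k 1) k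
    let eZ : WPlus ℤ n := xDPlus ℤ (Finsupp.single k 2) k
    ⁅h, e⁆ = e ∧ ⁅hZ, eZ⁆ = eZ ∧
    ∃ (HZ : HopfU ℤ (WPlus ℤ n)) (H : HopfU K (JW p n K)),
      -- the quantization of `U(W(n; 1))`
      IsQuantization H ∧
      (∀ (α : Fin n → ℕ) (i : Fin n), (∀ j, α j < p) →
        H.comul (el K (xD p K α i)) =
            ptensor K (el K (xD p K α i))
              (oneSubPow (inU K e) ((α k : ℤ) - kron i k)) +
            ∑ ℓ ∈ Finset.range p, ((-1) ^ ℓ * coeffCbar K (α k) i k ℓ) •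
              (ptensor K (cst (rising (inU K h) 0 ℓ))
                (oneSubPow (inU K e) (-(ℓ : ℤ)) *
                  el K (xD p K (α + Pi.single k ℓ) i)) * PowerSeries.X ^ ℓ) ∧
        H.antipode (el K (xD p K α i)) =
            -(oneSubPow (inU K e) (-(α k : ℤ) + kron i k) *
              ∑ ℓ ∈ Finset.range p, coeffCbar K (α k) i k ℓ •
                (el K (xD p K (α + Pi.single k ℓ) i) *
                  cst (rising (inU K h) 1 ℓ) * PowerSeries.X ^ ℓ)) ∧
        H.counit (el K (xD p K α i)) = 0) ∧
      -- the quantization integral form in characteristic zero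
      IsQuantization HZ ∧
      (∀ (α : Fin n →₀ ℕ) (i : Fin n),
        HZ.comul (el ℤ (xDPlus ℤ α i)) =
            ptensor ℤ (el ℤ (xDPlus ℤ α i))
              (oneSubPow (inU ℤ eZ) ((α k : ℤ) - kron i k)) +
            formalSum (fun ℓ => ((-1) ^ ℓ * coeffC (α k) i k ℓ) •
              ptensor ℤ (cst (rising (inU ℤ hZ) 0 ℓ))
                (oneSubPow (inU ℤ eZ) (-(ℓ : ℤ)) *
                  el ℤ (xDPlus ℤ (α + Finsupp.single k ℓ) i))) ∧
        HZ.antipode (el ℤ (xDPlus ℤ α i)) =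
            -(oneSubPow (inU ℤ eZ) (-(α k : ℤ) + kron i k) *
              formalSum (fun ℓ => coeffC (α k) i k ℓ •
                (el ℤ (xDPlus ℤ (α + Finsupp.single k ℓ) i) *
                  cst (rising (inU ℤ hZ) 1 ℓ)))) ∧
        HZ.counit (el ℤ (xDPlus ℤ α i)) = 0) ∧
      -- the former is the reduction of the latter modulo `p` and modulo the ideal spanned by the
      -- `x^α D_i` with some `α j ≥ p`, under `x^α D_i ↦ α! x^(α) D_i`
      ∃ π : U ℤ (WPlus ℤ n) →+* U K (JW p n K),
        (∀ (α : Fin n →₀ ℕ) (i : Fin n),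
          π (inU ℤ (xDPlus ℤ α i)) =
            ((∏ j, (α j).factorial : ℕ) : K) • inU K (xD p K α i)) ∧
        IsInducedBy (Int.castRingHom K) π HZ H := by
  intro h e hZ eZ
  have hhZ : (datumPlus k).h = hZ := rfl
  have heZ : (datumPlus k).e = eZ := rfl
  have hh : (datumJW p K k).h = h := rfl
  have he : (datumJW p K k).e = e := rfl
  -- This truncates the infinite sums of the general construction at ℓ = p - 1.
  have zero_of_le : ∀ (α : Fin n → ℕ) (i : Fin n) (ℓ : ℕ), p ≤ ℓ →
      xD p K (α + Pi.single k ℓ) i = 0 := fun α i ℓ hℓ =>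
    xD_eq_zero (j := k) (by rw [Pi.add_apply, Pi.single_eq_same]; exact le_add_left hℓ) i
  refine ⟨?_, ?_, (datumPlus k).hopf, (datumJW p K k).hopf, (datumJW p K k).isQuantization, ?_,
    (datumPlus k).isQuantization, ?_, mapU (toJW p n K) toJW_lie, ?_, ?_⟩
  -- The relation [h, e] = e says that e has weight one.
  · exact ((datumJW p K k).h_lie (datumJW p K k).e_mem).trans (one_smul ℤ _)
  · exact ((datumPlus k).h_lie (datumPlus k).e_mem).trans (one_smul ℤ _)
  · intro α i _
    have hmem : xD p K α i ∈ (datumJW p K k).piece ((α k : ℤ) - kron i k) := xD_mem p K k α i rfl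
    have hd : ∀ ℓ, (datumJW p K k).d ℓ (xD p K α i) =
        coeffCbar K (α k) i k ℓ • xD p K (α + Pi.single k ℓ) i := fun ℓ => divAd_xD p K k ℓ α i
    refine ⟨?_, ?_, (datumJW p K k).hopf_counit_el _⟩
    · rw [(datumJW p K k).hopf_comul_el_of_smul hmem _ _ hd, formalSum_eq_sum_range _ p]
      · simp only [smul_mul_assoc, hh, he]
      · intro ℓ hℓ
        rw [zero_of_le α i ℓ hℓ, el_zero, mul_zero, ptensor_eq, map_zero, mul_zero, smul_zero]
    · rw [(datumJW p K k).hopf_antipode_el_of_smul hmem _ _ hd, formalSum_eq_sum_range _ p,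
        neg_sub', sub_neg_eq_add]
      · simp only [smul_mul_assoc, hh, he]
      · intro ℓ hℓ
        rw [zero_of_le α i ℓ hℓ, el_zero, zero_mul, smul_zero]
  · intro α i
    have hmem : xDPlus ℤ α i ∈ (datumPlus k).piece ((α k : ℤ) - kron i k) := xDPlus_mem k α i rfl
    have hd : ∀ ℓ, (datumPlus k).d ℓ (xDPlus ℤ α i) =
        coeffC (α k) i k ℓ • xDPlus ℤ (α + Finsupp.single k ℓ) i :=
      fun ℓ => divAdPlus_xDPlus k ℓ α i
    refine ⟨?_, ?_, (datumPlus k).hopf_counit_el _⟩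
    · exact (datumPlus k).hopf_comul_el_of_smul hmem _ _ hd
    · rw [(datumPlus k).hopf_antipode_el_of_smul hmem _ _ hd, neg_sub', sub_neg_eq_add]
      rfl
  · intro α i
    rw [mapU_ι, toJW_xDPlus, map_smul]
  · refine (datumPlus k).isInducedBy (datumJW p K k) (ϖ := toJW p n K) (fun r => ?_)
      (mapU_ι _ _) ?_ ?_ (toJW_divAdPlus p K k)
      (fun w x hx => map_mem_weightSpace _ _ _ _ _ (toJW_basisPlus_mem p K k) hx)
    · rw [eq_intCast, map_intCast, eq_intCast, map_intCast]
    · exact toJW_single_one p K k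
    · exact toJW_single_two p K k
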